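/- Let $\zeta$ be an indeterminate and put $$F(x,y,z)=(\zeta+2)xyz-\zeta(xy+yz+xz+x+y+z)+\zeta(2\zeta+1),$$ $$G(x,y)=(\zeta+2)xy(x+y)-\zeta(x^2+y^2)-2(\zeta^2+3\zeta+1)xy+\zeta(2\zeta+1)(x+y).$$ For an integer $n\ge 0$ let $$S_n(x_1,\dots,x_n,y_1,\dots,y_n,z)=\frac{\prod_{i,j=1}^nG(x_i,y_j)}{\prod_{1\le i<j\le n}(x_j-x_i)(y_j-y_i)}\,\det_{1\le i,j\le n}\left(\frac{F(x_i,y_j,z)}{G(x_i,y_j)}\right),$$ which is a polynomial in its $2n+1$ variables with coefficients in $\mathbb{Q}[\zeta]$. Write $\delta_n=\lfloor n^2/4\rfloor$. Let $$A_n=\frac{1!\,4!\,7!\cdots(3n-2)!}{n!\,(n+1)!\cdots(2n-1)!},\qquad C_n=\frac{2\cdot5\cdots(3n-1)}{1\cdot4\cdots(3n-2)}\,A_n$$ be the alternating sign matrix numbers and the cyclically symmetric plane partition numbers. For every $n\ge0$ there is a unique polynomial $p_n\in\mathbb{Q}[\zeta]$ such that $$\left(1+\tfrac\zeta2\right)^{n^2}S_n\Big(\underbrace{2\zeta+1,\dots,2\zeta+1}_{n+1},\underbrace{\tfrac{\zeta}{\zeta+2},\dots,\tfrac{\zeta}{\zeta+2}}_{n}\Big)=(-1)^{\binom{n+1}2}\zeta^{n^2}(1+\zeta)^{n^2}(1+2\zeta)^{\delta_n}\left(1+\tfrac\zeta2\right)^{\delta_{n-1}}p_n(\zeta).$$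 The polynomial $p_n$ has degree $n(n+1)/2$ and leading coefficient $2^{-\lfloor (n+2)/2\rfloor}\binom{2n+2}{n+1}$. Moreover, $$p_n(-1)=\begin{cases}-2^{\delta_{n+1}},&n\equiv1\bmod 4,\\ 2^{\delta_{n+1}},&\text{otherwise,}\end{cases}\qquad p_n(1)=2^{\delta_{n+1}}A_{n+1},$$ $$p_n(-2)=\begin{cases}A_{n+1},&n\text{ even},\\(-1)^{\frac{n+1}2}C_{n+1},&n\text{ odd},\end{cases}$$ $$p_n\left(-\tfrac12\right)=\begin{cases}2^{-\frac12(n^2+2n+2)}C_{n+1},&n\text{ even},\\(-1)^{\frac{n+1}2}2^{-\frac12(n+1)^2}A_{n+1},&n\text{ odd}.\end{cases}$$ -/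

import Mathlib

open Polynomial

namespace ThreeColour

/-- `F(x, y, z)`, depending on the parameter `ζ`. -/
def F {R : Type*} [CommRing R] (ζ x y z : R) : R :=
  (ζ + 2) * x * y * z - ζ * (x * y + y * z + x * z + x + y + z) + ζ * (2 * ζ + 1)

/-- `G(x, y)`, depending on the parameter `ζ`. -/
def G {R : Type*} [CommRing R] (ζ x y : R) : R :=
  (ζ + 2) * x * y * (x + y) - ζ * (x ^ 2 + y ^ 2) - 2 * (ζ ^ 2 + 3 * ζ + 1) * x * y
    + ζ * (2 * ζ + 1) * (x + y)

/-- Polynomials in `2n+1` variables with coefficients in `ℚ[ζ]`; the variable `ζ` is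
`Polynomial.X` and the `2n+1` variables are listed as `x₁, …, xₙ, y₁, …, yₙ, z`. -/
abbrev PolyRing (n : ℕ) : Type := MvPolynomial (Fin (2 * n + 1)) ℚ[X]

/-- The parameter `ζ`, as an element of `PolyRing n`. -/
noncomputable def zeta (n : ℕ) : PolyRing n := MvPolynomial.C Polynomial.X

/-- Position of `xᵢ` among the `2n+1` variables. -/
def ix {n : ℕ} (i : Fin n) : Fin (2 * n + 1) := ⟨i, by omega⟩

/-- Position of `yⱼ` among the `2n+1` variables. -/
def iy {n : ℕ} (j : Fin n) : Fin (2 * n + 1) := ⟨n + j, by omega⟩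

/-- Position of `z` among the `2n+1` variables. -/
def iz (n : ℕ) : Fin (2 * n + 1) := ⟨2 * n, by omega⟩

/-- The variable `xᵢ`. -/
noncomputable def x {n : ℕ} (i : Fin n) : PolyRing n := MvPolynomial.X (ix i)

/-- The variable `yⱼ`. -/
noncomputable def y {n : ℕ} (j : Fin n) : PolyRing n := MvPolynomial.X (iy j)

/-- The variable `z`. -/
noncomputable def z (n : ℕ) : PolyRing n := MvPolynomial.X (iz n)

/-- The determinantal expression defining `S_n`, as a rational function. -/
noncomputable def SFrac (n : ℕ) : FractionRing (PolyRing n) :=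
  algebraMap (PolyRing n) (FractionRing (PolyRing n)) (∏ i : Fin n, ∏ j : Fin n, G (zeta n) (x i) (y j)) /
    algebraMap (PolyRing n) (FractionRing (PolyRing n))
      (∏ i : Fin n, ∏ j ∈ Finset.Ioi i, ((x j - x i) * (y j - y i))) *
    (Matrix.of fun i j : Fin n =>
      algebraMap (PolyRing n) (FractionRing (PolyRing n)) (F (zeta n) (x i) (y j) (z n)) /
        algebraMap (PolyRing n) (FractionRing (PolyRing n)) (G (zeta n) (x i) (y j))).det

lemma G_ne_zero {n : ℕ} (i j : Fin n) : G (zeta n) (x i) (y j) ≠ 0 := by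
  intro h
  have h2 := congrArg (MvPolynomial.eval₂Hom (Polynomial.evalRingHom (0 : ℚ)) (fun _ => 1)) h
  simp [G, zeta, x, y] at h2
  norm_num at h2

lemma X_sub_X_irreducible {σ R : Type*} [CommRing R] [IsDomain R] {a b : σ} (hab : a ≠ b) :
    Irreducible (MvPolynomial.X b - MvPolynomial.X a : MvPolynomial σ R) := by
  classical
  have hc : MvPolynomial.coeff (Finsupp.single b 1)
      (MvPolynomial.X b - MvPolynomial.X a : MvPolynomial σ R) = 1 := by
    have h : Finsupp.single a 1 ≠ Finsupp.single b 1 := fun h =>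
      hab (Finsupp.single_left_injective one_ne_zero h)
    rw [MvPolynomial.coeff_sub, MvPolynomial.coeff_X, MvPolynomial.coeff_X, if_pos rfl, if_neg h,
      sub_zero]
  apply MvPolynomial.irreducible_of_totalDegree_eq_one
  · apply le_antisymm
    · refine (MvPolynomial.totalDegree_sub _ _).trans ?_
      simp
    · have := MvPolynomial.le_totalDegree (p := (MvPolynomial.X b - MvPolynomial.X a :
        MvPolynomial σ R)) (s := Finsupp.single b 1) (by
          rw [MvPolynomial.mem_support_iff, hc]; exact one_ne_zero)
      simpa using this
  · intro r hr
    have := hr (Finsupp.single b 1)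
    rw [hc] at this
    exact isUnit_of_dvd_one this

/-- A polynomial that vanishes when the variable `b` is set equal to `a` is divisible by
the difference of the two variables. -/
lemma X_sub_X_dvd {σ R : Type*} [CommRing R] [DecidableEq σ] (a b : σ) (f : MvPolynomial σ R)
    (hf : MvPolynomial.rename (fun c => if c = b then a else c) f = 0) :
    (MvPolynomial.X b - MvPolynomial.X a : MvPolynomial σ R) ∣ f := by
  let q := Ideal.Quotient.mkₐ R
    (Ideal.span {(MvPolynomial.X b - MvPolynomial.X a : MvPolynomial σ R)})
  have hq : q.comp (MvPolynomial.rename (fun c => if c = b then a else c)) = q := by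
    apply MvPolynomial.algHom_ext
    intro c
    simp only [AlgHom.comp_apply, MvPolynomial.rename_X]
    split_ifs with h
    · subst h
      symm
      exact (Ideal.Quotient.eq).2 (Ideal.subset_span rfl)
    · rfl
  have h0 : q f = 0 := by
    rw [← hq, AlgHom.comp_apply, hf, map_zero]
  exact Ideal.mem_span_singleton.1 (Ideal.Quotient.eq_zero_iff_mem.1 h0)

lemma X_sub_X_isRelPrime {σ R : Type*} [CommRing R] [IsDomain R] [LinearOrder σ] {a b c d : σ}
    (hab : a < b) (hcd : c < d) (h : ¬ (a = c ∧ b = d)) :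
    IsRelPrime (MvPolynomial.X b - MvPolynomial.X a : MvPolynomial σ R)
      (MvPolynomial.X d - MvPolynomial.X c) := by
  rw [(X_sub_X_irreducible hab.ne).isRelPrime_iff_not_dvd]
  intro hdvd
  have h1 := map_dvd (MvPolynomial.rename (R := R) (fun e => if e = b then a else e)) hdvd
  simp only [map_sub, MvPolynomial.rename_X, if_true, if_neg hab.ne, sub_self, zero_dvd_iff,
    sub_eq_zero] at h1
  have h2 := MvPolynomial.X_injective h1
  split_ifs at h2 with h3 h4 h4
  · exact hcd.ne (h4.trans h3.symm)
  · exact h ⟨h2, h3.symm⟩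
  · subst h4 h2
    exact lt_asymm hab hcd
  · exact hcd.ne h2.symm

/-- The matrix over the polynomial ring obtained by clearing denominators row by row. -/
noncomputable def clearedMatrix (n : ℕ) : Matrix (Fin n) (Fin n) (PolyRing n) :=
  Matrix.of fun i j => F (zeta n) (x i) (y j) (z n) *
    ∏ k ∈ Finset.univ.erase j, G (zeta n) (x i) (y k)

lemma rename_F {n : ℕ} (f : Fin (2 * n + 1) → Fin (2 * n + 1)) (a b c : PolyRing n) :
    MvPolynomial.rename f (F (zeta n) a b c) =
      F (zeta n) (MvPolynomial.rename f a) (MvPolynomial.rename f b) (MvPolynomial.rename f c) := by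
  simp [F, zeta, map_ofNat]

lemma rename_G {n : ℕ} (f : Fin (2 * n + 1) → Fin (2 * n + 1)) (a b : PolyRing n) :
    MvPolynomial.rename f (G (zeta n) a b) =
      G (zeta n) (MvPolynomial.rename f a) (MvPolynomial.rename f b) := by
  simp [G, zeta, map_ofNat]

lemma x_dvd {n : ℕ} {i j : Fin n} (hij : i < j) : x j - x i ∣ (clearedMatrix n).det := by
  apply X_sub_X_dvd
  rw [AlgHom.map_det]
  apply Matrix.det_zero_of_row_eq hij.ne
  funext k
  have hy (l : Fin n) : iy l ≠ ix j := by
    simp only [ix, iy, ne_eq, Fin.mk.injEq]; omega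
  have hz : iz n ≠ ix j := by
    simp only [ix, iz, ne_eq, Fin.mk.injEq]; omega
  simp only [clearedMatrix, AlgHom.mapMatrix_apply, Matrix.map_apply, Matrix.of_apply, map_mul,
    map_prod, rename_F, rename_G, x, y, z, MvPolynomial.rename_X, if_neg (hy _), if_neg hz,
    if_true]
  have : (if ix i = ix j then ix i else ix i) = ix i := by split_ifs <;> rfl
  rw [this]

lemma y_dvd {n : ℕ} {i j : Fin n} (hij : i < j) : y j - y i ∣ (clearedMatrix n).det := by
  apply X_sub_X_dvd
  rw [AlgHom.map_det]
  apply Matrix.det_zero_of_column_eq hij.ne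
  intro k
  have hx (l : Fin n) : ix l ≠ iy j := by
    simp only [ix, iy, ne_eq, Fin.mk.injEq]; omega
  have hz : iz n ≠ iy j := by
    simp only [iy, iz, ne_eq, Fin.mk.injEq]; omega
  simp only [clearedMatrix, AlgHom.mapMatrix_apply, Matrix.map_apply, Matrix.of_apply, map_mul,
    map_prod, rename_F, rename_G, x, y, z, MvPolynomial.rename_X, if_neg (hx _), if_neg hz,
    if_true]
  have h1 : (if iy i = iy j then iy i else iy i) = iy i := by split_ifs <;> rfl
  rw [h1]
  congr 1
  have hi : j ∈ Finset.univ.erase i := by simp [hij.ne']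
  have hj : i ∈ Finset.univ.erase j := by simp [hij.ne]
  rw [← Finset.mul_prod_erase _ _ hi, ← Finset.mul_prod_erase _ _ hj, Finset.erase_right_comm]
  rw [if_pos rfl, h1]

lemma ix_lt {n : ℕ} {i j : Fin n} (h : i < j) : ix i < ix j := by
  exact Fin.mk_lt_mk.2 (Fin.lt_def.1 h)

lemma iy_lt {n : ℕ} {i j : Fin n} (h : i < j) : iy i < iy j := by
  exact Fin.mk_lt_mk.2 (Nat.add_lt_add_left (Fin.lt_def.1 h) n)

lemma denominator_dvd (n : ℕ) :
    (∏ i : Fin n, ∏ j ∈ Finset.Ioi i, ((x j - x i) * (y j - y i))) ∣ (clearedMatrix n).det := by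
  classical
  rw [Finset.prod_sigma']
  have key {i j k l : Fin n} (hij : i < j) (hkl : k < l) (h : ¬ (i = k ∧ j = l)) :
      IsRelPrime (x j - x i) (x l - x k) ∧ IsRelPrime (y j - y i) (y l - y k) := by
    constructor
    · refine X_sub_X_isRelPrime (ix_lt hij) (ix_lt hkl) fun h' => h ?_
      simpa [ix, Fin.ext_iff] using h'
    · refine X_sub_X_isRelPrime (iy_lt hij) (iy_lt hkl) fun h' => h ?_
      simpa [iy, Fin.ext_iff] using h'
  have cross {i j k l : Fin n} (hij : i < j) (hkl : k < l) :
      IsRelPrime (x j - x i) (y l - y k) := by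
    refine X_sub_X_isRelPrime (ix_lt hij) (iy_lt hkl) fun h' => ?_
    have := h'.1
    simp only [ix, iy, Fin.mk.injEq] at this
    omega
  apply Finset.prod_dvd_of_isRelPrime
  · rintro ⟨i, j⟩ hij ⟨k, l⟩ hkl hne
    have hij : i < j := by simpa using hij
    have hkl : k < l := by simpa using hkl
    have hne : ¬ (i = k ∧ j = l) := by
      rintro ⟨rfl, rfl⟩
      exact hne rfl
    simp only [Function.onFun]
    exact IsRelPrime.mul_left
      (IsRelPrime.mul_right (key hij hkl hne).1 (cross hij hkl))
      (IsRelPrime.mul_right (cross hkl hij).symm (key hij hkl hne).2)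
  · rintro ⟨i, j⟩ hij
    have hij : i < j := by simpa using hij
    exact (cross hij hij).mul_dvd (x_dvd hij) (y_dvd hij)

/-- The determinantal expression is a polynomial. -/
lemma exists_S (n : ℕ) :
    ∃ S : PolyRing n, algebraMap (PolyRing n) (FractionRing (PolyRing n)) S = SFrac n := by
  obtain ⟨S, hS⟩ := denominator_dvd n
  refine ⟨S, ?_⟩
  have hne : algebraMap (PolyRing n) (FractionRing (PolyRing n))
      (∏ i : Fin n, ∏ j ∈ Finset.Ioi i, ((x j - x i) * (y j - y i))) ≠ 0 := by
    rw [Ne, FaithfulSMul.algebraMap_eq_zero_iff]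
    refine Finset.prod_ne_zero_iff.2 fun i _ => Finset.prod_ne_zero_iff.2 fun j hj => ?_
    have hj : i < j := by simpa using hj
    exact mul_ne_zero (X_sub_X_irreducible (ix_lt hj).ne).ne_zero
      (X_sub_X_irreducible (iy_lt hj).ne).ne_zero
  have hdet : algebraMap (PolyRing n) (FractionRing (PolyRing n)) (clearedMatrix n).det =
      algebraMap (PolyRing n) (FractionRing (PolyRing n))
        (∏ i : Fin n, ∏ j : Fin n, G (zeta n) (x i) (y j)) *
      (Matrix.of fun i j : Fin n =>
        algebraMap (PolyRing n) (FractionRing (PolyRing n)) (F (zeta n) (x i) (y j) (z n)) /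
          algebraMap (PolyRing n) (FractionRing (PolyRing n)) (G (zeta n) (x i) (y j))).det := by
    rw [RingHom.map_det, map_prod, ← Matrix.det_mul_column]
    congr 1
    ext i j
    have hG : algebraMap (PolyRing n) (FractionRing (PolyRing n)) (G (zeta n) (x i) (y j)) ≠ 0 := by
      rw [Ne, FaithfulSMul.algebraMap_eq_zero_iff]
      exact G_ne_zero i j
    simp only [clearedMatrix, RingHom.mapMatrix_apply, Matrix.map_apply, Matrix.of_apply, map_mul,
      ← Finset.mul_prod_erase Finset.univ (fun k => G (zeta n) (x i) (y k)) (Finset.mem_univ j)]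
    field_simp
  rw [SFrac, div_mul_eq_mul_div, ← hdet, hS, map_mul, mul_div_cancel_left₀ _ hne]

/-- The polynomial `S_n(x₁, …, xₙ, y₁, …, yₙ, z)`. -/
noncomputable def S (n : ℕ) : PolyRing n := (exists_S n).choose

lemma S_spec (n : ℕ) : algebraMap (PolyRing n) (FractionRing (PolyRing n)) (S n) = SFrac n :=
  (exists_S n).choose_spec

/-- `S_n` evaluated at rational functions `v₀, …, v_{2n}` of `ζ`. -/
noncomputable def SEval (n : ℕ) (v : Fin (2 * n + 1) → RatFunc ℚ) : RatFunc ℚ :=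
  MvPolynomial.eval₂ (algebraMap ℚ[X] (RatFunc ℚ)) v (S n)

/-- `δ_n = [n²/4]`. -/
def delta (n : ℕ) : ℕ := n ^ 2 / 4

/-- The identity that characterizes `p_n`: with `a = 2ζ+1` and `b = ζ/(ζ+2)`,
`(1+ζ/2)^{n²} S_n(a, …, a, b, …, b)`, with `n+1` arguments `a` and `n` arguments `b`, equals
`(-1)^{n(n+1)/2} ζ^{n²} (1+ζ)^{n²} (1+2ζ)^{δ_n} (1+ζ/2)^{δ_{n-1}} p_n(ζ)`.
(For `n = 0` the truncated subtraction is harmless, as `[(-1)²/4] = 0 = [0²/4]`.) -/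
def IsSpecialPolynomial (n : ℕ) (p : ℚ[X]) : Prop :=
  (1 + RatFunc.X / 2) ^ n ^ 2 *
      SEval n (fun k => if (k : ℕ) < n + 1 then 2 * RatFunc.X + 1
        else RatFunc.X / (RatFunc.X + 2)) =
    (-1) ^ (n + 1).choose 2 * RatFunc.X ^ n ^ 2 * (1 + RatFunc.X) ^ n ^ 2 *
      (1 + 2 * RatFunc.X) ^ delta n * (1 + RatFunc.X / 2) ^ delta (n - 1) *
      algebraMap ℚ[X] (RatFunc ℚ) p

/-- The alternating sign matrix numbers
`A_n = 1! 4! 7! ⋯ (3n-2)! / (n! (n+1)! ⋯ (2n-1)!)`. -/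
def A (n : ℕ) : ℚ :=
  (∏ k ∈ Finset.range n, ((3 * k + 1).factorial : ℚ)) /
    ∏ k ∈ Finset.range n, ((n + k).factorial : ℚ)

/-- The cyclically symmetric plane partition numbers
`C_n = (2 · 5 ⋯ (3n-1)) / (1 · 4 ⋯ (3n-2)) · A_n`. -/
def C (n : ℕ) : ℚ :=
  (∏ k ∈ Finset.range n, (3 * (k : ℚ) + 2)) / (∏ k ∈ Finset.range n, (3 * (k : ℚ) + 1)) * A n

end ThreeColour

/-! Write a = 2ζ+1, b = ζ/(ζ+2), P = x²(x-a), Q = (ζ+2)x-ζ. Then (x-y)G(x,y) = P(x)Q(y) - P(y)Q(x),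
so 1/G is a Cauchy kernel in the variable f = P/Q, while F arises from a 3×3 determinant in P, Q and
a third polynomial W. By Lagrange interpolation in f, the n×n determinant defining S_n becomes the
determinant of the 2n+1 functions W P^k Q^{n-1-k} and P^k Q^{n-k} at the 2n+1 variables, divided by
a Vandermonde determinant (`det_famW_eval`). That quotient is the determinant of the coefficients of
the remainders modulo the product of the X - point (`coefDet`). It involves no division, so the
points may be merged: the special value of S_n is a `coefDet` modulo (X-b)^n (X-a)^{n+1}
(`SEval_eq_coefDet`).

P vanishes at a and Q at b, so P/Q and Q/P serve as local parameters there. Expanding in them makes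
P^k Q^{n-k} into monomials, and a Schur complement leaves an n×n matrix whose entries depend only on
k+j (`det_reduced`, `det_hMat`). Clearing denominators by blocks produces the powers of 1+2ζ and ζ+2
(`detHat_X_eq`). At ζ = -1 the points a and b merge; rescaling about that confluence gives a second
polynomial expression, `detHat`. Comparing the two forces (1+ζ)^{n²+n} to divide the cleared
determinant, whence existence and uniqueness (`existsUnique_isSpecialPolynomial`).

The four values and the leading term come from these descriptions. ζ = -1: `detHat` is triangular
for functionals adapted to palindromic polynomials (`detHat_neg_one`). ζ = -2 and ζ = -1/2: the
cleared matrix is block triangular, and its diagonal blocks are Hankel determinants of the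
coefficients of Y or 3Y²-Y, where Y²(Y-1) = cτ (`eval_det_fullMat`). The trigonometric
parametrization of this cubic turns them into determinants of coefficients of Chebyshev polynomials,
that is, Vandermonde determinants in the squares of 1,2,4,5,7,… or of 1,5,7,11,… (`det_toeplitz`).
Products of one determinant of each kind are A_{n+1} or C_{n+1} up to powers of 2 and 3
(`detE_mul_detU`, `detU_mul_detE`). ζ = 1: the substitution x = (c-1)/(c+1) turns the whole family
into polynomials in c and c³-3c, and sends b, a to c = 2, -2. Splitting Chebyshev polynomials by
parity yields the same two kinds of Vandermonde determinant (`det_localCoeff_famW_one`). ζ → ∞: only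
the expansion at a contributes to the top degree, its cubic degenerates to a quadratic, and a
Hessenberg determinant extracts a central binomial coefficient (`natDegree_det_weightMat`). -/

namespace SpecialPoly

/-! ### Determinants of remainders modulo a monic polynomial. -/

section CoefDet

variable {R : Type*} [CommRing R] {p q : ℕ}

/-- The position of an index in the concatenation of two blocks of sizes `p` and `q`. -/
def ord : Fin p ⊕ Fin q → ℕ := Sum.elim (fun i => i) (fun j => p + j)

@[simp] lemma ord_inl (i : Fin p) : ord (Sum.inl i : Fin p ⊕ Fin q) = i := rfl
@[simp] lemma ord_inr (j : Fin q) : ord (Sum.inr j : Fin p ⊕ Fin q) = p + j := rfl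

lemma ord_lt (c : Fin p ⊕ Fin q) : ord c < p + q := by
  rcases c with c | c
  · simp only [ord_inl]; omega
  · simp only [ord_inr]; omega

lemma ord_injective : Function.Injective (ord : Fin p ⊕ Fin q → ℕ) := by
  rintro (a | a) (b | b) h <;> simp [Fin.ext_iff] at h ⊢ <;> omega

lemma sum_ord {M : Type*} [AddCommMonoid M] (f : ℕ → M) :
    ∑ c : Fin p ⊕ Fin q, f (ord c) = ∑ i ∈ Finset.range (p + q), f i := by
  simp [Fintype.sum_sum_type, Finset.sum_range, Fin.sum_univ_add]

lemma eq_sum_ord {f : R[X]} (hf : f.degree < (p + q : ℕ)) :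
    f = ∑ c : Fin p ⊕ Fin q, C (f.coeff (ord c)) * X ^ ord c := by
  ext i
  rw [sum_ord fun i => C (f.coeff i) * X ^ i, finsetSum_coeff]
  simp only [coeff_C_mul_X_pow, Finset.sum_ite_eq, Finset.mem_range]
  split_ifs with h
  · rfl
  · exact coeff_eq_zero_of_degree_lt (hf.trans_le (by exact_mod_cast not_lt.1 h))

/-- The determinant of the coefficients of the remainders of a family of polynomials modulo a
monic polynomial. -/
noncomputable def coefDet (φ : Fin p ⊕ Fin q → R[X]) (N : R[X]) : R :=
  (Matrix.of fun r c : Fin p ⊕ Fin q => (φ r %ₘ N).coeff (ord c)).det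

/-- Evaluating a determinant of linear functionals that vanish on the multiples of `N`. -/
lemma det_functional {N : R[X]} (hN : N.Monic) (hd : N.natDegree = p + q)
    (L : Fin p ⊕ Fin q → R[X] →ₗ[R] R) (hL : ∀ c f, L c (N * f) = 0)
    (φ : Fin p ⊕ Fin q → R[X]) :
    (Matrix.of fun r c => L c (φ r)).det =
      coefDet φ N * (Matrix.of fun r c : Fin p ⊕ Fin q => L c (X ^ ord r)).det := by
  nontriviality R
  rw [coefDet, ← Matrix.det_mul]
  congr 1
  ext r c
  have hdeg : (φ r %ₘ N).degree < (p + q : ℕ) := by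
    have := degree_modByMonic_lt (φ r) hN
    rwa [degree_eq_natDegree hN.ne_zero, hd] at this
  -- Only the remainder is seen by a functional that kills the multiples of N, so the matrix of
  -- values factors through the matrix of coefficients.
  have h1 : L c (φ r) = L c (φ r %ₘ N) := by
    conv_lhs => rw [← modByMonic_add_div (φ r) N, map_add, hL, add_zero]
  rw [Matrix.of_apply, h1, Matrix.mul_apply]
  conv_lhs => rw [eq_sum_ord hdeg, map_sum]
  refine Finset.sum_congr rfl fun s _ => ?_
  rw [← smul_eq_C_mul, map_smul, smul_eq_mul]
  rfl

lemma coefDet_eq_of_degree_lt {N : R[X]} (hN : N.Monic) (hd : N.natDegree = p + q)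
    (φ : Fin p ⊕ Fin q → R[X]) (hφ : ∀ r, (φ r).degree < (p + q : ℕ)) :
    coefDet φ N = (Matrix.of fun r c : Fin p ⊕ Fin q => (φ r).coeff (ord c)).det := by
  nontriviality R
  unfold coefDet
  congr 1
  ext r c
  rw [Matrix.of_apply, Matrix.of_apply, (modByMonic_eq_self_iff hN).2]
  rw [degree_eq_natDegree hN.ne_zero, hd]
  exact hφ r

lemma coefDet_linearComb (N : R[X]) (T : Matrix (Fin p ⊕ Fin q) (Fin p ⊕ Fin q) R)
    (φ ψ : Fin p ⊕ Fin q → R[X]) (h : ∀ r, ψ r = ∑ s, T r s • φ s) :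
    coefDet ψ N = T.det * coefDet φ N := by
  rw [coefDet, coefDet, ← Matrix.det_mul]
  congr 1
  ext r c
  rw [Matrix.of_apply, h, Matrix.mul_apply, ← modByMonicHom_apply, map_sum, finsetSum_coeff]
  simp [modByMonicHom_apply]

lemma coefDet_smul (N : R[X]) (t : Fin p ⊕ Fin q → R) (φ : Fin p ⊕ Fin q → R[X]) :
    coefDet (fun r => t r • φ r) N = (∏ r, t r) * coefDet φ N := by
  rw [coefDet_linearComb N (Matrix.diagonal t) φ, Matrix.det_diagonal]
  intro r
  rw [Finset.sum_eq_single r]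
  · simp
  · intro b _ hb
    simp [Matrix.diagonal_apply_ne' _ hb]
  · simp

/-- Division by a monic polynomial commutes with ring homomorphisms. This is what permits
specializing ζ and merging the points. -/
lemma map_coefDet {R' : Type*} [CommRing R'] (f : R →+* R') {N : R[X]} (hN : N.Monic)
    (φ : Fin p ⊕ Fin q → R[X]) :
    f (coefDet φ N) = coefDet (fun r => (φ r).map f) (N.map f) := by
  rw [coefDet, coefDet, RingHom.map_det]
  congr 1
  ext r c
  simp [← map_modByMonic f hN]

/-- The determinant of a matrix that is triangular with respect to the order of `ord`. -/
lemma det_of_ord_triangular (M : Matrix (Fin p ⊕ Fin q) (Fin p ⊕ Fin q) R)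
    (key : Fin p ⊕ Fin q → ℕ) (hkey : Function.Injective key)
    (h : ∀ r c, key r < key c → M r c = 0) : M.det = ∏ r, M r r := by
  let _ : LinearOrder (Fin p ⊕ Fin q) := LinearOrder.lift' key hkey
  have := @Matrix.det_of_isLowerTriangular (Fin p ⊕ Fin q) R _ _ _ _ M (fun i j hij => h _ _ hij)
  convert this

/-- A determinant of functionals can be computed on any family of monic polynomials of degrees
`0, 1, 2, …`. -/
lemma det_functional_monic {N : R[X]} (hN : N.Monic) (hd : N.natDegree = p + q)
    (L : Fin p ⊕ Fin q → R[X] →ₗ[R] R) (hL : ∀ c f, L c (N * f) = 0)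
    (φ e : Fin p ⊕ Fin q → R[X]) (he : ∀ r, (e r).Monic) (hed : ∀ r, (e r).natDegree = ord r) :
    (Matrix.of fun r c => L c (φ r)).det =
      coefDet φ N * (Matrix.of fun r c => L c (e r)).det := by
  nontriviality R
  -- Monic polynomials of degrees 0, 1, 2, … have a unitriangular coefficient matrix, so they can
  -- replace the monomials.
  have h1 : coefDet e N = 1 := by
    rw [coefDet_eq_of_degree_lt hN hd e, det_of_ord_triangular _ ord ord_injective]
    · refine Finset.prod_eq_one fun r _ => ?_
      rw [Matrix.of_apply, ← hed, coeff_natDegree, he r]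
    · intro r c hrc
      rw [Matrix.of_apply]
      exact coeff_eq_zero_of_natDegree_lt (by rwa [hed])
    · intro r
      rw [degree_eq_natDegree (he r).ne_zero, hed]
      exact_mod_cast ord_lt r
  rw [det_functional hN hd L hL φ, det_functional hN hd L hL e, h1, one_mul]

end CoefDet

end SpecialPoly

namespace SpecialPoly

/-! ### The polynomials P, Q, W, V and the families built from them. -/

section FourPolynomials

variable {R : Type*} [CommRing R]

/-- The polynomial `x²(x - a)` with `a = 2ζ + 1`. -/
noncomputable def polyP (ζ : R) : R[X] := X ^ 2 * (X - C (2 * ζ + 1))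

/-- The polynomial `(ζ + 2)x - ζ`. -/
noncomputable def polyQ (ζ : R) : R[X] := C (ζ + 2) * X - C ζ

/-- The polynomial `(ζ + 2)x² + ζ`. -/
noncomputable def polyW (ζ : R) : R[X] := C (ζ + 2) * X ^ 2 + C ζ

/-- The polynomial `x(x - 1 - ζ)`. -/
noncomputable def polyV (ζ : R) : R[X] := X * (X - C (1 + ζ))

/-- The `2n + 1` functions `w P^k Q^{n-1-k}` and `P^k Q^{n-k}`. -/
noncomputable def famW (ζ : R) (n : ℕ) : Fin n ⊕ Fin (n + 1) → R[X] :=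
  Sum.elim (fun k => polyW ζ * polyP ζ ^ (k : ℕ) * polyQ ζ ^ (n - 1 - k))
    (fun k => polyP ζ ^ (k : ℕ) * polyQ ζ ^ (n - k))

/-- The `2n + 1` functions `V P^k Q^{n-k}` and `P^k Q^{n-k}`. -/
noncomputable def famV (ζ : R) (n : ℕ) : Fin n ⊕ Fin (n + 1) → R[X] :=
  Sum.elim (fun k => polyV ζ * polyP ζ ^ (k : ℕ) * polyQ ζ ^ (n - k))
    (fun k => polyP ζ ^ (k : ℕ) * polyQ ζ ^ (n - k))

end FourPolynomials

/-! ### Lagrange interpolation and a Schur complement. -/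

section Lagrange

variable {K : Type*} [Field K] {n : ℕ}

lemma sum_pow_mul_basis (Y : Fin n → K) (hY : Function.Injective Y) (t : K) {k : ℕ} (hk : k < n) :
    ∑ j, Y j ^ k * (Lagrange.basis Finset.univ Y j).eval t = t ^ k := by
  have h := Lagrange.eq_interpolate (s := Finset.univ) (v := Y) (f := (X ^ k : K[X]))
    hY.injOn (by simpa using hk)
  have h2 := congrArg (eval t) h
  rw [eval_pow, eval_X, Lagrange.interpolate_apply, eval_finsetSum] at h2
  rw [h2]
  simp

lemma eval_basis_eq (Y : Fin n → K) (j : Fin n) (t : K) (ht : t ≠ Y j) :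
    (Lagrange.basis Finset.univ Y j).eval t =
      (∏ k, (t - Y k)) * (t - Y j)⁻¹ * (∏ k ∈ {j}ᶜ, (Y j - Y k))⁻¹ := by
  have h : t - Y j ≠ 0 := sub_ne_zero.2 ht
  rw [Lagrange.basis, eval_prod, ← Finset.mul_prod_erase _ _ (Finset.mem_univ j),
    ← Finset.compl_singleton, ← Finset.prod_inv_distrib,  mul_comm (t - Y j), mul_assoc,
    mul_assoc, mul_inv_cancel_left₀ h, ← Finset.prod_mul_distrib]
  refine Finset.prod_congr rfl fun k _ => ?_
  simp [Lagrange.basisDivisor, mul_comm]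

/-- The sign `(-1)^{n(n-1)/2}`. -/
def revSign (n : ℕ) : ℤ := ∏ i : Fin n, ∏ _j ∈ Finset.Ioi i, (-1 : ℤ)

lemma prod_offDiag_eq (Y : Fin n → K) :
    ∏ j, ∏ k ∈ {j}ᶜ, (Y j - Y k) = revSign n * (∏ i, ∏ j ∈ Finset.Ioi i, (Y j - Y i)) ^ 2 := by
  rw [revSign, ← Finset.prod_prod_Ioi_mul_eq_prod_prod_off_diag (fun a b => Y b - Y a)]
  push_cast
  rw [← Finset.prod_pow, ← Finset.prod_mul_distrib]
  refine Finset.prod_congr rfl fun i _ => ?_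
  rw [← Finset.prod_pow, ← Finset.prod_mul_distrib]
  refine Finset.prod_congr rfl fun j _ => ?_
  ring

lemma det_pow_snoc (Y : Fin n → K) (Z : K) :
    (Matrix.of fun (k : Fin (n + 1)) (j : Fin (n + 1)) =>
      (Fin.snoc Y Z : Fin (n + 1) → K) j ^ (k : ℕ)).det =
      (∏ i, ∏ j ∈ Finset.Ioi i, (Y j - Y i)) * ∏ j, (Z - Y j) := by
  have : (Matrix.of fun (k : Fin (n + 1)) (j : Fin (n + 1)) =>
      (Fin.snoc Y Z : Fin (n + 1) → K) j ^ (k : ℕ)) =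
      (Matrix.vandermonde (Fin.snoc Y Z : Fin (n + 1) → K)).transpose := rfl
  rw [this, Matrix.det_transpose, Matrix.det_vandermonde, Fin.prod_univ_castSucc]
  have hl : Finset.Ioi (Fin.last n) = ∅ := by ext; simp [Fin.le_last]
  rw [hl, Finset.prod_empty, mul_one, ← Finset.prod_mul_distrib]
  refine Finset.prod_congr rfl fun i _ => ?_
  have hi : Finset.Ioi i.castSucc = (Finset.Ioi i).map Fin.castSuccEmb ∪ {Fin.last n} := by
    ext j
    refine Fin.lastCases ?_ (fun j => ?_) j
    · simp [Fin.castSucc_lt_last]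
    · simp [Fin.le_last]
  rw [hi, Finset.prod_union, Finset.prod_map]
  · simp
  · simp

/-- A Schur complement computation: a determinant in the functions `v f^k` (`k < n`) and
`f^k` (`k ≤ n`), evaluated at points where `f` takes the values `X i`, `Y j`, `Z` and `v` the
values `vx i`, `vy j`, `vz`. -/
lemma det_two_families (X Y vx vy : Fin n → K) (Z vz : K) (hY : Function.Injective Y)
    (hZ : ∀ j, Z ≠ Y j) :
    (Matrix.fromBlocks (Matrix.of fun k i : Fin n => vx i * X i ^ (k : ℕ))
      (Matrix.of fun (k : Fin n) (j : Fin (n + 1)) =>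
        (Fin.snoc vy vz : Fin (n + 1) → K) j * (Fin.snoc Y Z : Fin (n + 1) → K) j ^ (k : ℕ))
      (Matrix.of fun (k : Fin (n + 1)) i => X i ^ (k : ℕ))
      (Matrix.of fun (k : Fin (n + 1)) (j : Fin (n + 1)) =>
        (Fin.snoc Y Z : Fin (n + 1) → K) j ^ (k : ℕ))).det =
    (∏ i, ∏ j ∈ Finset.Ioi i, (Y j - Y i)) ^ 2 * (∏ j, (Z - Y j)) *
      (Matrix.of fun j i : Fin n => (Lagrange.basis Finset.univ Y j).eval (X i) *
        (vx i - vy j - (vz - vy j) * (X i - Y j) / (Z - Y j))).det := by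
  set q : Fin n → Fin n → K := fun j i => (Lagrange.basis Finset.univ Y j).eval (X i) with hq
  have hsum (i : Fin n) {k : ℕ} (hk : k < n) : ∑ j, Y j ^ k * q j i = X i ^ k :=
    sum_pow_mul_basis Y hY (X i) hk
  have hZ' (j : Fin n) : Z - Y j ≠ 0 := sub_ne_zero.2 (hZ j)
  have hZ'' (j : Fin n) : Y j - Z ≠ 0 := sub_ne_zero.2 (hZ j).symm
  -- These, together with `ez`, are the values at X i of the Lagrange basis for the n+1 nodes Y j
  -- and Z; they reproduce the powers up to the exponent n.
  set e : Fin n → Fin n → K := fun j i => q j i * (X i - Z) / (Y j - Z) with he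
  set ez : Fin n → K := fun i => 1 - ∑ j, e j i with hez
  have key (i : Fin n) {k : ℕ} (hk : k ≤ n) : ∑ j, Y j ^ k * e j i + Z ^ k * ez i = X i ^ k := by
    induction k with
    | zero => simp [hez]
    | succ k ih =>
      have ih := ih (by omega)
      have h2 : ∑ j, Y j ^ (k + 1) * e j i = Z * ∑ j, Y j ^ k * e j i + (X i - Z) * X i ^ k := by
        rw [← hsum i (show k < n by omega), Finset.mul_sum, Finset.mul_sum,
          ← Finset.sum_add_distrib]
        refine Finset.sum_congr rfl fun j _ => ?_
        rw [he]
        field_simp [hZ'' j]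
        ring
      rw [h2]
      linear_combination Z * ih
  set E : Matrix (Fin (n + 1)) (Fin n) K := Matrix.of fun j i =>
    (Fin.snoc (fun j => e j i) (ez i) : Fin (n + 1) → K) j with hE
  set V : Matrix (Fin n) (Fin n) K := Matrix.of fun k j => Y j ^ (k : ℕ) with hV
  set Ψ : Matrix (Fin n) (Fin n) K := Matrix.of fun j i => q j i *
        (vx i - vy j - (vz - vy j) * (X i - Y j) / (Z - Y j)) with hΨ
  -- Interpolation expresses the X columns of the lower rows through the Y, Z columns. Subtracting
  -- that combination clears the lower left block and leaves V * Ψ in the upper left one.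
  have hfac : (Matrix.fromBlocks (Matrix.of fun k i : Fin n => vx i * X i ^ (k : ℕ))
      (Matrix.of fun (k : Fin n) (j : Fin (n + 1)) =>
        (Fin.snoc vy vz : Fin (n + 1) → K) j * (Fin.snoc Y Z : Fin (n + 1) → K) j ^ (k : ℕ))
      (Matrix.of fun (k : Fin (n + 1)) i => X i ^ (k : ℕ))
      (Matrix.of fun (k : Fin (n + 1)) (j : Fin (n + 1)) =>
        (Fin.snoc Y Z : Fin (n + 1) → K) j ^ (k : ℕ))) =
      Matrix.fromBlocks (V * Ψ) (Matrix.of fun (k : Fin n) (j : Fin (n + 1)) =>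
        (Fin.snoc vy vz : Fin (n + 1) → K) j * (Fin.snoc Y Z : Fin (n + 1) → K) j ^ (k : ℕ)) 0
        (Matrix.of fun (k : Fin (n + 1)) (j : Fin (n + 1)) =>
        (Fin.snoc Y Z : Fin (n + 1) → K) j ^ (k : ℕ)) * Matrix.fromBlocks 1 0 E 1 := by
    rw [Matrix.fromBlocks_multiply]
    simp only [Matrix.mul_one, Matrix.mul_zero, zero_add]
    congr 1
    · ext k i
      simp only [Matrix.add_apply, Matrix.mul_apply, Matrix.of_apply, hV, hΨ, hE,
        Fin.sum_univ_castSucc, Fin.snoc_castSucc, Fin.snoc_last]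
      have h1 := hsum i k.2
      have h2 := key i k.2.le
      rw [← add_assoc, ← Finset.sum_add_distrib]
      have h3 : ∑ j, Y j ^ (k : ℕ) * q j i * (vx i - vz) + ∑ j, Y j ^ (k : ℕ) * e j i * vz =
          ∑ j, (Y j ^ (k : ℕ) * (q j i * (vx i - vy j - (vz - vy j) * (X i - Y j) / (Z - Y j))) +
            vy j * Y j ^ (k : ℕ) * e j i) := by
        rw [← Finset.sum_add_distrib]
        refine Finset.sum_congr rfl fun j _ => ?_
        have : Y j - Z = - (Z - Y j) := by ring
        rw [he]
        simp only [this]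
        field_simp [hZ' j]
        ring
      rw [← h3, ← Finset.sum_mul, ← Finset.sum_mul, h1]
      linear_combination (-vz) * h2
    · ext k i
      simp only [Matrix.mul_apply, Matrix.of_apply, hE,
        Fin.sum_univ_castSucc, Fin.snoc_castSucc, Fin.snoc_last]
      exact (key i (Nat.lt_succ_iff.1 k.2)).symm
  have hdetV : V.det = ∏ i, ∏ j ∈ Finset.Ioi i, (Y j - Y i) := by
    rw [← Matrix.det_vandermonde, ← Matrix.det_transpose]
    rfl
  have hdetD := det_pow_snoc Y Z
  rw [hfac, Matrix.det_mul, Matrix.det_fromBlocks_zero₂₁, Matrix.det_fromBlocks_zero₁₂,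
    Matrix.det_mul, hdetV, hdetD]
  simp only [Matrix.det_one]
  ring

end Lagrange

end SpecialPoly

namespace SpecialPoly

/-! ### From the n×n determinant in F/G to a determinant of size 2n+1. -/

section CauchyDeterminant

variable {K : Type*} [Field K]

/-- The identity behind everything: after division by Q(x)Q(y), G is the divided difference of f =
P/Q. -/
lemma sub_mul_G (ζ x y : K) :
    (x - y) * ThreeColour.G ζ x y =
      (polyP ζ).eval x * (polyQ ζ).eval y - (polyP ζ).eval y * (polyQ ζ).eval x := by
  simp only [ThreeColour.G, polyP, polyQ, eval_mul, eval_sub, eval_pow, eval_X, eval_C]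
  ring

/-- The left side is, up to a factor Q(y), the 3×3 determinant of W, P, Q at x, y, z. Such a
determinant is alternating, and dividing out the Vandermonde factor leaves F. -/
lemma det_three_F (ζ x y z : K) :
    ((polyW ζ).eval x * (polyQ ζ).eval y - (polyW ζ).eval y * (polyQ ζ).eval x) *
        ((polyP ζ).eval z * (polyQ ζ).eval y - (polyP ζ).eval y * (polyQ ζ).eval z) -
      ((polyW ζ).eval z * (polyQ ζ).eval y - (polyW ζ).eval y * (polyQ ζ).eval z) *
        ((polyP ζ).eval x * (polyQ ζ).eval y - (polyP ζ).eval y * (polyQ ζ).eval x) =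
      -(ζ + 2) * ThreeColour.F ζ x y z * (y - x) * (z - y) * (z - x) * (polyQ ζ).eval y := by
  simp only [ThreeColour.F, polyP, polyQ, polyW, eval_mul, eval_sub, eval_add, eval_pow, eval_X,
    eval_C]
  ring

/-- After division by Q^n, the family becomes v f^k and f^k with f = P/Q and v = W/Q, the shape
required by `det_two_families`. In the resulting n×n matrix the Lagrange basis contributes the 1/G
and the three-term difference contributes F; the rest are row and column factors. The hypotheses say
that the points are generic enough for all divisions. -/
lemma det_famW_eval {n : ℕ} (ζ : K) (x y : Fin n → K) (z : K)
    (hQx : ∀ i, (polyQ ζ).eval (x i) ≠ 0) (hQy : ∀ i, (polyQ ζ).eval (y i) ≠ 0)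
    (hQz : (polyQ ζ).eval z ≠ 0) (hxy : ∀ i j, x i ≠ y j)
    (hG : ∀ i j, ThreeColour.G ζ (x i) (y j) ≠ 0)
    (hyy : ∀ i j, i ≠ j → (y i - y j) * ThreeColour.G ζ (y i) (y j) ≠ 0)
    (hyz : ∀ j, (z - y j) * ThreeColour.G ζ z (y j) ≠ 0) :
    (Matrix.of fun r c : Fin n ⊕ Fin (n + 1) =>
      (famW ζ n r).eval ((Sum.elim x (Fin.snoc y z : Fin (n + 1) → K)) c)).det =
    revSign n * (-(ζ + 2)) ^ n * ((∏ i, ∏ j, ThreeColour.G ζ (x i) (y j)) *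
      (Matrix.of fun i j => ThreeColour.F ζ (x i) (y j) z / ThreeColour.G ζ (x i) (y j)).det) *
      ((∏ i, ∏ j, (y j - x i)) * (∏ i, (z - x i)) * ∏ j, (z - y j)) := by
  set P : K → K := fun t => (polyP ζ).eval t with hP
  set Q : K → K := fun t => (polyQ ζ).eval t with hQ
  set W : K → K := fun t => (polyW ζ).eval t with hW
  set f : K → K := fun t => P t / Q t with hf
  set v : K → K := fun t => W t / Q t with hv
  have hsubf (s t : K) (hs : Q s ≠ 0) (ht : Q t ≠ 0) :
      f s - f t = (s - t) * ThreeColour.G ζ s t / (Q s * Q t) := by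
    rw [sub_mul_G]
    simp only [hf]
    field_simp
    ring
  have hY : Function.Injective fun j => f (y j) := by
    intro i j hij
    by_contra hne
    have := hsubf (y i) (y j) (hQy i) (hQy j)
    rw [sub_eq_zero.2 hij] at this
    exact div_ne_zero (hyy i j hne) (mul_ne_zero (hQy i) (hQy j)) this.symm
  have hZ (j : Fin n) : f z ≠ f (y j) := by
    intro h
    have := hsubf z (y j) hQz (hQy j)
    rw [sub_eq_zero.2 h] at this
    exact div_ne_zero (hyz j) (mul_ne_zero hQz (hQy j)) this.symm
  have hX (i j : Fin n) : f (x i) ≠ f (y j) := by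
    intro h
    have := hsubf (x i) (y j) (hQx i) (hQy j)
    rw [sub_eq_zero.2 h] at this
    exact div_ne_zero (mul_ne_zero (sub_ne_zero.2 (hxy i j)) (hG i j))
      (mul_ne_zero (hQx i) (hQy j)) this.symm
  set pts : Fin n ⊕ Fin (n + 1) → K := Sum.elim x (Fin.snoc y z : Fin (n + 1) → K) with hpts
  have hQpts (c) : Q (pts c) ≠ 0 := by
    rcases c with i | j
    · exact hQx i
    · refine Fin.lastCases ?_ (fun j => ?_) j
      · simpa [pts] using hQz
      · simpa [pts] using hQy j
  -- Each column is divided by the n-th power of Q at its point; the exponents n-1-k and n-k in the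
  -- family are chosen so that this is homogeneous.
  have hscale : (Matrix.of fun r c : Fin n ⊕ Fin (n + 1) => (famW ζ n r).eval (pts c)) =
      Matrix.of fun r c => Q (pts c) ^ n *
        (Matrix.fromBlocks (Matrix.of fun k i : Fin n => v (x i) * f (x i) ^ (k : ℕ))
      (Matrix.of fun (k : Fin n) (j : Fin (n + 1)) =>
        (Fin.snoc (fun j => v (y j)) (v z) : Fin (n + 1) → K) j *
        (Fin.snoc (fun j => f (y j)) (f z) : Fin (n + 1) → K) j ^ (k : ℕ))
      (Matrix.of fun (k : Fin (n + 1)) i => f (x i) ^ (k : ℕ))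
      (Matrix.of fun (k : Fin (n + 1)) (j : Fin (n + 1)) =>
        (Fin.snoc (fun j => f (y j)) (f z) : Fin (n + 1) → K) j ^ (k : ℕ))) r c := by
    have h1 (k : Fin n) (t : K) (ht : Q t ≠ 0) :
        W t * P t ^ (k : ℕ) * Q t ^ (n - 1 - k) = Q t ^ n * (v t * f t ^ (k : ℕ)) := by
      have : Q t ^ n = Q t * Q t ^ (k : ℕ) * Q t ^ (n - 1 - k) := by
        rw [← pow_succ', ← pow_add]
        congr 1
        omega
      rw [this]
      simp only [hv, hf, div_pow]
      field_simp
    have h2 (k : Fin (n + 1)) (t : K) (ht : Q t ≠ 0) :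
        P t ^ (k : ℕ) * Q t ^ (n - k) = Q t ^ n * f t ^ (k : ℕ) := by
      have : Q t ^ n = Q t ^ (k : ℕ) * Q t ^ (n - k) := by
        rw [← pow_add]
        congr 1
        omega
      rw [this]
      simp only [hf, div_pow]
      field_simp
    have hs (g : K → K) (j : Fin (n + 1)) :
        (Fin.snoc (fun j => g (y j)) (g z) : Fin (n + 1) → K) j =
          g ((Fin.snoc y z : Fin (n + 1) → K) j) := by
      refine Fin.lastCases ?_ (fun j => ?_) j <;> simp
    ext r c
    rcases r with k | k <;> rcases c with i | j
    all_goals simp only [Matrix.of_apply, famW, Sum.elim_inl, Sum.elim_inr, eval_mul, eval_pow,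
      Matrix.fromBlocks_apply₁₁, Matrix.fromBlocks_apply₁₂, Matrix.fromBlocks_apply₂₁,
      Matrix.fromBlocks_apply₂₂, hs]
    · exact h1 k _ (hQpts (Sum.inl i))
    · exact h1 k _ (hQpts (Sum.inr j))
    · exact h2 k _ (hQpts (Sum.inl i))
    · exact h2 k _ (hQpts (Sum.inr j))
  rw [hscale, Matrix.det_mul_row, det_two_families _ _ _ _ _ _ hY hZ]
  have hΨ : (Matrix.of fun j i : Fin n =>
        (Lagrange.basis Finset.univ (fun j => f (y j)) j).eval (f (x i)) *
        (v (x i) - v (y j) - (v z - v (y j)) * (f (x i) - f (y j)) / (f z - f (y j)))) =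
      Matrix.of fun j i =>
        ((ζ + 2) * (z - y j) * (∏ k ∈ {j}ᶜ, (f (y j) - f (y k)))⁻¹ / (f z - f (y j)) / Q z) *
        (Matrix.of fun j i => ((∏ k, (f (x i) - f (y k))) * (z - x i)) *
          (Matrix.of fun i j => ThreeColour.F ζ (x i) (y j) z /
            ThreeColour.G ζ (x i) (y j)).transpose j i) j i := by
    ext j i
    simp only [Matrix.of_apply, Matrix.transpose_apply]
    rw [eval_basis_eq _ _ _ (hX i j)]
    have e1 : (f (x i) - f (y j))⁻¹ =
        (Q (x i) * Q (y j)) / ((x i - y j) * ThreeColour.G ζ (x i) (y j)) := by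
      rw [hsubf _ _ (hQx i) (hQy j), inv_div]
    -- With denominators cleared this is the 3×3 determinant of `det_three_F`.
    have e2 : v (x i) - v (y j) - (v z - v (y j)) * (f (x i) - f (y j)) / (f z - f (y j)) =
        -(ζ + 2) * ThreeColour.F ζ (x i) (y j) z * (y j - x i) * (z - y j) * (z - x i) /
          (Q (x i) * Q (y j) * Q z) / (f z - f (y j)) := by
      have h3 := det_three_F ζ (x i) (y j) z
      have hne : f z - f (y j) ≠ 0 := sub_ne_zero.2 (hZ j)
      rw [eq_div_iff hne, sub_mul, div_mul_cancel₀ _ hne]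
      have a1 := hQx i
      have a2 := hQy j
      simp only [hv, hf, hP, hQ, hW] at h3 a1 a2 hQz ⊢
      field_simp
      linear_combination h3
    rw [e1, e2]
    have a1 := hQx i
    have a2 := hQy j
    have a3 := sub_ne_zero.2 (hxy i j)
    have a4 := hG i j
    have a5 : f z - f (y j) ≠ 0 := sub_ne_zero.2 (hZ j)
    change Q (x i) ≠ 0 at a1
    change Q (y j) ≠ 0 at a2
    change Q z ≠ 0 at hQz
    field_simp
    ring
  rw [hΨ, Matrix.det_mul_column, Matrix.det_mul_row, Matrix.det_transpose]
  have hV : (∏ i, ∏ j ∈ Finset.Ioi i, (f (y j) - f (y i))) ≠ 0 := by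
    refine Finset.prod_ne_zero_iff.2 fun i _ => Finset.prod_ne_zero_iff.2 fun j hj => ?_
    exact sub_ne_zero.2 fun h => (Finset.mem_Ioi.1 hj).ne' (hY h)
  have hoff := prod_offDiag_eq fun j => f (y j)
  have hz : (∏ j, (f z - f (y j))) ≠ 0 :=
    Finset.prod_ne_zero_iff.2 fun j _ => sub_ne_zero.2 (hZ j)
  have hdiff : ∏ i, ∏ k, (f (x i) - f (y k)) = (∏ i, ∏ j, ThreeColour.G ζ (x i) (y j)) *
      (∏ i, ∏ j, (x i - y j)) / ((∏ i, Q (x i)) ^ n * (∏ j, Q (y j)) ^ n) := by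
    have e3 : ((∏ i, Q (x i)) ^ n * (∏ j, Q (y j)) ^ n) = ∏ i, ∏ j, (Q (x i) * Q (y j)) := by
      simp only [Finset.prod_mul_distrib, Finset.prod_const, Finset.card_univ, Fintype.card_fin,
        Finset.prod_pow]
    rw [e3, ← Finset.prod_mul_distrib, ← Finset.prod_div_distrib]
    refine Finset.prod_congr rfl fun i _ => ?_
    rw [← Finset.prod_mul_distrib, ← Finset.prod_div_distrib]
    refine Finset.prod_congr rfl fun j _ => ?_
    rw [hsubf _ _ (hQx i) (hQy j)]
    ring
  have hflip : ∏ i, ∏ j, (y j - x i) = (-1) ^ (n * n) * ∏ i, ∏ j, (x i - y j) := by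
    have : (-1 : K) ^ (n * n) = ∏ _i : Fin n, ∏ _j : Fin n, (-1 : K) := by
      simp only [Finset.prod_const, Finset.card_univ, Fintype.card_fin, pow_mul]
    rw [this, ← Finset.prod_mul_distrib]
    refine Finset.prod_congr rfl fun i _ => ?_
    rw [← Finset.prod_mul_distrib]
    exact Finset.prod_congr rfl fun j _ => by ring
  have hrev : (revSign n : K) * revSign n = 1 := by
    have : revSign n * revSign n = 1 := by
      simp only [revSign, ← Finset.prod_mul_distrib]
      simp
    rw [← Int.cast_mul, this, Int.cast_one]
  have hpow : (-(ζ + 2)) ^ n * (-1 : K) ^ (n * n) = (ζ + 2) ^ n := by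
    rw [neg_pow, mul_right_comm, ← pow_add, 
      Even.neg_one_pow (by simpa [mul_add, add_comm] using Nat.even_mul_succ_self n), one_mul]
  have hQprod : ∏ c, Q (pts c) ^ n = (∏ i, Q (x i)) ^ n * (∏ j, Q (y j)) ^ n * Q z ^ n := by
    rw [Fintype.prod_sum_type, Fin.prod_univ_castSucc]
    simp [hpts, Finset.prod_pow, mul_assoc]
  have hcol : ∏ j, ((ζ + 2) * (z - y j) * (∏ k ∈ {j}ᶜ, (f (y j) - f (y k)))⁻¹ / (f z - f (y j)) / Q z)
      = (ζ + 2) ^ n * (∏ j, (z - y j)) *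
        (revSign n * (∏ i, ∏ j ∈ Finset.Ioi i, (f (y j) - f (y i))) ^ 2)⁻¹ /
          (∏ j, (f z - f (y j))) / Q z ^ n := by
    rw [← hoff]
    simp [Finset.prod_div_distrib, Finset.prod_mul_distrib, Finset.prod_inv_distrib]
  have hrev0 : (revSign n : K) ≠ 0 := left_ne_zero_of_mul_eq_one hrev
  have hQx' : ∏ i, Q (x i) ≠ 0 := Finset.prod_ne_zero_iff.2 fun i _ => hQx i
  have hQy' : ∏ i, Q (y i) ≠ 0 := Finset.prod_ne_zero_iff.2 fun i _ => hQy i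
  change Q z ≠ 0 at hQz
  rw [hQprod, hcol, Finset.prod_mul_distrib, hdiff, hflip]
  set D := (Matrix.of fun i j => ThreeColour.F ζ (x i) (y j) z /
    ThreeColour.G ζ (x i) (y j)).det
  set V := ∏ i, ∏ j ∈ Finset.Ioi i, (f (y j) - f (y i))
  rw [← hpow]
  have q1 := pow_ne_zero n hQx'
  have q2 := pow_ne_zero n hQy'
  have q3 := pow_ne_zero n hQz
  generalize (∏ i, Q (x i)) ^ n = a1 at *
  generalize (∏ i, Q (y i)) ^ n = a2 at *
  generalize Q z ^ n = a3 at *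
  generalize (-(ζ + 2)) ^ n = a4
  generalize (-1 : K) ^ (n * n) = a5
  generalize (∏ i, ∏ j, ThreeColour.G ζ (x i) (y j)) = a6
  generalize (∏ i, ∏ j, (x i - y j)) = a7
  generalize (∏ j, (f z - f (y j))) = a8 at *
  generalize (∏ i, (z - x i)) = a9
  generalize (∏ i, (z - y i)) = b1
  have e5 : (revSign n : K)⁻¹ = revSign n := inv_eq_of_mul_eq_one_left hrev
  rw [mul_inv, e5]
  generalize (revSign n : K) = r
  field_simp

end CauchyDeterminant

end SpecialPoly

namespace SpecialPoly

/-! ### S_n as a determinant of remainders. -/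

section SPolynomial

open ThreeColour (PolyRing zeta S SFrac S_spec ix iy iz SEval)

lemma famW_map {R R' : Type*} [CommRing R] [CommRing R'] (f : R →+* R') (ζ : R) (n : ℕ)
    (r : Fin n ⊕ Fin (n + 1)) : (famW ζ n r).map f = famW (f ζ) n r := by
  rcases r with k | k <;>
    simp [famW, polyP, polyQ, polyW, Polynomial.map_sub, Polynomial.map_mul, Polynomial.map_pow,
      Polynomial.map_add, map_ofNat]

/-- The determinant of the values of a family at given points, in terms of a determinant of
remainders. -/
lemma det_eval_eq {K : Type*} [Field K] {n : ℕ} (φ : Fin n ⊕ Fin (n + 1) → K[X]) (x y : Fin n → K)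
    (z : K) :
    (Matrix.of fun r c : Fin n ⊕ Fin (n + 1) =>
      (φ r).eval ((Sum.elim x (Fin.snoc y z : Fin (n + 1) → K)) c)).det =
    coefDet φ (∏ c, (X - C ((Sum.elim x (Fin.snoc y z : Fin (n + 1) → K)) c))) *
      ((∏ i, ∏ j ∈ Finset.Ioi i, (x j - x i)) * (∏ i, ∏ j ∈ Finset.Ioi i, (y j - y i)) *
        ((∏ i, ∏ j, (y j - x i)) * (∏ i, (z - x i)) * ∏ j, (z - y j))) := by
  set pts : Fin n ⊕ Fin (n + 1) → K := Sum.elim x (Fin.snoc y z : Fin (n + 1) → K) with hpts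
  have hN : (∏ c, (X - C (pts c))).Monic := monic_prod_of_monic _ _ fun c _ => monic_X_sub_C _
  have hd : (∏ c, (X - C (pts c))).natDegree = n + (n + 1) := by
    rw [natDegree_prod_of_monic _ _ fun c _ => monic_X_sub_C _]
    simp
  -- The second half of this basis vanishes at the x i, so its matrix of values is block triangular
  -- with Vandermonde diagonal blocks, one in the x i and one in the y j and z.
  set e : Fin n ⊕ Fin (n + 1) → K[X] :=
    Sum.elim (fun k => X ^ (k : ℕ)) (fun k => (∏ i, (X - C (x i))) * X ^ (k : ℕ)) with he
  have hm : (∏ i, (X - C (x i))).Monic := monic_prod_of_monic _ _ fun c _ => monic_X_sub_C _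
  have key := det_functional_monic hN hd (fun c => leval (pts c)) (fun c f => by
      simp only [leval_apply, eval_mul, eval_prod]
      rw [Finset.prod_eq_zero (Finset.mem_univ c), zero_mul]
      simp) φ e (by
      rintro (k | k)
      · exact monic_X_pow _
      · exact hm.mul (monic_X_pow _)) (by
      rintro (k | k)
      · simp [he]
      · simp only [he, Sum.elim_inr, ord_inr]
        rw [hm.natDegree_mul (monic_X_pow _), natDegree_X_pow,
          natDegree_prod_of_monic _ _ fun c _ => monic_X_sub_C _]
        simp)
  simp only [leval_apply] at key
  rw [key]
  congr 1
  have hb : (Matrix.of fun r c => (e r).eval (pts c)) = Matrix.fromBlocks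
      (Matrix.vandermonde x).transpose
      (Matrix.of fun (k : Fin n) (j : Fin (n + 1)) =>
        (Fin.snoc y z : Fin (n + 1) → K) j ^ (k : ℕ)) 0
      (Matrix.of fun (k j : Fin (n + 1)) =>
        (∏ i, ((Fin.snoc y z : Fin (n + 1) → K) j - x i)) *
        (Matrix.of fun (k j : Fin (n + 1)) => (Fin.snoc y z : Fin (n + 1) → K) j ^ (k : ℕ)) k j) := by
    ext r c
    rcases r with k | k <;> rcases c with i | j
    · simp [he, hpts, Matrix.vandermonde]
    · simp [he, hpts]
    · simp only [he, hpts, Matrix.of_apply, Sum.elim_inr, Sum.elim_inl, eval_mul, eval_prod,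
        Matrix.fromBlocks_apply₂₁, Matrix.zero_apply]
      rw [Finset.prod_eq_zero (Finset.mem_univ i), zero_mul]
      simp
    · simp [he, hpts, eval_prod]
  rw [hb, Matrix.det_fromBlocks_zero₂₁, Matrix.det_transpose, Matrix.det_vandermonde,
    Matrix.det_mul_row, det_pow_snoc, Fin.prod_univ_castSucc]
  simp only [Fin.snoc_castSucc, Fin.snoc_last]
  rw [Finset.prod_comm]
  ring

variable {n : ℕ}

/-- The list `x₁, …, xₙ, y₁, …, yₙ, z`, split into the blocks `x` and `y, z`. -/
def blockIndex (n : ℕ) : Fin n ⊕ Fin (n + 1) → Fin (2 * n + 1) :=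
  Sum.elim ix (Fin.snoc iy (iz n) : Fin (n + 1) → Fin (2 * n + 1))

/-- The offset 2n of z is n plus the last index of the second block. -/
lemma blockIndex_val (c : Fin n ⊕ Fin (n + 1)) : (blockIndex n c : ℕ) = ord c := by
  rcases c with i | j
  · rfl
  · refine Fin.lastCases ?_ (fun j => ?_) j
    · simp [blockIndex, iz]; omega
    · simp [blockIndex, iy]

lemma G_X_ne_zero (a b : Fin (2 * n + 1)) :
    ThreeColour.G (zeta n) (MvPolynomial.X a) (MvPolynomial.X b) ≠ 0 := by
  intro h
  -- At ζ = 0 with all variables equal to 1, the value of G is 2.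
  have h2 := congrArg (MvPolynomial.eval₂Hom (Polynomial.evalRingHom (0 : ℚ)) (fun _ => 1)) h
  simp [ThreeColour.G, zeta] at h2
  norm_num at h2

lemma Q_X_ne_zero (a : Fin (2 * n + 1)) :
    (polyQ (zeta n)).eval (MvPolynomial.X a) ≠ 0 := by
  intro h
  have h2 := congrArg (MvPolynomial.eval₂Hom (Polynomial.evalRingHom (0 : ℚ)) (fun _ => 1)) h
  simp [polyQ, zeta] at h2

lemma X_sub_X_ne_zero {a b : Fin (2 * n + 1)} (h : a ≠ b) :
    (MvPolynomial.X a - MvPolynomial.X b : PolyRing n) ≠ 0 :=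
  sub_ne_zero.2 fun h' => h (MvPolynomial.X_injective h')

/-- The polynomial `S_n` as a determinant of remainders. -/
lemma S_eq_coefDet (n : ℕ) :
    (revSign n : PolyRing n) * (-(zeta n + 2)) ^ n * S n =
      coefDet (famW (zeta n) n) (∏ c, (X - C (MvPolynomial.X (blockIndex n c)))) := by
  set φ := algebraMap (PolyRing n) (FractionRing (PolyRing n)) with hφ
  have hinj : Function.Injective φ := IsFractionRing.injective _ _
  have hne {a : PolyRing n} (h : a ≠ 0) : φ a ≠ 0 := (map_ne_zero_iff φ hinj).2 h
  -- Both sides are polynomials, so it suffices to compare them in the fraction field, where the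
  -- variables are generic points and the Vandermonde factors can be cancelled. The resulting
  -- identity has no denominators and survives any specialization.
  apply hinj
  have hN : (∏ c, (X - C (MvPolynomial.X (blockIndex n c) : PolyRing n))).Monic :=
    monic_prod_of_monic _ _ fun c _ => monic_X_sub_C _
  rw [map_coefDet φ hN]
  simp only [famW_map]
  set xK : Fin n → FractionRing (PolyRing n) := fun i => φ (ThreeColour.x i) with hxK
  set yK : Fin n → FractionRing (PolyRing n) := fun i => φ (ThreeColour.y i) with hyK
  set zK : FractionRing (PolyRing n) := φ (ThreeColour.z n) with hzK
  have hpts (c) : φ (MvPolynomial.X (blockIndex n c)) =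
      (Sum.elim xK (Fin.snoc yK zK : Fin (n + 1) → FractionRing (PolyRing n))) c := by
    rcases c with i | j
    · rfl
    · refine Fin.lastCases ?_ (fun j => ?_) j
      · simp [blockIndex, hzK, ThreeColour.z]
      · simp [blockIndex, hyK, ThreeColour.y]
  have hmapN : (∏ c, (X - C (MvPolynomial.X (blockIndex n c) : PolyRing n))).map φ =
      ∏ c, (X - C ((Sum.elim xK (Fin.snoc yK zK : Fin (n + 1) → FractionRing (PolyRing n))) c)) := by
    rw [Polynomial.map_prod]
    exact Finset.prod_congr rfl fun c _ => by simp [hpts]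
  rw [hmapN]
  have hGφ (a b : PolyRing n) : ThreeColour.G (φ (zeta n)) (φ a) (φ b) =
      φ (ThreeColour.G (zeta n) a b) := by simp [ThreeColour.G, map_ofNat]
  have hFφ (a b c : PolyRing n) : ThreeColour.F (φ (zeta n)) (φ a) (φ b) (φ c) =
      φ (ThreeColour.F (zeta n) a b c) := by simp [ThreeColour.F, map_ofNat]
  have hQφ (a : PolyRing n) : (polyQ (φ (zeta n))).eval (φ a) = φ ((polyQ (zeta n)).eval a) := by
    simp [polyQ, map_ofNat]
  have hix (i j : Fin n) : ix i ≠ iy j := by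
    simp only [ix, iy, ne_eq, Fin.mk.injEq]; omega
  have hixx {i j : Fin n} (h : i ≠ j) : ix i ≠ ix j := by
    simp only [ix, ne_eq, Fin.mk.injEq]; omega
  have hiyy {i j : Fin n} (h : i ≠ j) : iy i ≠ iy j := by
    simp only [iy, ne_eq, Fin.mk.injEq]; omega
  have hiyz (j : Fin n) : iz n ≠ iy j := by
    simp only [iy, iz, ne_eq, Fin.mk.injEq]; omega
  have hixz (j : Fin n) : iz n ≠ ix j := by
    simp only [ix, iz, ne_eq, Fin.mk.injEq]; omega
  have hx0 : (∏ i, ∏ j ∈ Finset.Ioi i, (xK j - xK i)) ≠ 0 := by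
    refine Finset.prod_ne_zero_iff.2 fun i _ => Finset.prod_ne_zero_iff.2 fun j hj => ?_
    rw [hxK, ← map_sub]
    exact hne (X_sub_X_ne_zero (hixx (Finset.mem_Ioi.1 hj).ne'))
  have hy0 : (∏ i, ∏ j ∈ Finset.Ioi i, (yK j - yK i)) ≠ 0 := by
    refine Finset.prod_ne_zero_iff.2 fun i _ => Finset.prod_ne_zero_iff.2 fun j hj => ?_
    rw [hyK, ← map_sub]
    exact hne (X_sub_X_ne_zero (hiyy (Finset.mem_Ioi.1 hj).ne'))
  have hxy0 : (∏ i, ∏ j, (yK j - xK i)) ≠ 0 := by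
    refine Finset.prod_ne_zero_iff.2 fun i _ => Finset.prod_ne_zero_iff.2 fun j hj => ?_
    rw [hyK, hxK, ← map_sub]
    exact hne (X_sub_X_ne_zero (hix i j).symm)
  have hzx0 : (∏ i, (zK - xK i)) ≠ 0 := by
    refine Finset.prod_ne_zero_iff.2 fun i _ => ?_
    rw [hxK, hzK, ← map_sub]
    exact hne (X_sub_X_ne_zero (hixz i))
  have hzy0 : (∏ i, (zK - yK i)) ≠ 0 := by
    refine Finset.prod_ne_zero_iff.2 fun i _ => ?_
    rw [hyK, hzK, ← map_sub]
    exact hne (X_sub_X_ne_zero (hiyz i))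
  have h1 := det_famW_eval (φ (zeta n)) xK yK zK
    (fun i => by rw [hxK, hQφ]; exact hne (Q_X_ne_zero _))
    (fun i => by rw [hyK, hQφ]; exact hne (Q_X_ne_zero _))
    (by rw [hzK, hQφ]; exact hne (Q_X_ne_zero _))
    (fun i j => by
      rw [← sub_ne_zero, hyK, hxK, ← map_sub]; exact hne (X_sub_X_ne_zero (hix i j)))
    (fun i j => by rw [hyK, hxK, hGφ]; exact hne (G_X_ne_zero _ _))
    (fun i j hij => by
      rw [hyK, hGφ, ← map_sub, ← map_mul]
      exact hne (mul_ne_zero (X_sub_X_ne_zero (hiyy hij)) (G_X_ne_zero _ _)))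
    (fun j => by
      rw [hyK, hzK, hGφ, ← map_sub, ← map_mul]
      exact hne (mul_ne_zero (X_sub_X_ne_zero (hiyz j)) (G_X_ne_zero _ _)))
  rw [det_eval_eq] at h1
  have hS : φ (S n) * ((∏ i, ∏ j ∈ Finset.Ioi i, (xK j - xK i)) *
      (∏ i, ∏ j ∈ Finset.Ioi i, (yK j - yK i))) =
      (∏ i, ∏ j, ThreeColour.G (φ (zeta n)) (xK i) (yK j)) *
      (Matrix.of fun i j => ThreeColour.F (φ (zeta n)) (xK i) (yK j) zK /
        ThreeColour.G (φ (zeta n)) (xK i) (yK j)).det := by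
    rw [hφ, S_spec, SFrac, ← hφ]
    have hden : φ (∏ i : Fin n, ∏ j ∈ Finset.Ioi i, ((ThreeColour.x j - ThreeColour.x i) *
        (ThreeColour.y j - ThreeColour.y i))) = (∏ i, ∏ j ∈ Finset.Ioi i, (xK j - xK i)) *
      (∏ i, ∏ j ∈ Finset.Ioi i, (yK j - yK i)) := by
      simp only [map_prod, map_mul, map_sub, Finset.prod_mul_distrib, hxK, hyK]
    rw [hden]
    simp only [hxK, hyK, hzK, hGφ, hFφ, map_prod]
    rw [div_mul_eq_mul_div, div_mul_cancel₀]
    exact mul_ne_zero hx0 hy0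
  rw [← hS] at h1
  have hcancel := mul_ne_zero (mul_ne_zero hx0 hy0) (mul_ne_zero (mul_ne_zero hxy0 hzx0) hzy0)
  apply mul_right_cancel₀ hcancel
  rw [h1]
  simp only [map_mul, map_pow, map_neg, map_add, map_ofNat, map_intCast]
  ring

/-- `S_n` evaluated in an extension of `ℚ[ζ]`, as a determinant of remainders. -/
lemma SEval_eq_coefDet (n : ℕ) (v : Fin (2 * n + 1) → RatFunc ℚ) :
    (revSign n : RatFunc ℚ) * (-(RatFunc.X + 2)) ^ n * SEval n v =
      coefDet (famW RatFunc.X n) (∏ c, (X - C (v (blockIndex n c)))) := by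
  have h := congrArg (MvPolynomial.eval₂Hom (algebraMap ℚ[X] (RatFunc ℚ)) v) (S_eq_coefDet n)
  rw [map_coefDet _ (monic_prod_of_monic _ _ fun c _ => monic_X_sub_C _)] at h
  simp only [famW_map, Polynomial.map_prod] at h
  have hrev : MvPolynomial.eval₂ (algebraMap ℚ[X] (RatFunc ℚ)) v (revSign n : PolyRing n) =
      revSign n := by
    rw [← MvPolynomial.coe_eval₂Hom, map_intCast]
  simpa [zeta, SEval, map_ofNat, RatFunc.algebraMap_X, hrev] using h

end SPolynomial

end SpecialPoly

namespace SpecialPoly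

/-! ### Confluent points and expansion in local parameters. -/

section LocalParameters

lemma prod_ord {M : Type*} [CommMonoid M] {p q : ℕ} (f : ℕ → M) :
    ∏ c : Fin p ⊕ Fin q, f (ord c) = ∏ i ∈ Finset.range (p + q), f i := by
  simp [Fintype.prod_sum_type, Finset.prod_range, Fin.prod_univ_add]

/-- The modulus depends only on the multiset of points. Hence the arguments a may fill x₁, …, xₙ, y₁
although the later blocks attach b to the block of size n. -/
lemma prod_special_points {R : Type*} [CommRing R] (n : ℕ) (a b : R) :
    ∏ c : Fin n ⊕ Fin (n + 1),
      (X - C (if (blockIndex n c : ℕ) < n + 1 then a else b)) =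
      (X - C b) ^ n * (X - C a) ^ (n + 1) := by
  simp only [blockIndex_val]
  rw [prod_ord fun i => (X - C (if i < n + 1 then a else b)), show n + (n + 1) = (n + 1) + n by ring,
    Finset.prod_range_add, mul_comm]
  congr 1
  · rw [Finset.prod_congr rfl fun i hi => by rw [if_neg (by omega)]]
    simp
  · rw [Finset.prod_congr rfl fun i hi => by rw [if_pos (Finset.mem_range.1 hi)]]
    simp

lemma coefDet_blockComb {R : Type*} [CommRing R] {p q : ℕ} (N : R[X])
    (A : Matrix (Fin p) (Fin p) R) (B : Matrix (Fin p) (Fin q) R) (D : Matrix (Fin q) (Fin q) R)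
    (φ ψ : Fin p ⊕ Fin q → R[X])
    (h1 : ∀ k, ψ (Sum.inl k) = ∑ i, A k i • φ (Sum.inl i) + ∑ j, B k j • φ (Sum.inr j))
    (h2 : ∀ k, ψ (Sum.inr k) = ∑ j, D k j • φ (Sum.inr j)) :
    coefDet ψ N = A.det * D.det * coefDet φ N := by
  rw [coefDet_linearComb N (Matrix.fromBlocks A B 0 D) φ ψ, Matrix.det_fromBlocks_zero₂₁]
  rintro (k | k)
  · simp [Fintype.sum_sum_type, h1]
  · simp [Fintype.sum_sum_type, h2]

/-- This relation lets V replace W: VQ differs from a multiple of W by a combination of P and Q,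
which the other half of the family already contains. -/
lemma polyV_mul_polyQ {R : Type*} [CommRing R] (ζ : R) :
    C (ζ + 2) * (polyV ζ * polyQ ζ) =
      C (ζ * (1 + ζ)) * polyW ζ + C ((ζ + 2) ^ 2) * polyP ζ + C (ζ * (1 + ζ)) * polyQ ζ := by
  simp only [polyV, polyQ, polyW, polyP, map_add, map_mul, map_ofNat, map_one, map_pow]
  ring

/-- Block triangular row operations: the rows with P^k Q^{n-k} stay, and each row with V is, up to
scalars, the row with W plus two of them. -/
lemma coefDet_famV {R : Type*} [CommRing R] (ζ : R) (n : ℕ) (N : R[X]) :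
    (ζ + 2) ^ n * coefDet (famV ζ n) N = (ζ * (1 + ζ)) ^ n * coefDet (famW ζ n) N := by
  have h1 : coefDet (fun r => (Sum.elim (fun _ => ζ + 2) (fun _ => 1) : Fin n ⊕ Fin (n + 1) → R) r •
      famV ζ n r) N = (ζ + 2) ^ n * coefDet (famV ζ n) N := by
    rw [coefDet_smul]
    simp
  rw [← h1, coefDet_blockComb N (Matrix.diagonal fun _ => ζ * (1 + ζ))
    (Matrix.of fun k j => (if (j : ℕ) = k + 1 then (ζ + 2) ^ 2 else 0) +
      (if (j : ℕ) = k then ζ * (1 + ζ) else 0)) 1 (famW ζ n)]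
  · simp
  · intro k
    have e1 : ∑ j : Fin (n + 1), (Matrix.of fun (k : Fin n) (j : Fin (n + 1)) =>
        (if (j : ℕ) = k + 1 then (ζ + 2) ^ 2 else 0) +
        (if (j : ℕ) = k then ζ * (1 + ζ) else 0)) k j • famW ζ n (Sum.inr j) =
        (ζ + 2) ^ 2 • famW ζ n (Sum.inr k.succ) +
          (ζ * (1 + ζ)) • famW ζ n (Sum.inr k.castSucc) := by
      simp only [Matrix.of_apply, add_smul, Finset.sum_add_distrib, ite_smul, zero_smul]
      congr 1
      · rw [Finset.sum_eq_single k.succ]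
        · simp
        · intro b _ hb
          rw [if_neg]
          intro h
          exact hb (Fin.ext (by simpa using h))
        · simp
      · rw [Finset.sum_eq_single k.castSucc]
        · simp
        · intro b _ hb
          rw [if_neg]
          intro h
          exact hb (Fin.ext (by simpa using h))
        · simp
    rw [e1, Finset.sum_eq_single k (fun b _ hb => by simp [Matrix.diagonal_apply_ne' _ hb])
      (by simp)]
    simp only [Sum.elim_inl, famV, famW, Sum.elim_inr, Matrix.diagonal_apply_eq, smul_eq_C_mul,
      Fin.val_succ, Fin.val_castSucc]
    have h3 : n - (k : ℕ) = (n - 1 - k) + 1 := by omega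
    have h4 : n - ((k : ℕ) + 1) = n - 1 - k := by omega
    rw [h3, h4]
    linear_combination (polyP ζ ^ (k : ℕ) * polyQ ζ ^ (n - 1 - k)) * polyV_mul_polyQ ζ
  · intro k
    rw [Finset.sum_eq_single k (fun b _ hb => by simp [Matrix.one_apply_ne' hb]) (by simp)]
    simp [famV, famW]

variable {K : Type*} [Field K]

/-- The functional `f ↦ [t^j] u(t) f(Y(t))`. -/
noncomputable def localCoeff (Y u : PowerSeries K) (j : ℕ) : K[X] →ₗ[K] K :=
  (PowerSeries.coeff j).comp ((LinearMap.mulLeft K u).comp (aeval Y).toLinearMap)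

lemma localCoeff_apply (Y u : PowerSeries K) (j : ℕ) (f : K[X]) :
    localCoeff Y u j f = PowerSeries.coeff j (u * aeval Y f) := rfl

/-- The determinant of local functionals at two points `b` and `a`. -/
lemma det_localCoeff {p q : ℕ} (a b : K) (Ya Yb ua ub : PowerSeries K)
    (φ : Fin p ⊕ Fin q → K[X]) :
    (Matrix.of fun r c : Fin p ⊕ Fin q => (Sum.elim
      (fun j : Fin p => localCoeff (PowerSeries.C b + PowerSeries.X * Yb) ub j)
      (fun j : Fin q => localCoeff (PowerSeries.C a + PowerSeries.X * Ya) ua j) c) (φ r)).det =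
    coefDet φ ((X - C b) ^ p * (X - C a) ^ q) *
      ((∏ j : Fin p, (PowerSeries.constantCoeff Yb ^ (j : ℕ) * PowerSeries.constantCoeff ub)) *
        ∏ j : Fin q, ((a - b) ^ p * PowerSeries.constantCoeff Ya ^ (j : ℕ) *
          PowerSeries.constantCoeff ua)) := by
  set L : Fin p ⊕ Fin q → K[X] →ₗ[K] K := Sum.elim
      (fun j : Fin p => localCoeff (PowerSeries.C b + PowerSeries.X * Yb) ub j)
      (fun j : Fin q => localCoeff (PowerSeries.C a + PowerSeries.X * Ya) ua j) with hL
  have hb : aeval (PowerSeries.C b + PowerSeries.X * Yb) (X - C b) = PowerSeries.X * Yb := by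
    simp
  have ha : aeval (PowerSeries.C a + PowerSeries.X * Ya) (X - C a) = PowerSeries.X * Ya := by
    simp
  have hab : aeval (PowerSeries.C a + PowerSeries.X * Ya) (X - C b) =
      PowerSeries.C (a - b) + PowerSeries.X * Ya := by
    simp
    ring
  have hm1 : ((X - C b) ^ p : K[X]).Monic := (monic_X_sub_C b).pow p
  have hm2 : ((X - C a) ^ q : K[X]).Monic := (monic_X_sub_C a).pow q
  have hvan (j k : ℕ) (hjk : j < k) (g : PowerSeries K) :
      PowerSeries.coeff j (PowerSeries.X ^ k * g) = 0 := by
    rw [PowerSeries.coeff_X_pow_mul', if_neg (by omega)]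
  have hdiag (j : ℕ) (g : PowerSeries K) :
      PowerSeries.coeff j (PowerSeries.X ^ j * g) = PowerSeries.constantCoeff g := by
    rw [PowerSeries.coeff_X_pow_mul', if_pos le_rfl, Nat.sub_self,
      PowerSeries.coeff_zero_eq_constantCoeff_apply]
  -- In the basis (X-b)^j, (X-b)^p (X-a)^j, the order of vanishing at b and then at a makes the
  -- matrix triangular; its diagonal collects the constant terms.
  rw [det_functional_monic (hm1.mul hm2) (by
    rw [hm1.natDegree_mul hm2, natDegree_pow, natDegree_pow, natDegree_X_sub_C,
      natDegree_X_sub_C, mul_one, mul_one]) L ?_ φ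
    (Sum.elim (fun j => (X - C b) ^ (j : ℕ)) (fun j => (X - C b) ^ p * (X - C a) ^ (j : ℕ)))
    ?_ ?_]
  · congr 1
    rw [← Matrix.det_transpose, det_of_ord_triangular _ ord ord_injective, Fintype.prod_sum_type]
    · congr 1
      · refine Finset.prod_congr rfl fun j _ => ?_
        simp only [Matrix.transpose_apply, Matrix.of_apply, hL, Sum.elim_inl, localCoeff_apply,
          map_pow, hb]
        rw [mul_pow, mul_left_comm, hdiag]
        simp [mul_comm]
      · refine Finset.prod_congr rfl fun j _ => ?_
        simp only [Matrix.transpose_apply, Matrix.of_apply, hL, Sum.elim_inr, localCoeff_apply,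
          map_pow, map_mul, ha, hab]
        rw [show ua * ((PowerSeries.C (a - b) + PowerSeries.X * Ya) ^ p *
          (PowerSeries.X * Ya) ^ (j : ℕ)) = PowerSeries.X ^ (j : ℕ) *
          (ua * (PowerSeries.C (a - b) + PowerSeries.X * Ya) ^ p * Ya ^ (j : ℕ)) by ring, hdiag]
        simp
        ring
    · rintro (j | j) (i | i) h
      · simp only [Matrix.transpose_apply, Matrix.of_apply, hL, Sum.elim_inl, localCoeff_apply,
          map_pow, hb]
        rw [mul_pow, mul_left_comm, hvan _ _ (by simpa using h)]
      · simp only [Matrix.transpose_apply, Matrix.of_apply, hL, Sum.elim_inl, Sum.elim_inr,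
          localCoeff_apply, map_pow, map_mul, hb]
        rw [mul_pow, mul_assoc, mul_left_comm, hvan _ _ j.2]
      · simp at h
        omega
      · simp only [Matrix.transpose_apply, Matrix.of_apply, hL, Sum.elim_inr, localCoeff_apply,
          map_pow, map_mul, ha]
        rw [mul_pow, mul_left_comm, mul_left_comm _ (PowerSeries.X ^ _),
          mul_left_comm _ (PowerSeries.X ^ _), hvan _ _ (by simpa using h)]
  · rintro (j | j) f
    · simp only [hL, Sum.elim_inl, localCoeff_apply, map_mul, map_pow, hb]
      rw [mul_pow, mul_assoc, mul_assoc, mul_left_comm, hvan _ _ j.2]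
    · simp only [hL, Sum.elim_inr, localCoeff_apply, map_mul, map_pow, ha]
      rw [mul_pow, show ∀ A B C D E : PowerSeries K, A * (B * (C * D) * E) = C * (A * B * D * E) by
        intros; ring, hvan _ _ j.2]
  · rintro (j | j)
    · exact (monic_X_sub_C b).pow _
    · exact hm1.mul ((monic_X_sub_C a).pow _)
  · rintro (j | j)
    · simp [natDegree_pow]
    · simp only [Sum.elim_inr, ord_inr]
      rw [hm1.natDegree_mul ((monic_X_sub_C a).pow _), natDegree_pow, natDegree_pow,
        natDegree_X_sub_C, natDegree_X_sub_C, mul_one, mul_one]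

/-- Expanding in the local parameters `P/Q` at `a` and `Q/P` at `b` reduces the determinant of
size `2n + 1` to a determinant of size `n`. -/
lemma det_reduced {n : ℕ} (ζ a b : K) (Ya Yb ua ub : PowerSeries K)
    (hPa : aeval (PowerSeries.C a + PowerSeries.X * Ya) (polyP ζ) =
      PowerSeries.X * aeval (PowerSeries.C a + PowerSeries.X * Ya) (polyQ ζ))
    (hQb : aeval (PowerSeries.C b + PowerSeries.X * Yb) (polyQ ζ) =
      PowerSeries.X * aeval (PowerSeries.C b + PowerSeries.X * Yb) (polyP ζ))
    (hua : ua * aeval (PowerSeries.C a + PowerSeries.X * Ya) (polyQ ζ) ^ n = 1)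
    (hub : ub * aeval (PowerSeries.C b + PowerSeries.X * Yb) (polyP ζ) ^ n = 1) :
    (Matrix.of fun k j : Fin n =>
      PowerSeries.coeff (j : ℕ) (PowerSeries.X ^ (n - k) *
        aeval (PowerSeries.C b + PowerSeries.X * Yb) (polyV ζ)) -
      PowerSeries.coeff (n - j) (PowerSeries.X ^ (k : ℕ) *
        aeval (PowerSeries.C a + PowerSeries.X * Ya) (polyV ζ))).det =
    coefDet (famV ζ n) ((X - C b) ^ n * (X - C a) ^ (n + 1)) *
      ((∏ j : Fin n, (PowerSeries.constantCoeff Yb ^ (j : ℕ) * PowerSeries.constantCoeff ub)) *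
        ∏ j : Fin (n + 1), ((a - b) ^ n * PowerSeries.constantCoeff Ya ^ (j : ℕ) *
          PowerSeries.constantCoeff ua)) := by
  rw [← det_localCoeff a b Ya Yb ua ub (famV ζ n)]
  set Xa := PowerSeries.C a + PowerSeries.X * Ya
  set Xb := PowerSeries.C b + PowerSeries.X * Yb
  -- With weight Q^{-n} at a, P^k Q^{n-k} becomes the k-th power of the local parameter; with weight
  -- P^{-n} at b it becomes the power n-k.
  have ea (k : ℕ) (hk : k ≤ n) : ua * (aeval Xa (polyP ζ) ^ k * aeval Xa (polyQ ζ) ^ (n - k)) =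
      PowerSeries.X ^ k := by
    rw [hPa, mul_pow, mul_assoc, ← pow_add, Nat.add_sub_cancel' hk, mul_left_comm, hua, mul_one]
  have eb (k : ℕ) (hk : k ≤ n) : ub * (aeval Xb (polyP ζ) ^ k * aeval Xb (polyQ ζ) ^ (n - k)) =
      PowerSeries.X ^ (n - k) := by
    rw [hQb, mul_pow, mul_left_comm _ (PowerSeries.X ^ _), ← pow_add, Nat.add_sub_cancel' hk,
      mul_left_comm, hub, mul_one]
  -- The lower right block is the identity and the lower left one is a partial reversal, so the
  -- Schur complement is just a difference of two coefficients of V.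
  have hM : (Matrix.of fun r c : Fin n ⊕ Fin (n + 1) => (Sum.elim
      (fun j : Fin n => localCoeff Xb ub j)
      (fun j : Fin (n + 1) => localCoeff Xa ua j) c) (famV ζ n r)) =
      Matrix.fromBlocks
        (Matrix.of fun k j : Fin n =>
          PowerSeries.coeff (j : ℕ) (PowerSeries.X ^ (n - k) * aeval Xb (polyV ζ)))
        (Matrix.of fun (k : Fin n) (c : Fin (n + 1)) =>
          PowerSeries.coeff (c : ℕ) (PowerSeries.X ^ (k : ℕ) * aeval Xa (polyV ζ)))
        (Matrix.of fun (c : Fin (n + 1)) (j : Fin n) => if (c : ℕ) = n - j then 1 else 0) 1 := by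
    ext r c
    rcases r with k | k <;> rcases c with j | j
    · simp only [Matrix.of_apply, Sum.elim_inl, localCoeff_apply, famV, map_mul, map_pow,
        Matrix.fromBlocks_apply₁₁]
      rw [mul_assoc, mul_left_comm, eb _ k.2.le, mul_comm]
    · simp only [Matrix.of_apply, Sum.elim_inl, Sum.elim_inr, localCoeff_apply, famV, map_mul,
        map_pow, Matrix.fromBlocks_apply₁₂]
      rw [mul_assoc, mul_left_comm, ea _ k.2.le, mul_comm]
    · simp only [Matrix.of_apply, Sum.elim_inl, Sum.elim_inr, localCoeff_apply, famV, map_mul,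
        map_pow, Matrix.fromBlocks_apply₂₁]
      rw [eb _ (Nat.lt_succ_iff.1 k.2), PowerSeries.coeff_X_pow]
      refine if_congr ?_ rfl rfl
      have := j.2
      have := k.2
      omega
    · simp only [Matrix.of_apply, Sum.elim_inr, localCoeff_apply, famV, map_mul,
        map_pow, Matrix.fromBlocks_apply₂₂]
      rw [ea _ (Nat.lt_succ_iff.1 k.2), PowerSeries.coeff_X_pow, Matrix.one_apply]
      refine if_congr ?_ rfl rfl
      rw [Fin.ext_iff, eq_comm]
  rw [hM, Matrix.det_fromBlocks_one₂₂]
  congr 1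
  ext k j
  simp only [Matrix.of_apply, Matrix.sub_apply, Matrix.mul_apply, mul_ite, mul_one, mul_zero]
  rw [Finset.sum_eq_single (⟨n - j, by omega⟩ : Fin (n + 1))]
  · simp
  · intro b _ hb
    rw [if_neg]
    intro h
    exact hb (Fin.ext h)
  · simp

end LocalParameters

end SpecialPoly

namespace SpecialPoly

/-! ### The two local expansions as power series over ℚ[ζ]. -/

section Series

/-- A formal fixed point equation `u = y₀ + t Φ(u)` has a solution. -/
lemma exists_fixedPoint {R : Type*} [CommRing R] (y₀ : R) (Φ : (PowerSeries R)[X]) :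
    ∃ u : PowerSeries R, u = PowerSeries.C y₀ + PowerSeries.X * Φ.eval u := by
  set step : PowerSeries R → PowerSeries R :=
    fun u => PowerSeries.C y₀ + PowerSeries.X * Φ.eval u with hstep
  -- u - v divides Φ(u) - Φ(v), so the step is a contraction in the X-adic metric.
  have hcontr (u v : PowerSeries R) (k : ℕ) (h : PowerSeries.X ^ k ∣ u - v) :
      PowerSeries.X ^ (k + 1) ∣ step u - step v := by
    have : step u - step v = PowerSeries.X * (Φ.eval u - Φ.eval v) := by
      simp only [hstep]
      ring
    rw [this, pow_succ']
    exact mul_dvd_mul_left _ (h.trans (sub_dvd_eval_sub u v Φ))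
  set U : ℕ → PowerSeries R := fun k => step^[k] 0 with hU
  have hUs (k : ℕ) : U (k + 1) = step (U k) := by
    simp only [hU, Function.iterate_succ_apply']
  have h1 (k : ℕ) : PowerSeries.X ^ k ∣ U (k + 1) - U k := by
    induction k with
    | zero => simp
    | succ k ih =>
      rw [hUs (k + 1), hUs k]
      exact hcontr _ _ k (by rwa [← hUs])
  have h2 (k m : ℕ) : PowerSeries.X ^ k ∣ U (k + m) - U k := by
    induction m with
    | zero => simp
    | succ m ih =>
      have := (pow_dvd_pow PowerSeries.X (Nat.le_add_right k m)).trans (h1 (k + m))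
      have h3 := dvd_add this ih
      rwa [sub_add_sub_cancel] at h3
  -- The coefficient of index k is constant from the iterate k+1 on.
  set u : PowerSeries R := PowerSeries.mk fun k => PowerSeries.coeff k (U (k + 1)) with hu
  have h3 (k : ℕ) : PowerSeries.X ^ k ∣ u - U k := by
    rw [PowerSeries.X_pow_dvd_iff]
    intro m hm
    rw [map_sub, hu, PowerSeries.coeff_mk, ← map_sub, ← neg_sub, map_neg, neg_eq_zero]
    obtain ⟨d, rfl⟩ := Nat.exists_eq_add_of_lt hm
    have := h2 (m + 1) d
    rw [PowerSeries.X_pow_dvd_iff] at this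
    have h4 := this m (by omega)
    rwa [show m + 1 + d = m + d + 1 by ring] at h4
  refine ⟨u, ?_⟩
  change u = step u
  rw [← sub_eq_zero]
  ext m
  have h4 := hcontr u (U m) m (h3 m)
  rw [← hUs] at h4
  have h5 := dvd_sub (h3 (m + 1)) h4
  rw [sub_sub_sub_cancel_right, PowerSeries.X_pow_dvd_iff] at h5
  simpa using h5 m (by omega)

/-- The polynomial `2ζ + 1`. -/
noncomputable def aPoly : ℚ[X] := 2 * X + 1

/-- Insert Y = 1 + τU in the cubic for Y and divide by τ. The constant term is (ζ+2)a - ζ = 2(1+ζ)².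
-/
lemma exists_serU : ∃ u : PowerSeries ℚ[X], u = PowerSeries.C (2 * (1 + X) ^ 2) +
    PowerSeries.X * (PowerSeries.C ((X + 2) * aPoly) * u - 2 * u ^ 2 - PowerSeries.X * u ^ 3) := by
  obtain ⟨u, hu⟩ := exists_fixedPoint (2 * (1 + X) ^ 2 : ℚ[X])
    (C (PowerSeries.C ((X + 2) * aPoly)) * X - 2 * X ^ 2 - C PowerSeries.X * X ^ 3)
  refine ⟨u, ?_⟩
  conv_lhs => rw [hu]
  simp

/-- `(Y - 1)/τ`, where `Y` is the solution of `Y²(Y - 1) = τ((ζ + 2)aY - ζ)` with `Y(0) = 1`. -/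
noncomputable def serU : PowerSeries ℚ[X] := exists_serU.choose

lemma serU_spec : serU = PowerSeries.C (2 * (1 + X) ^ 2) +
    PowerSeries.X * (PowerSeries.C ((X + 2) * aPoly) * serU - 2 * serU ^ 2 -
      PowerSeries.X * serU ^ 3) := exists_serU.choose_spec

/-- The solution of `Y²(Y - 1) = τ((ζ + 2)aY - ζ)` with `Y(0) = 1`. -/
noncomputable def serY : PowerSeries ℚ[X] := 1 + PowerSeries.X * serU

lemma serY_spec : serY ^ 2 * (serY - 1) =
    PowerSeries.X * (PowerSeries.C ((X + 2) * aPoly) * serY - PowerSeries.C X) := by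
  have h : PowerSeries.C (2 * (1 + X) ^ 2 : ℚ[X]) =
      PowerSeries.C ((X + 2) * aPoly) - PowerSeries.C X := by
    rw [← map_sub, aPoly]
    congr 1
    ring
  have h2 := serU_spec
  rw [h] at h2
  rw [serY]
  linear_combination PowerSeries.X * h2

/-- The equation Q = σP near b, after x = Z/(ζ+2) and after absorbing (ζ+2)³ in the parameter. This
normalization keeps the coefficients polynomial in ζ. -/
lemma exists_serZ : ∃ u : PowerSeries ℚ[X], u = PowerSeries.C X +
    PowerSeries.X * (u ^ 2 * (u - PowerSeries.C (aPoly * (X + 2)))) := by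
  obtain ⟨u, hu⟩ := exists_fixedPoint (X : ℚ[X])
    (X ^ 2 * (X - C (PowerSeries.C (aPoly * (X + 2)))))
  refine ⟨u, ?_⟩
  conv_lhs => rw [hu]
  simp

/-- The solution of `Z = ζ + σZ²(Z - a(ζ + 2))`. -/
noncomputable def serZ : PowerSeries ℚ[X] := exists_serZ.choose

lemma serZ_spec : serZ = PowerSeries.C X +
    PowerSeries.X * (serZ ^ 2 * (serZ - PowerSeries.C (aPoly * (X + 2)))) :=
  exists_serZ.choose_spec

/-- The coefficients of `Y(aY - 1 - ζ)`. -/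
noncomputable def alpha (m : ℕ) : ℚ[X] :=
  PowerSeries.coeff m (serY * (PowerSeries.C aPoly * serY - PowerSeries.C (1 + X)))

/-- The coefficients of `Z(Z - (1 + ζ)(2 + ζ))`. -/
noncomputable def beta (m : ℕ) : ℚ[X] :=
  PowerSeries.coeff m (serZ * (serZ - PowerSeries.C ((1 + X) * (X + 2))))

end Series

/-! ### The reduced n×n matrix. -/

section Hankel

variable {K : Type*} [Field K]

/-- The reduced matrix. -/
noncomputable def hMat (ev : ℚ[X] →+* K) (n : ℕ) : Matrix (Fin n) (Fin n) K :=
  Matrix.of fun k j =>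
    (if n ≤ k + j then ((ev X + 2)⁻¹) ^ 2 * ((ev X + 2)⁻¹ ^ 3) ^ ((k : ℕ) + j - n) *
      ev (beta (k + j - n)) else 0) -
    (if (k : ℕ) + j ≤ n then ev aPoly * ((ev aPoly)⁻¹ ^ 3) ^ (n - k - j) *
      ev (alpha (n - k - j)) else 0)

lemma rescale_C_eq (c s : K) : PowerSeries.rescale c (PowerSeries.C s) = PowerSeries.C s := by
  ext m
  rw [PowerSeries.coeff_rescale, PowerSeries.coeff_C]
  split_ifs with h <;> simp [h]

lemma constantCoeff_rescale_eq (c : K) (f : PowerSeries K) :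
    PowerSeries.constantCoeff (PowerSeries.rescale c f) = PowerSeries.constantCoeff f := by
  rw [← PowerSeries.coeff_zero_eq_constantCoeff_apply, PowerSeries.coeff_rescale]
  simp

lemma prod_pow_val {M : Type*} [CommMonoid M] (c : M) (n : ℕ) :
    ∏ j : Fin n, c ^ (j : ℕ) = c ^ n.choose 2 := by
  rw [Finset.prod_pow_eq_pow_sum, ← Finset.sum_range fun i => i, Finset.sum_range_id,
    Nat.choose_two_right]

lemma sq_eq_choose (n : ℕ) : n ^ 2 = 2 * n.choose 2 + n := by
  induction n with
  | zero => rfl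
  | succ n ih =>
    rw [Nat.choose_succ_succ' n 1, Nat.choose_one_right]
    simp only [Nat.reduceAdd]
    nlinarith

/-- The points near a and b are aY(τ/a³) and Z(σ/(ζ+2)³)/(ζ+2). Substituting in V gives the scaled
coefficients `alpha` and `beta`, and `det_reduced` applies; what remains is the product of the
leading terms of the local data. The nonvanishing conditions make these terms invertible. -/
lemma det_hMat (ev : ℚ[X] →+* K) (n : ℕ) (h0 : ev X ≠ 0) (ha : ev aPoly ≠ 0)
    (h2 : ev X + 2 ≠ 0) (hε : 1 + ev X ≠ 0) (hK : (2 : K) ≠ 0) :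
    (-1) ^ (n + 1).choose 2 * (ev X * ev aPoly) ^ (n ^ 2 + n) * (hMat ev n).det =
      (ev X + 2) ^ n *
        coefDet (famV (ev X) n) ((X - C (ev X / (ev X + 2))) ^ n * (X - C (ev aPoly)) ^ (n + 1)) := by
  set ζ := ev X with hζ
  set a := ev aPoly with ha'
  have haζ : a = 2 * ζ + 1 := by simp [ha', hζ, aPoly, map_ofNat]
  set U := PowerSeries.map ev serU with hU
  set Y := PowerSeries.map ev serY with hY
  set Z := PowerSeries.map ev serZ with hZ
  have hYU : Y = 1 + PowerSeries.X * U := by simp [hY, hU, serY]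
  have hYeq : Y ^ 2 * (Y - 1) =
      PowerSeries.X * (PowerSeries.C ((ζ + 2) * a) * Y - PowerSeries.C ζ) := by
    have := congrArg (PowerSeries.map ev) serY_spec
    simpa [map_ofNat] using this
  have hZeq : Z = PowerSeries.C ζ +
      PowerSeries.X * (Z ^ 2 * (Z - PowerSeries.C (a * (ζ + 2)))) := by
    have := congrArg (PowerSeries.map ev) serZ_spec
    simpa [map_ofNat] using this
  have hU0 : PowerSeries.constantCoeff U = 2 * (1 + ζ) ^ 2 := by
    have := congrArg (fun s => PowerSeries.constantCoeff (PowerSeries.map ev s)) serU_spec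
    simpa [map_ofNat] using this
  have hZ0 : PowerSeries.constantCoeff Z = ζ := by
    have := congrArg PowerSeries.constantCoeff hZeq
    simpa using this
  set g := ζ + 2 with hg
  set c := a⁻¹ ^ 3 with hc
  set d := g⁻¹ ^ 3 with hd
  have hac : a ^ 3 * c = 1 := by rw [hc]; field_simp
  have hgd : g * g⁻¹ = 1 := mul_inv_cancel₀ h2
  set Z1 := Z ^ 2 * (Z - PowerSeries.C (a * g)) with hZ1
  set ra := PowerSeries.rescale c with hra
  set rb := PowerSeries.rescale d with hrb
  have hraC (s : K) : ra (PowerSeries.C s) = PowerSeries.C s := by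
    rw [hra, rescale_C_eq]
  have hrbC (s : K) : rb (PowerSeries.C s) = PowerSeries.C s := by
    rw [hrb, rescale_C_eq]
  have hraX : ra PowerSeries.X = PowerSeries.C c * PowerSeries.X := PowerSeries.rescale_X c
  have hrbX : rb PowerSeries.X = PowerSeries.C d * PowerSeries.X := PowerSeries.rescale_X d
  set Ya := PowerSeries.C (a * c) * ra U with hYa
  set Yb := PowerSeries.C (g⁻¹ * d) * rb Z1 with hYb
  -- `Ya` and `Yb` were chosen so that the expansions in the shape used by `det_reduced` are
  -- rescalings of the universal series.
  have hXa : PowerSeries.C a + PowerSeries.X * Ya = PowerSeries.C a * ra Y := by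
    rw [hYa, hYU, map_add, map_one, map_mul ra, hraX, map_mul PowerSeries.C]
    ring
  have hXb : PowerSeries.C (ζ / g) + PowerSeries.X * Yb = PowerSeries.C g⁻¹ * rb Z := by
    rw [hZeq, hYb, map_add, hrbC, map_mul rb PowerSeries.X Z1, hrbX, map_mul PowerSeries.C, div_eq_mul_inv,
      map_mul PowerSeries.C]
    ring
  have hraY : ra Y ^ 2 * (ra Y - 1) = PowerSeries.C c * PowerSeries.X *
      (PowerSeries.C (g * a) * ra Y - PowerSeries.C ζ) := by
    have := congrArg ra hYeq
    simpa only [map_mul ra, map_pow, map_sub, map_one, hraX, hraC] using this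
  have hrbZ : rb Z = PowerSeries.C ζ + PowerSeries.C d * PowerSeries.X * rb Z1 := by
    have := congrArg rb hZeq
    simpa only [map_mul rb, map_add, hrbX, hrbC] using this
  have hrbZ1 : rb Z1 = rb Z ^ 2 * (rb Z - PowerSeries.C (a * g)) := by
    rw [hZ1, map_mul, map_pow, map_sub, hrbC]
  have eP (s : PowerSeries K) : aeval s (polyP ζ) = s ^ 2 * (s - PowerSeries.C a) := by
    rw [haζ]
    simp [polyP, map_ofNat]
  have eQ (s : PowerSeries K) : aeval s (polyQ ζ) = PowerSeries.C g * s - PowerSeries.C ζ := by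
    simp [polyQ, hg, map_ofNat]
  have eV (s : PowerSeries K) : aeval s (polyV ζ) = s * (s - PowerSeries.C (1 + ζ)) := by
    simp [polyV]
  have hC1 : (PowerSeries.C a) ^ 3 * PowerSeries.C c = 1 := by
    rw [← map_pow, ← map_mul, hac, map_one]
  have hC2 : PowerSeries.C g * PowerSeries.C g⁻¹ = (1 : PowerSeries K) := by
    rw [← map_mul, hgd, map_one]
  have hC3 : PowerSeries.C d = (PowerSeries.C g⁻¹ : PowerSeries K) ^ 3 := by
    rw [hd, map_pow]
  have hPa : aeval (PowerSeries.C a + PowerSeries.X * Ya) (polyP ζ) =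
      PowerSeries.X * aeval (PowerSeries.C a + PowerSeries.X * Ya) (polyQ ζ) := by
    rw [hXa, eP, eQ]
    rw [map_mul PowerSeries.C] at hraY
    linear_combination (PowerSeries.C a) ^ 3 * hraY + PowerSeries.X *
      (PowerSeries.C g * PowerSeries.C a * ra Y - PowerSeries.C ζ) * hC1
  have hQb : aeval (PowerSeries.C (ζ / g) + PowerSeries.X * Yb) (polyQ ζ) =
      PowerSeries.X * aeval (PowerSeries.C (ζ / g) + PowerSeries.X * Yb) (polyP ζ) := by
    rw [hXb, eP, eQ]
    rw [hrbZ1, hC3, map_mul PowerSeries.C] at hrbZ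
    have h5 : PowerSeries.C g⁻¹ * rb Z - PowerSeries.C a =
        PowerSeries.C g⁻¹ * (rb Z - PowerSeries.C a * PowerSeries.C g) := by
      linear_combination (PowerSeries.C a) * hC2
    rw [h5]
    linear_combination rb Z * hC2 + hrbZ
  have hQa0 : PowerSeries.constantCoeff
      (aeval (PowerSeries.C a + PowerSeries.X * Ya) (polyQ ζ)) = 2 * (1 + ζ) ^ 2 := by
    rw [eQ]
    simp only [map_sub, map_mul, map_add, PowerSeries.constantCoeff_C,
      PowerSeries.constantCoeff_X, zero_mul, add_zero]
    rw [hg, haζ]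
    ring
  have hPb0 : PowerSeries.constantCoeff
      (aeval (PowerSeries.C (ζ / g) + PowerSeries.X * Yb) (polyP ζ)) =
      -(2 * ζ ^ 2 * (1 + ζ) ^ 2) / g ^ 3 := by
    rw [eP]
    simp only [map_sub, map_mul, map_add, map_pow, PowerSeries.constantCoeff_C,
      PowerSeries.constantCoeff_X, zero_mul, add_zero]
    rw [haζ]
    field_simp
    rw [hg]
    ring
  have hQa1 : (2 * (1 + ζ) ^ 2) ≠ 0 := mul_ne_zero hK (pow_ne_zero _ hε)
  have hPb1 : -(2 * ζ ^ 2 * (1 + ζ) ^ 2) / g ^ 3 ≠ 0 := div_ne_zero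
    (neg_ne_zero.2 (mul_ne_zero (mul_ne_zero hK (pow_ne_zero _ h0)) (pow_ne_zero _ hε)))
    (pow_ne_zero _ h2)
  have hYa0 : PowerSeries.constantCoeff Ya = a⁻¹ ^ 2 * (2 * (1 + ζ) ^ 2) := by
    rw [hYa, map_mul, PowerSeries.constantCoeff_C, hra, constantCoeff_rescale_eq, hU0, hc]
    field_simp
  have hYb0 : PowerSeries.constantCoeff Yb = -(2 * ζ ^ 2 * (1 + ζ) ^ 2) / g ^ 4 := by
    rw [hYb, map_mul, PowerSeries.constantCoeff_C, hrb, constantCoeff_rescale_eq, hZ1, hd]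
    simp only [map_mul, map_pow, map_sub, hZ0, PowerSeries.constantCoeff_C]
    rw [haζ]
    field_simp
    rw [hg]
    ring
  have main := det_reduced (n := n) ζ a (ζ / g) Ya Yb
    ((aeval (PowerSeries.C a + PowerSeries.X * Ya) (polyQ ζ))⁻¹ ^ n)
    ((aeval (PowerSeries.C (ζ / g) + PowerSeries.X * Yb) (polyP ζ))⁻¹ ^ n) hPa hQb
    (by rw [← mul_pow, PowerSeries.inv_mul_cancel _ (by rw [hQa0]; exact hQa1), one_pow])
    (by rw [← mul_pow, PowerSeries.inv_mul_cancel _ (by rw [hPb0]; exact hPb1), one_pow])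
  have hH : (Matrix.of fun k j : Fin n =>
      PowerSeries.coeff (j : ℕ) (PowerSeries.X ^ (n - k) *
        aeval (PowerSeries.C (ζ / g) + PowerSeries.X * Yb) (polyV ζ)) -
      PowerSeries.coeff (n - j) (PowerSeries.X ^ (k : ℕ) *
        aeval (PowerSeries.C a + PowerSeries.X * Ya) (polyV ζ))) = hMat ev n := by
    have hVa : aeval (PowerSeries.C a + PowerSeries.X * Ya) (polyV ζ) =
        PowerSeries.C a * ra (PowerSeries.map ev
          (serY * (PowerSeries.C aPoly * serY - PowerSeries.C (1 + X)))) := by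
      rw [hXa, eV]
      simp only [map_mul, map_sub, PowerSeries.map_C, ← hY, hraC, ← ha', map_add, map_one, ← hζ]
      ring
    have hVb : aeval (PowerSeries.C (ζ / g) + PowerSeries.X * Yb) (polyV ζ) =
        PowerSeries.C (g⁻¹ ^ 2) * rb (PowerSeries.map ev
          (serZ * (serZ - PowerSeries.C ((1 + X) * (X + 2))))) := by
      rw [hXb, eV]
      simp only [map_mul, map_sub, PowerSeries.map_C, ← hZ, hrbC, map_add, map_one, ← hζ, map_pow,
        map_ofNat]
      have : PowerSeries.C ζ + 2 = (PowerSeries.C g : PowerSeries K) := by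
        rw [hg, map_add, map_ofNat]
      rw [this]
      linear_combination (PowerSeries.C g⁻¹ * rb Z * (1 + PowerSeries.C ζ)) * hC2
    ext k j
    rw [Matrix.of_apply, hMat, Matrix.of_apply, hVa, hVb, PowerSeries.coeff_X_pow_mul',
      PowerSeries.coeff_X_pow_mul']
    congr 1
    · refine if_congr (by omega) ?_ rfl
      rw [PowerSeries.coeff_C_mul, hrb, PowerSeries.coeff_rescale, PowerSeries.coeff_map]
      have : (j : ℕ) - (n - k) = k + j - n := by omega
      rw [this, beta, hd, mul_assoc]
    · refine if_congr (by omega) ?_ rfl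
      rw [PowerSeries.coeff_C_mul, hra, PowerSeries.coeff_rescale, PowerSeries.coeff_map]
      have : n - (j : ℕ) - k = n - k - j := by omega
      rw [this, alpha, hc, mul_assoc]
  rw [hH] at main
  rw [main]
  simp only [Finset.prod_mul_distrib, prod_pow_val, map_pow, PowerSeries.constantCoeff_inv, hQa0,
    hPb0, hYa0, hYb0, Finset.prod_const, Finset.card_univ, Fintype.card_fin]
  have hsub : a - ζ / g = 2 * (1 + ζ) ^ 2 / g := by
    rw [haζ]
    field_simp
    rw [hg]
    ring
  rw [hsub]
  have hn1 : (n + 1).choose 2 = n.choose 2 + n := by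
    rw [Nat.choose_succ_succ' n 1, Nat.choose_one_right, add_comm]
  have hs : (-1 : K) ≠ 0 := by simp
  rw [show -(2 * ζ ^ 2 * (1 + ζ) ^ 2) = (-1) * (ζ ^ 2 * (2 * (1 + ζ) ^ 2)) by ring, hn1]
  simp only [← pow_mul]
  rw [show n ^ 2 + n = 2 * n.choose 2 + 2 * n by rw [sq_eq_choose]; ring,
    show n * n = 2 * n.choose 2 + n by rw [← sq_eq_choose]; ring,
    show n * (n + 1) = 2 * n.choose 2 + 2 * n by rw [mul_add, ← sq, sq_eq_choose]; ring]
  generalize coefDet (famV ζ n) _ = D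
  generalize 2 * (1 + ζ) ^ 2 = e at hQa1 ⊢
  generalize (-1 : K) = s at hs ⊢
  generalize n.choose 2 = T
  simp only [div_pow, mul_pow, inv_pow, pow_add, pow_mul]
  field_simp
  ring_nf

end Hankel

end SpecialPoly

namespace SpecialPoly

/-! ### Reversing the columns of a determinant. -/

section Reversal

lemma sign_revPerm (n : ℕ) : (Equiv.Perm.sign (Fin.revPerm : Equiv.Perm (Fin n)) : ℤ) = revSign n := by
  rw [Equiv.Perm.sign_eq_prod_prod_Ioi, revSign]
  push_cast
  refine Finset.prod_congr rfl fun i _ => Finset.prod_congr rfl fun j hj => ?_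
  have : i < j := Finset.mem_Ioi.1 hj
  rw [if_neg]
  · simp
  · simpa using this.le

lemma revSign_eq (n : ℕ) : revSign n = (-1) ^ n.choose 2 := by
  rw [revSign, ← prod_pow_val, ← Equiv.prod_comp Fin.revPerm]
  refine Finset.prod_congr rfl fun i _ => ?_
  rw [Finset.prod_const, Fin.card_Ioi, Fin.revPerm_apply, Fin.val_rev]
  congr 1
  omega

lemma det_rev {R : Type*} [CommRing R] {n : ℕ} (M : Matrix (Fin n) (Fin n) R) :
    (Matrix.of fun i j => M i (Fin.rev j)).det = (-1) ^ n.choose 2 * M.det := by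
  have h := Matrix.det_permute' (Fin.revPerm : Equiv.Perm (Fin n)) M
  have h2 : ((Equiv.Perm.sign (Fin.revPerm : Equiv.Perm (Fin n)) : ℤ) : R) = (-1) ^ n.choose 2 := by
    rw [sign_revPerm, revSign_eq]
    push_cast
    rfl
  rw [h2] at h
  rw [← h]
  rfl

end Reversal

/-! ### Affine substitution and the confluence at ζ = -1. -/

section Substitution

variable {R : Type*} [CommRing R]

/-- The effect of an affine substitution. -/
lemma coefDet_comp {p q : ℕ} (A B : R) {N N' : R[X]} (hN : N.Monic) (hd : N.natDegree = p + q)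
    (hN' : N'.Monic) (hd' : N'.natDegree = p + q)
    (hcomp : N.comp (C A + C B * X) = C (B ^ (p + q)) * N') (φ : Fin p ⊕ Fin q → R[X]) :
    B ^ (p + q).choose 2 * coefDet φ N = coefDet (fun r => (φ r).comp (C A + C B * X)) N' := by
  nontriviality R
  -- Substitute, reduce modulo N', read off a coefficient. These functionals kill the multiples of N
  -- because N turns into a multiple of N' under the substitution.
  set L : Fin p ⊕ Fin q → R[X] →ₗ[R] R := fun c =>
    (lcoeff R (ord c)).comp ((modByMonicHom N').comp (aeval (C A + C B * X)).toLinearMap) with hL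
  have hLa (c) (f : R[X]) : L c f = ((f.comp (C A + C B * X)) %ₘ N').coeff (ord c) := rfl
  have h1 := det_functional hN hd L (fun c f => by
    rw [hLa, mul_comp, hcomp, mul_comm (C _), mul_assoc, (modByMonic_eq_zero_iff_dvd hN').2
      (dvd_mul_right _ _), coeff_zero]) φ
  have hdeg (r : Fin p ⊕ Fin q) : ((C A + C B * X) ^ ord r : R[X]).natDegree ≤ ord r := by
    refine natDegree_pow_le_of_le _ ?_ |>.trans (by rw [mul_one])
    rw [add_comm]
    exact natDegree_linear_le
  have hcoef (r c : Fin p ⊕ Fin q) :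
      L c (X ^ ord r) = ((C A + C B * X) ^ ord r : R[X]).coeff (ord c) := by
    rw [hLa, pow_comp, X_comp, (modByMonic_eq_self_iff hN').2]
    refine (degree_le_of_natDegree_le (hdeg r)).trans_lt ?_
    rw [degree_eq_natDegree hN'.ne_zero, hd']
    exact_mod_cast ord_lt r
  have h2 : (Matrix.of fun r c : Fin p ⊕ Fin q => L c (X ^ ord r)).det = B ^ (p + q).choose 2 := by
    rw [det_of_ord_triangular _ ord ord_injective]
    · rw [← prod_pow_val, ← Finset.prod_range fun i => B ^ i, ← prod_ord fun i => B ^ i]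
      refine Finset.prod_congr rfl fun r _ => ?_
      rw [Matrix.of_apply, hcoef]
      have := coeff_pow_of_natDegree_le (p := (C A + C B * X : R[X])) (m := ord r) (n := 1)
        (by rw [add_comm]; exact natDegree_linear_le)
      rw [mul_one] at this
      rw [this]
      simp
    · intro r c hrc
      rw [Matrix.of_apply, hcoef]
      exact coeff_eq_zero_of_natDegree_lt ((hdeg r).trans_lt hrc)
  rw [h2] at h1
  rw [mul_comm, ← h1]
  rfl

/-- The family `famV`, recentred at `P = Q` and `V = 1`. -/
noncomputable def famC (ζ : R) (n : ℕ) : Fin n ⊕ Fin (n + 1) → R[X] :=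
  Sum.elim (fun k => (polyV ζ - 1) * (polyP ζ - polyQ ζ) ^ (k : ℕ) * polyQ ζ ^ (n - k))
    (fun k => (polyP ζ - polyQ ζ) ^ (k : ℕ) * polyQ ζ ^ (n - k))

/-- The coefficients of `(P - Q)^k Q^{n-k}` in the `P^i Q^{n-i}`. -/
def binomMat (R : Type*) [CommRing R] (m m' : ℕ) : Matrix (Fin m) (Fin m') R :=
  Matrix.of fun k i => (-1) ^ ((k : ℕ) - i) * (Nat.choose k i : R)

lemma det_binomMat (m : ℕ) : (binomMat R m m).det = 1 := by
  rw [Matrix.det_of_isLowerTriangular]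
  · exact Finset.prod_eq_one fun i _ => by simp [binomMat]
  · intro i j hij
    have : i < j := hij
    simp [binomMat, Nat.choose_eq_zero_of_lt (Fin.lt_def.1 this)]

lemma sub_pow_mul_pow (P Q : R[X]) {n k m : ℕ} (hk : k ≤ n) (hkm : k < m) (hm : m ≤ n + 1) :
    (P - Q) ^ k * Q ^ (n - k) =
      ∑ i : Fin m, ((-1) ^ (k - i) * (Nat.choose k i : R)) • (P ^ (i : ℕ) * Q ^ (n - i)) := by
  rw [← Finset.sum_range fun i => ((-1) ^ (k - i) * (Nat.choose k i : R)) • (P ^ i * Q ^ (n - i)),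
    ← Finset.sum_subset (Finset.range_subset_range.2 (show k + 1 ≤ m by omega)), sub_eq_add_neg,
    add_pow, Finset.sum_mul]
  · refine Finset.sum_congr rfl fun i hi => ?_
    have hik : i ≤ k := Nat.lt_succ_iff.1 (Finset.mem_range.1 hi)
    rw [show n - i = (k - i) + (n - k) by omega, pow_add, neg_pow, smul_eq_C_mul]
    simp only [map_mul, map_pow, map_neg, map_one, map_natCast]
    ring
  · intro i _ hi
    have : k < i := by simpa using hi
    simp [Nat.choose_eq_zero_of_lt this]

/-- The change of family is unitriangular by the binomial theorem. It is made because at ζ = -1 one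
has Q = x+1, P - Q = (x-1)(x+1)² and V - 1 = (x-1)(x+1): P - Q vanishes to second order at the point
-1 where a and b meet, and V - 1 vanishes there although V does not. -/
lemma coefDet_famC (ζ : R) (n : ℕ) (N : R[X]) :
    coefDet (famC ζ n) N = coefDet (famV ζ n) N := by
  rw [coefDet_blockComb N (binomMat R n n) (-binomMat R n (n + 1)) (binomMat R (n + 1) (n + 1))
    (famV ζ n), det_binomMat, det_binomMat, one_mul, one_mul]
  · intro k
    simp only [famC, famV, Sum.elim_inl, Sum.elim_inr, binomMat, Matrix.of_apply, Matrix.neg_apply,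
      neg_smul, Finset.sum_neg_distrib]
    rw [← sub_pow_mul_pow _ _ k.2.le (by omega) le_rfl, sub_mul, sub_mul, one_mul, ← sub_eq_add_neg]
    congr 1
    rw [mul_assoc, sub_pow_mul_pow _ _ k.2.le k.2 (by omega), Finset.mul_sum]
    refine Finset.sum_congr rfl fun i _ => ?_
    rw [mul_smul_comm, mul_assoc]
  · intro k
    simp only [famC, famV, Sum.elim_inr, binomMat, Matrix.of_apply]
    exact sub_pow_mul_pow _ _ (by omega) k.2 le_rfl

/-- The polynomial `(P - Q)/(1 + ζ)²` in the local variable at `ζ = -1`. -/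
noncomputable def polyR1 (ζ : R) : R[X] :=
  -2 * X ^ 2 - 5 * X - 2 + C (1 + ζ) * (4 + X + (1 + X) ^ 2 * (X - 2 * C (1 + ζ))) -
    C (1 + ζ) ^ 2 * X

/-- The polynomial `(V - 1)/(1 + ζ)` in the local variable at `ζ = -1`. -/
noncomputable def polyV1 (ζ : R) : R[X] :=
  -2 * X - 3 + C (1 + ζ) * (X * (1 + X)) - C (1 + ζ) ^ 2 * (1 + X)

/-- The family `famC` in the local variable at `ζ = -1`. -/
noncomputable def famH (ζ : R) (n : ℕ) : Fin n ⊕ Fin (n + 1) → R[X] :=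
  Sum.elim (fun k => polyV1 ζ * polyR1 ζ ^ (k : ℕ) * X ^ (n - k))
    (fun k => polyR1 ζ ^ (k : ℕ) * X ^ (n - k))

/-- The determinant of the family `famV` in the local variable at `ζ = -1`. -/
noncomputable def detHat (ζ : R) (n : ℕ) : R :=
  coefDet (famH ζ n) (X ^ n * (X - C (2 * (1 + ζ))) ^ (n + 1))

lemma map_detHat {R' : Type*} [CommRing R'] (f : R →+* R') (ζ : R) (n : ℕ) :
    f (detHat ζ n) = detHat (f ζ) n := by
  rw [detHat, map_coefDet f ((monic_X_pow n).mul ((monic_X_sub_C _).pow _)), detHat]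
  congr 1
  · funext r
    rcases r with k | k <;> simp [famH, polyR1, polyV1]
  · simp [map_ofNat]

/-- With e = 1+ζ and g = ζ+2, both a and b are within O(e) of -1 and a - b = 2e²/g. The substitution
x = b + (e/g)X sends b to 0 and a to 2e, and factors e out of Q, e² out of P - Q and e out of V - 1.
Counting these powers against the power of e/g from the substitution leaves e^{n²+n}. -/
lemma coefDet_famV_eq_detHat {K : Type*} [Field K] (ζ : K) (n : ℕ) (h2 : ζ + 2 ≠ 0)
    (hε : 1 + ζ ≠ 0) :
    (ζ + 2) ^ (n ^ 2 + n) *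
        coefDet (famV ζ n) ((X - C (ζ / (ζ + 2))) ^ n * (X - C (2 * ζ + 1)) ^ (n + 1)) =
      (1 + ζ) ^ (n ^ 2 + n) * detHat ζ n := by
  rw [← coefDet_famC]
  set g := ζ + 2 with hg
  set e := 1 + ζ with he
  have hm : ((X - C (ζ / g)) ^ n * (X - C (2 * ζ + 1)) ^ (n + 1) : K[X]).Monic :=
    ((monic_X_sub_C _).pow _).mul ((monic_X_sub_C _).pow _)
  have hm' : (X ^ n * (X - C (2 * e)) ^ (n + 1) : K[X]).Monic :=
    ((monic_X_pow _)).mul ((monic_X_sub_C _).pow _)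
  have hb : ζ / g = -1 + 2 * (e / g) := by
    field_simp
    rw [hg, he]
    ring
  have ha : 2 * ζ + 1 = -1 + 2 * e := by
    rw [he]
    ring
  have hge : C g = 1 + C e := by
    rw [← C_1, ← C_add]
    congr 1
    rw [hg, he]
    ring
  have hgi : (C g * C g⁻¹ : K[X]) = 1 := by
    rw [← C_mul, mul_inv_cancel₀ h2, C_1]
  have hζe : C ζ = C e - 1 := by
    rw [← C_1, ← C_sub]
    congr 1
    rw [he]
    ring
  set l : K[X] := C (ζ / g) + C (e / g) * X with hl
  have hlg : l = C g⁻¹ * (C ζ + C e * X) := by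
    rw [hl, div_eq_mul_inv, div_eq_mul_inv, C_mul, C_mul]
    ring
  have hla : l - C (2 * ζ + 1) = C g⁻¹ * (C e * (X - C (2 * e))) := by
    have : C g * C (2 * ζ + 1) = C ζ + C e * C (2 * e) := by
      rw [← C_mul, ← C_mul, ← C_add]
      congr 1
      rw [hg, he]
      ring
    rw [hlg]
    linear_combination C (2 * ζ + 1) * hgi - C g⁻¹ * this
  have hQ : (polyQ ζ).comp l = C e * X := by
    simp only [polyQ, sub_comp, mul_comp, C_comp, X_comp, ← hg]
    rw [hlg]
    linear_combination (C ζ + C e * X) * hgi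
  have hP : (polyP ζ).comp l = C g⁻¹ ^ 3 * (C ζ + C e * X) ^ 2 * (C e * (X - C (2 * e))) := by
    simp only [polyP, sub_comp, mul_comp, C_comp, X_comp, pow_comp]
    rw [hla, hlg]
    ring
  have hgi3 : (C g⁻¹ ^ 3 * C g ^ 3 : K[X]) = 1 := by
    rw [← mul_pow, mul_comm (C g⁻¹), hgi, one_pow]
  have hgi2 : (C g⁻¹ ^ 2 * C g ^ 2 : K[X]) = 1 := by
    rw [← mul_pow, mul_comm (C g⁻¹), hgi, one_pow]
  have hR : (polyP ζ - polyQ ζ).comp l = C (g⁻¹ ^ 3 * e ^ 2) * polyR1 ζ := by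
    rw [sub_comp, hP, hQ, polyR1, ← he, hζe]
    rw [hge] at hgi3
    simp only [C_mul, C_pow, map_ofNat]
    linear_combination (C e * X) * hgi3
  have hV : (polyV ζ - 1).comp l = C (g⁻¹ ^ 2 * e) * polyV1 ζ := by
    simp only [polyV, sub_comp, mul_comp, C_comp, X_comp, one_comp]
    rw [polyV1, ← he, C_mul, C_pow]
    have h3 : l - C e = C g⁻¹ * (C ζ + C e * X - C g * C e) := by
      rw [hlg]
      linear_combination (C e) * hgi
    rw [h3, hlg, hζe, hge]
    rw [hge] at hgi2
    linear_combination hgi2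
  have hN : ((X - C (ζ / g)) ^ n * (X - C (2 * ζ + 1)) ^ (n + 1) : K[X]).comp l =
      C ((e / g) ^ (n + (n + 1))) * (X ^ n * (X - C (2 * e)) ^ (n + 1)) := by
    simp only [mul_comp, pow_comp, sub_comp, X_comp, C_comp]
    rw [hla, hl, add_sub_cancel_left, div_eq_mul_inv]
    simp only [C_pow, C_mul, mul_pow, pow_add, pow_one]
    ring
  have hmain := coefDet_comp (ζ / g) (e / g) hm (by
      rw [((monic_X_sub_C _).pow _).natDegree_mul ((monic_X_sub_C _).pow _), natDegree_pow,
        natDegree_pow, natDegree_X_sub_C, natDegree_X_sub_C, mul_one, mul_one]) hm' (by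
      rw [(monic_X_pow _).natDegree_mul ((monic_X_sub_C _).pow _), natDegree_pow,
        natDegree_pow, natDegree_X_sub_C, natDegree_X, mul_one, mul_one]) hN (famC ζ n)
  have hfam : (fun r => (famC ζ n r).comp l) = fun r =>
      (Sum.elim (fun k : Fin n => e ^ (n + 1) * e ^ (k : ℕ) * ((g⁻¹ ^ 3) ^ (k : ℕ) * g⁻¹ ^ 2))
        (fun k : Fin (n + 1) => e ^ n * e ^ (k : ℕ) * (g⁻¹ ^ 3) ^ (k : ℕ)) r) • famH ζ n r := by
    funext r
    rcases r with k | k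
    · have h1 : e ^ n = e ^ (k : ℕ) * e ^ (n - k) := by
        rw [← pow_add]
        congr 1
        omega
      simp only [famC, famH, Sum.elim_inl, mul_comp, pow_comp, hR, hV, hQ, smul_eq_C_mul]
      rw [pow_succ e n, h1]
      simp only [C_mul, C_pow]
      ring
    · have h1 : e ^ n = e ^ (k : ℕ) * e ^ (n - k) := by
        rw [← pow_add]
        congr 1
        omega
      simp only [famC, famH, Sum.elim_inr, mul_comp, pow_comp, hR, hQ, smul_eq_C_mul]
      rw [h1]
      simp only [C_mul, C_pow]
      ring
  rw [hfam, coefDet_smul, Fintype.prod_sum_type] at hmain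
  simp only [Sum.elim_inl, Sum.elim_inr, Finset.prod_mul_distrib, prod_pow_val, Finset.prod_const,
    Finset.card_univ, Fintype.card_fin] at hmain
  rw [detHat, ← he]
  have hn1 : (n + 1).choose 2 = n.choose 2 + n := by
    rw [Nat.choose_succ_succ' n 1, Nat.choose_one_right, add_comm]
  have hn2 : (n + (n + 1)).choose 2 = 4 * n.choose 2 + 3 * n := by
    have h1 := sq_eq_choose (n + (n + 1))
    have h2 := sq_eq_choose n
    nlinarith
  rw [hn1, hn2] at hmain
  rw [show n ^ 2 + n = 2 * n.choose 2 + 2 * n by rw [sq_eq_choose]; ring]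
  simp only [← pow_mul] at hmain
  rw [show (n + 1) * n = 2 * n.choose 2 + 2 * n by rw [add_mul, ← sq, sq_eq_choose]; ring,
    show n * (n + 1) = 2 * n.choose 2 + 2 * n by rw [mul_add, ← sq, sq_eq_choose]; ring] at hmain
  generalize coefDet (famC ζ n) _ = D at hmain ⊢
  generalize coefDet (famH ζ n) _ = D' at hmain ⊢
  generalize n.choose 2 = T at hmain ⊢
  have hc : (e / g) ^ (4 * T + 3 * n) ≠ 0 := pow_ne_zero _ (div_ne_zero hε h2)
  apply mul_left_cancel₀ hc
  rw [mul_left_comm, hmain]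
  simp only [div_pow, inv_pow, pow_add, pow_mul]
  field_simp
  ring_nf

end Substitution

end SpecialPoly

namespace SpecialPoly

/-! ### The defining identity in terms of `detHat`. -/

section Criterion

lemma ratFunc_add_ne_zero {c : ℚ} {p : ℚ[X]} (hp : p.eval c ≠ 0) :
    algebraMap ℚ[X] (RatFunc ℚ) p ≠ 0 := by
  rw [Ne, FaithfulSMul.algebraMap_eq_zero_iff]
  rintro rfl
  simp at hp

lemma ratFunc_X_add_two_ne_zero : (RatFunc.X + 2 : RatFunc ℚ) ≠ 0 := by
  have := ratFunc_add_ne_zero (c := 0) (p := X + 2) (by norm_num)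
  simpa [map_ofNat] using this

lemma ratFunc_one_add_X_ne_zero : (1 + RatFunc.X : RatFunc ℚ) ≠ 0 := by
  have := ratFunc_add_ne_zero (c := 0) (p := 1 + X) (by norm_num)
  simpa [map_ofNat] using this

lemma ratFunc_aPoly_ne_zero : algebraMap ℚ[X] (RatFunc ℚ) aPoly ≠ 0 :=
  ratFunc_add_ne_zero (c := 0) (by norm_num [aPoly])

lemma choose_two_succ (n : ℕ) : (n + 1).choose 2 = n.choose 2 + n := by
  rw [Nat.choose_succ_succ' n 1, Nat.choose_one_right, add_comm]

lemma neg_one_pow_mul_self {R : Type*} [CommRing R] (m : ℕ) :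
    ((-1) ^ m : R) * (-1) ^ m = 1 := by
  rw [← mul_pow, neg_one_mul, neg_neg, one_pow]

/-- Cancelling the common powers of 1+ζ in the defining identity makes it an identity of
polynomials, which can be evaluated also at ζ = -1. -/
lemma isSpecialPolynomial_iff (n : ℕ) (p : ℚ[X]) :
    ThreeColour.IsSpecialPolynomial n p ↔
      2 ^ ThreeColour.delta (n - 1) * detHat X n =
        2 ^ n ^ 2 * (X + 2) ^ (n + ThreeColour.delta (n - 1)) * X ^ (n ^ 2 + n) *
          aPoly ^ ThreeColour.delta n * p := by
  have hinj : Function.Injective (algebraMap ℚ[X] (RatFunc ℚ)) :=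
    FaithfulSMul.algebraMap_injective _ _
  rw [← hinj.eq_iff]
  simp only [map_mul, map_pow, map_add, map_ofNat, RatFunc.algebraMap_X, map_detHat]
  have haa : algebraMap ℚ[X] (RatFunc ℚ) aPoly = 1 + 2 * RatFunc.X := by
    simp [aPoly, map_ofNat, add_comm]
  have ha := ratFunc_aPoly_ne_zero
  rw [haa] at ha ⊢
  have hg := ratFunc_X_add_two_ne_zero
  have he := ratFunc_one_add_X_ne_zero
  have h0 : (RatFunc.X : RatFunc ℚ) ≠ 0 := RatFunc.X_ne_zero
  have h1 := SEval_eq_coefDet n (fun k => if (k : ℕ) < n + 1 then 2 * RatFunc.X + 1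
    else RatFunc.X / (RatFunc.X + 2))
  rw [prod_special_points, revSign_eq] at h1
  have h2 := coefDet_famV (RatFunc.X : RatFunc ℚ) n
    ((X - C (RatFunc.X / (RatFunc.X + 2))) ^ n * (X - C (2 * RatFunc.X + 1)) ^ (n + 1))
  have h3 := coefDet_famV_eq_detHat (RatFunc.X : RatFunc ℚ) n hg he
  rw [ThreeColour.IsSpecialPolynomial, choose_two_succ]
  rw [← h1] at h2
  have hgn : (RatFunc.X + 2 : RatFunc ℚ) ^ n ≠ 0 := pow_ne_zero _ hg
  generalize ThreeColour.SEval n _ = S at h1 h2 ⊢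
  generalize coefDet (famV (RatFunc.X : RatFunc ℚ) n) _ = D at h2 h3
  have h4 : D = (-1) ^ (n.choose 2 + n) * (RatFunc.X * (1 + RatFunc.X)) ^ n * S := by
    apply mul_left_cancel₀ hgn
    rw [h2, neg_pow (RatFunc.X + 2 : RatFunc ℚ), pow_add (-1)]
    push_cast
    ring
  rw [h4] at h3
  have hs := neg_one_pow_mul_self (R := RatFunc ℚ) (n.choose 2 + n)
  generalize detHat (RatFunc.X : RatFunc ℚ) n = H at h3 ⊢
  generalize algebraMap ℚ[X] (RatFunc ℚ) p = q
  generalize ((-1) ^ (n.choose 2 + n) : RatFunc ℚ) = s at hs h3 ⊢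
  generalize (1 + 2 * RatFunc.X : RatFunc ℚ) ^ ThreeColour.delta n = A
  generalize ThreeColour.delta (n - 1) = d
  have hg2 : (1 + RatFunc.X / 2 : RatFunc ℚ) = (RatFunc.X + 2) / 2 := by ring
  rw [hg2]
  generalize (RatFunc.X + 2 : RatFunc ℚ) = g at *
  generalize (1 + RatFunc.X : RatFunc ℚ) = e at *
  generalize (RatFunc.X : RatFunc ℚ) = z at *
  have h20 : (2 : RatFunc ℚ) ≠ 0 := two_ne_zero
  have hs0 : s ≠ 0 := by
    rintro rfl
    simp at hs
  have hk : e ^ (n ^ 2 + n) ≠ 0 := pow_ne_zero _ he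
  have hK : 2 ^ n ^ 2 * 2 ^ d * (g ^ n * (s * (z * e) ^ n)) ≠ 0 :=
    mul_ne_zero (mul_ne_zero (pow_ne_zero _ h20) (pow_ne_zero _ h20))
      (mul_ne_zero hgn (mul_ne_zero hs0 (pow_ne_zero _ (mul_ne_zero h0 he))))
  have hd (m : ℕ) : (g / 2) ^ m * 2 ^ m = g ^ m := by
    rw [← mul_pow, div_mul_cancel₀ _ h20]
  have key1 : 2 ^ n ^ 2 * 2 ^ d * (g ^ n * (s * (z * e) ^ n)) * ((g / 2) ^ n ^ 2 * S) =
      e ^ (n ^ 2 + n) * (2 ^ d * H) := by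
    have h5 := hd (n ^ 2)
    rw [pow_add g] at h3
    linear_combination 2 ^ d * h3 + 2 ^ d * g ^ n * (s * (z * e) ^ n) * S * h5
  have key2 : 2 ^ n ^ 2 * 2 ^ d * (g ^ n * (s * (z * e) ^ n)) *
      (s * z ^ n ^ 2 * e ^ n ^ 2 * A * (g / 2) ^ d * q) =
      e ^ (n ^ 2 + n) * (2 ^ n ^ 2 * g ^ (n + d) * z ^ (n ^ 2 + n) * A * q) := by
    have h5 := hd d
    simp only [pow_add, mul_pow]
    linear_combination (2 ^ n ^ 2 * g ^ n * (z ^ n * e ^ n) * z ^ n ^ 2 * e ^ n ^ 2 * A * q) *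
      (s * s * h5 + g ^ d * hs)
  rw [← mul_right_inj' hK, key1, key2, mul_right_inj' hk]

/-- The link between the expansion in local parameters and the rescaled confluence; both compute the
same `coefDet` of `famV`. -/
lemma det_hMat_eq_detHat {K : Type*} [Field K] (ev : ℚ[X] →+* K) (n : ℕ) (h0 : ev X ≠ 0)
    (ha : ev aPoly ≠ 0) (h2 : ev X + 2 ≠ 0) (hε : 1 + ev X ≠ 0) (hK : (2 : K) ≠ 0) :
    (-1) ^ (n + 1).choose 2 * (ev X * ev aPoly) ^ (n ^ 2 + n) * (ev X + 2) ^ n ^ 2 *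
        (hMat ev n).det =
      (1 + ev X) ^ (n ^ 2 + n) * detHat (ev X) n := by
  have haζ : ev aPoly = 2 * ev X + 1 := by simp [aPoly, map_ofNat]
  have h3 := coefDet_famV_eq_detHat (ev X) n h2 hε
  have h4 := det_hMat ev n h0 ha h2 hε hK
  rw [← h3, mul_right_comm, h4, haζ, pow_add (ev X + 2)]
  ring

end Criterion

end SpecialPoly

namespace SpecialPoly

/-! ### The value at ζ = -1. -/

section MinusOne

variable {R : Type*} [CommRing R]

/-- Polynomials that are symmetric about the exponent `m`. -/
def IsPalindromic (m : ℕ) (f : R[X]) : Prop :=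
  f.natDegree ≤ 2 * m ∧ f.reflect (2 * m) = f

lemma IsPalindromic.mul {m m' : ℕ} {f g : R[X]} (hf : IsPalindromic m f) (hg : IsPalindromic m' g) :
    IsPalindromic (m + m') (f * g) := by
  refine ⟨natDegree_mul_le.trans (by linarith [hf.1, hg.1]), ?_⟩
  rw [mul_add, reflect_mul _ _ hf.1 hg.1, hf.2, hg.2]

lemma IsPalindromic.pow {m : ℕ} {f : R[X]} (hf : IsPalindromic m f) (k : ℕ) :
    IsPalindromic (k * m) (f ^ k) := by
  induction k with
  | zero => simp [IsPalindromic]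
  | succ k ih =>
    rw [pow_succ, add_mul, one_mul]
    exact ih.mul hf

lemma isPalindromic_X : IsPalindromic 1 (X : R[X]) := by
  refine ⟨natDegree_X_le.trans (by norm_num), ?_⟩
  have := reflect_monomial (R := R) 2 1
  rw [pow_one, revAt_le (by norm_num)] at this
  simpa using this

lemma IsPalindromic.coeff_eq {m i : ℕ} {f : R[X]} (hf : IsPalindromic m f) (hi : i ≤ m) :
    f.coeff (m - i) = f.coeff (m + i) := by
  have := congrArg (fun p => p.coeff (m + i)) hf.2
  simp only [coeff_reflect] at this
  rw [revAt_le (by omega)] at this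
  rw [← this]
  congr 1
  omega

lemma isPalindromic_quadratic (a b : R) : IsPalindromic 1 (C a * X ^ 2 + C b * X + C a) := by
  constructor
  · compute_degree
  · have h : (C a * X ^ 2 + C b * X + C a : R[X]) = C a * X ^ 2 + C b * X ^ 1 + C a * X ^ 0 := by
      simp
    rw [h, reflect_add, reflect_add, reflect_C_mul_X_pow, reflect_C_mul_X_pow, reflect_C_mul_X_pow,
      revAt_le (by norm_num), revAt_le (by norm_num), revAt_le (by norm_num)]
    ring

/-- Functionals adapted to the family `famH` at `ζ = -1`. -/
noncomputable def palLin (R : Type*) [CommRing R] (n : ℕ) (c : Fin n ⊕ Fin (n + 1)) : R[X] →ₗ[R] R :=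
  Sum.elim (fun c : Fin n => lcoeff R (n - 1 - c) - lcoeff R (n + 1 + c))
    (fun c : Fin (n + 1) => lcoeff R (n + c)) c

/-- The modulus is X^{2n+1}, and `polyR1` is the palindromic -(2X²+5X+2). The differences of
coefficients symmetric about X^n therefore kill the rows without `polyV1`. In the other rows, from
`polyV1` = -2X-3 only the term -2X survives, since the constant keeps the symmetry. Both diagonal
blocks are triangular. -/
lemma detHat_neg_one (n : ℕ) : detHat (-1 : R) n = (-1) ^ (n.choose 2 + n) * 2 ^ (n ^ 2 + n) := by
  nontriviality R
  set Q : R[X] := C (-2) * X ^ 2 + C (-5) * X + C (-2) with hQ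
  have hR : polyR1 (-1 : R) = Q := by
    simp only [polyR1, hQ, map_neg, map_ofNat]
    simp
    ring
  have hV : polyV1 (-1 : R) = C (-2) * X - C 3 := by
    simp only [polyV1, map_neg, map_ofNat]
    simp
  have hQdeg (k : ℕ) : (Q ^ k).natDegree ≤ 2 * k := by
    refine natDegree_pow_le_of_le k ?_ |>.trans (by rw [mul_comm])
    rw [hQ]
    compute_degree
  have hQlead (k : ℕ) : (Q ^ k).coeff (2 * k) = (-2) ^ k := by
    rw [mul_comm, coeff_pow_of_natDegree_le (by simpa using hQdeg 1)]
    congr 1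
    rw [hQ]
    simp
  have hpal {k : ℕ} (hk : k ≤ n) : IsPalindromic n (Q ^ k * X ^ (n - k)) := by
    have := ((isPalindromic_quadratic (-2 : R) (-5)).pow k).mul (isPalindromic_X.pow (n - k))
    rwa [mul_one, mul_one, Nat.add_sub_cancel' hk] at this
  have hcoeff {k c : ℕ} (hk : k ≤ n) : (Q ^ k * X ^ (n - k)).coeff (n + c) = (Q ^ k).coeff (k + c) := by
    rw [show n + c = (k + c) + (n - k) by omega, coeff_mul_X_pow]
  have hN : (X ^ (2 * n + 1) : R[X]).Monic := monic_X_pow _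
  have hD : detHat (-1 : R) n = coefDet (famH (-1) n) (X ^ (2 * n + 1)) := by
    rw [detHat]
    congr 1
    rw [add_neg_cancel, mul_zero, C_0, sub_zero, ← pow_add]
    congr 1
    ring
  have h1 := det_functional hN (by rw [natDegree_X_pow]; ring) (palLin R n) (by
    rintro (c | c) f
    · simp only [palLin, Sum.elim_inl, LinearMap.sub_apply, lcoeff_apply, coeff_X_pow_mul']
      rw [if_neg (by omega), if_neg (by omega), sub_zero]
    · simp only [palLin, Sum.elim_inr, lcoeff_apply, coeff_X_pow_mul']
      rw [if_neg (by omega)]) (famH (-1) n)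
  rw [← hD] at h1
  -- On the monomials the antisymmetric functionals give a reversed identity, which is the source of
  -- the sign.
  have h2 : (Matrix.of fun r c : Fin n ⊕ Fin (n + 1) => palLin R n c (X ^ ord r)).det =
      (-1) ^ n.choose 2 := by
    have : (Matrix.of fun r c : Fin n ⊕ Fin (n + 1) => palLin R n c (X ^ ord r)) =
        Matrix.fromBlocks (Matrix.of fun i j => (1 : Matrix (Fin n) (Fin n) R) i (Fin.rev j)) 0
          (Matrix.of fun (i : Fin (n + 1)) j => palLin R n (Sum.inl j) (X ^ (n + (i : ℕ)))) 1 := by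
      ext (r | r) (c | c)
      · simp only [palLin, Matrix.of_apply, Sum.elim_inl, ord_inl, LinearMap.sub_apply,
          lcoeff_apply, coeff_X_pow, Matrix.fromBlocks_apply₁₁, Matrix.one_apply]
        rw [if_neg (by omega : ¬ (n + 1 + (c : ℕ) = r)), sub_zero]
        refine if_congr ?_ rfl rfl
        rw [Fin.ext_iff, Fin.val_rev]
        omega
      · simp only [palLin, Matrix.of_apply, Sum.elim_inr, ord_inl, lcoeff_apply, coeff_X_pow,
          Matrix.fromBlocks_apply₁₂, Matrix.zero_apply]
        rw [if_neg (by omega)]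
      · simp
      · simp only [palLin, Matrix.of_apply, Sum.elim_inr, ord_inr, lcoeff_apply, coeff_X_pow,
          Matrix.fromBlocks_apply₂₂, Matrix.one_apply]
        refine if_congr ?_ rfl rfl
        rw [Fin.ext_iff]
        omega
    rw [this, Matrix.det_fromBlocks_zero₁₂, det_rev, Matrix.det_one, mul_one,
      Matrix.det_one, mul_one]
  have h3 : (Matrix.of fun r c : Fin n ⊕ Fin (n + 1) => palLin R n c (famH (-1) n r)).det =
      (∏ k : Fin n, 2 * (-2) ^ (k : ℕ)) * ∏ k : Fin (n + 1), (-2) ^ (k : ℕ) := by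
    have : (Matrix.of fun r c : Fin n ⊕ Fin (n + 1) => palLin R n c (famH (-1) n r)) =
        Matrix.fromBlocks
          (Matrix.of fun k c : Fin n => 2 * ((Q ^ (k : ℕ)).coeff (k + c) - (Q ^ (k : ℕ)).coeff (k + c + 2)))
          (Matrix.of fun k c => palLin R n (Sum.inr c) (famH (-1) n (Sum.inl k))) 0
          (Matrix.of fun k c : Fin (n + 1) => (Q ^ (k : ℕ)).coeff (k + c)) := by
      ext (k | k) (c | c)
      · have e1 : (X * (Q ^ (k : ℕ) * X ^ (n - k))).coeff (n - 1 - c) =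
            (Q ^ (k : ℕ)).coeff (k + c + 2) := by
          rw [show (k : ℕ) + c + 2 = k + (c + 2) by ring, ← hcoeff k.2.le]
          by_cases hc : (c : ℕ) + 1 = n
          · rw [show n - 1 - c = 0 by omega, mul_coeff_zero, coeff_X_zero, zero_mul,
              coeff_mul_X_pow', if_pos (by omega), coeff_eq_zero_of_natDegree_lt]
            have := hQdeg k
            omega
          · rw [show n - 1 - c = (n - (c + 2)) + 1 by omega, coeff_X_mul,
              (hpal k.2.le).coeff_eq (by omega)]
        have e2 : (Q ^ (k : ℕ) * X ^ (n - k)).coeff (n - 1 - c) =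
            (Q ^ (k : ℕ) * X ^ (n - k)).coeff (n + 1 + c) := by
          rw [show n - 1 - c = n - (c + 1) by omega, (hpal k.2.le).coeff_eq (by omega)]
          congr 1
          omega
        have e3 : (X * (Q ^ (k : ℕ) * X ^ (n - k))).coeff (n + 1 + c) =
            (Q ^ (k : ℕ)).coeff (k + c) := by
          rw [← hcoeff k.2.le, add_right_comm, coeff_X_mul]
        simp only [palLin, Matrix.of_apply, Sum.elim_inl, LinearMap.sub_apply,
          lcoeff_apply, Matrix.fromBlocks_apply₁₁, famH, hR, hV, sub_mul, mul_assoc, coeff_sub,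
          coeff_C_mul, e1, e2, e3]
        ring
      · simp
      · simp only [palLin, Matrix.of_apply, Sum.elim_inl, LinearMap.sub_apply,
          lcoeff_apply, Matrix.fromBlocks_apply₂₁, famH, hR, Sum.elim_inr, Matrix.zero_apply]
        rw [show n - 1 - c = n - (c + 1) by omega, (hpal (Nat.lt_succ_iff.1 k.2)).coeff_eq (by omega),
          sub_eq_zero]
        congr 1
        omega
      · simp only [palLin, Matrix.of_apply, lcoeff_apply, Matrix.fromBlocks_apply₂₂, famH, hR,
          Sum.elim_inr]
        exact hcoeff (Nat.lt_succ_iff.1 k.2)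
    have hz {k c : ℕ} (h : k < c) : (Q ^ k).coeff (k + c) = 0 :=
      coeff_eq_zero_of_natDegree_lt ((hQdeg k).trans_lt (by omega))
    have hz2 {k c : ℕ} (h : k ≤ c) : (Q ^ k).coeff (k + c + 2) = 0 :=
      coeff_eq_zero_of_natDegree_lt ((hQdeg k).trans_lt (by omega))
    rw [this, Matrix.det_fromBlocks_zero₂₁, Matrix.det_of_isLowerTriangular,
      Matrix.det_of_isLowerTriangular]
    · simp only [Matrix.of_apply]
      congr 1
      · refine Finset.prod_congr rfl fun k _ => ?_
        rw [hz2 le_rfl, sub_zero, ← two_mul, hQlead]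
      · refine Finset.prod_congr rfl fun k _ => ?_
        rw [← two_mul, hQlead]
    · intro i j hij
      have : (i : ℕ) < j := Fin.lt_def.1 hij
      rw [Matrix.of_apply, hz this]
    · intro i j hij
      have : (i : ℕ) < j := Fin.lt_def.1 hij
      rw [Matrix.of_apply, hz this, hz2 this.le, sub_zero, mul_zero]
  rw [h2, h3] at h1
  have h4 := congrArg (fun s => s * (-1) ^ n.choose 2) h1
  simp only [mul_assoc, neg_one_pow_mul_self, mul_one] at h4
  rw [← h4, Finset.prod_mul_distrib, prod_pow_val, prod_pow_val, Finset.prod_const,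
    Finset.card_univ, Fintype.card_fin, choose_two_succ, sq_eq_choose, neg_pow (2 : R),
    neg_pow (2 : R) (_ + _)]
  have h5 := neg_one_pow_mul_self (R := R) (n.choose 2)
  simp only [pow_add, mul_assoc]
  rw [two_mul (n.choose 2)]
  simp only [pow_add]
  linear_combination (2 ^ n * 2 ^ n * 2 ^ n.choose 2 * 2 ^ n.choose 2 * (-1) ^ n * (-1) ^ n.choose 2) * h5

lemma delta_succ (n : ℕ) : ThreeColour.delta (n + 1) = ThreeColour.delta (n - 1) + n := by
  rcases n with _ | n
  · rfl
  · simp only [ThreeColour.delta, Nat.add_sub_cancel]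
    have : (n + 1 + 1) ^ 2 = n ^ 2 + 4 * (n + 1) := by ring
    rw [this]
    omega

/-- All three summands are determined modulo 2 by n modulo 4 up to even terms; writing n = 4m + i
reduces this to four cases. -/
lemma neg_one_pow_choose_add_delta (n : ℕ) :
    ((-1) ^ (n.choose 2 + n + ThreeColour.delta n) : ℚ) = if n % 4 = 1 then -1 else 1 := by
  have h := sq_eq_choose n
  have h4 := Nat.div_add_mod n 4
  have hlt := Nat.mod_lt n (by norm_num : 4 > 0)
  rw [ThreeColour.delta]
  generalize n / 4 = m at h4
  generalize n % 4 = i at h4 hlt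
  have hsq : n ^ 2 = 16 * m ^ 2 + 8 * (m * i) + i * i := by rw [← h4]; ring
  rw [hsq] at h ⊢
  generalize n.choose 2 = T at h
  have hw : m ^ 2 ≥ m := by nlinarith
  generalize m ^ 2 = w at *
  have key : (T + n + (16 * w + 8 * (m * i) + i * i) / 4) % 2 = if i = 1 then 1 else 0 := by
    interval_cases i <;> norm_num <;> omega
  rw [← Nat.div_add_mod (T + n + _) 2, key, pow_add, pow_mul, neg_one_sq, one_pow, one_mul]
  split_ifs <;> simp

lemma eval_neg_one_of_isSpecialPolynomial {n : ℕ} {p : ℚ[X]}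
    (hp : ThreeColour.IsSpecialPolynomial n p) :
    p.eval (-1) = (if n % 4 = 1 then -1 else 1) * 2 ^ ThreeColour.delta (n + 1) := by
  rw [isSpecialPolynomial_iff] at hp
  have h := congrArg (evalRingHom (-1 : ℚ)) hp
  have h0 : (-1 : ℚ) + 2 = 1 := by norm_num
  have h1 : (2 : ℚ) * (-1) + 1 = -1 := by norm_num
  have h2 : (-1 : ℚ) ^ (n ^ 2 + n) = 1 := by
    rw [sq_eq_choose, add_assoc, ← two_mul, ← mul_add, pow_mul, neg_one_sq, one_pow]
  simp only [map_mul, map_pow, map_detHat, map_ofNat, map_add, coe_evalRingHom, eval_X, aPoly,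
    map_one, detHat_neg_one, h0, h1, one_pow, mul_one, h2] at h
  have h3 : (2 : ℚ) ^ n ^ 2 ≠ 0 := by positivity
  rw [← neg_one_pow_choose_add_delta, delta_succ]
  apply mul_left_cancel₀ h3
  have h4 := neg_one_pow_mul_self (R := ℚ) (ThreeColour.delta n)
  simp only [pow_add] at h ⊢
  linear_combination (-(-1) ^ ThreeColour.delta n) * h - 2 ^ n ^ 2 * p.eval (-1) * h4

end MinusOne

end SpecialPoly

namespace SpecialPoly

/-! ### Clearing denominators; existence and uniqueness. -/

section FullMatrix

/-- The reduced matrix with denominators cleared, for `n = 2h + e` with `e ≤ 1`. -/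
noncomputable def fullMat (h e : ℕ) : Matrix (Fin (h + e) ⊕ Fin h) (Fin (h + e) ⊕ Fin h) ℚ[X] :=
  Matrix.fromBlocks
    (Matrix.of fun p q => -alpha (h + e + h - p - q))
    (Matrix.of fun p q =>
      (if h ≤ p + q then
        aPoly ^ (3 * (h - p) + e) * (X + 2) ^ (3 * (h - p) + 2 * e - 1) * beta (p + q - h) else 0) -
      (if (p : ℕ) + q ≤ h then
        aPoly ^ (3 * (q : ℕ) + 1 + e) * (X + 2) ^ (3 * (q : ℕ) + 1 + 2 * e) * alpha (h - p - q) else 0))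
    (Matrix.of fun p q =>
      (if h ≤ p + q then
        aPoly ^ (3 * (h - q) + 2 * e - 1) * (X + 2) ^ (3 * (h - q) + e - 1) * beta (p + q - h) else 0) -
      (if (p : ℕ) + q ≤ h then
        aPoly ^ (3 * (p : ℕ) + 2 * e) * (X + 2) ^ (3 * (p : ℕ) + 1 + e) * alpha (h - p - q) else 0))
    (Matrix.of fun p q =>
      beta (e + p + q) - (if e + p + q = 0 then aPoly * (X + 2) ^ 2 * alpha 0 else 0))

variable {K : Type*} [Field K]

lemma pow_mul_inv_cube {a : K} (ha : a ≠ 0) {r s m : ℕ} (h : r + 1 = s + 3 * m) :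
    a ^ r * (a * (a⁻¹ ^ 3) ^ m) = a ^ s := by
  rw [← mul_assoc, ← pow_succ, h, pow_add, ← pow_mul, mul_assoc, ← mul_pow, mul_inv_cancel₀ ha,
    one_pow, mul_one]

lemma pow_mul_inv_sq_cube {a : K} (ha : a ≠ 0) {r s m : ℕ} (h : r = s + 2 + 3 * m) :
    a ^ r * (a⁻¹ ^ 2 * (a⁻¹ ^ 3) ^ m) = a ^ s := by
  rw [← pow_mul, ← pow_add, h, add_assoc, pow_add, mul_assoc, ← mul_pow, mul_inv_cancel₀ ha,
    one_pow, mul_one]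

/-- The weights of the rows of `fullMat`. -/
def rowWeight (a g : K) (h e : ℕ) : Fin (h + e) ⊕ Fin h → K :=
  Sum.elim (fun p => a ^ (3 * (h - p) + e)) (fun p => g ^ (3 * (p : ℕ) + 1 + e))

/-- The weights of the columns of `fullMat`. -/
def colWeight (a g : K) (h e : ℕ) : Fin (h + e) ⊕ Fin h → K :=
  Sum.elim (fun p => a ^ (3 * (h - p) + 2 * e - 1)) (fun p => g ^ (3 * (p : ℕ) + 1 + 2 * e))

/-- The first h+e rows and columns are scaled by powers of a, the last h by powers of ζ+2. The
exponents cancel the denominators in the two diagonal blocks exactly, apart from the corner term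
with α₀, and leave nonnegative powers elsewhere. The truncated subtractions never truncate. -/
lemma fullMat_apply (ev : ℚ[X] →+* K) (h e : ℕ) (he : e ≤ 1) (ha : ev aPoly ≠ 0)
    (hg : ev X + 2 ≠ 0) (r c : Fin (h + e) ⊕ Fin h) :
    ev (fullMat h e r c) = rowWeight (ev aPoly) (ev X + 2) h e r *
      (hMat ev (h + e + h) (finSumFinEquiv r) (finSumFinEquiv c)) *
      colWeight (ev aPoly) (ev X + 2) h e c := by
  have hg' : ev (X + 2) = ev X + 2 := by simp [map_ofNat]
  rcases r with p | p <;> rcases c with q | q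
  · have hp := p.2
    have hq := q.2
    simp only [fullMat, rowWeight, colWeight, hMat, Matrix.fromBlocks_apply₁₁, Matrix.of_apply,
      Sum.elim_inl, finSumFinEquiv_apply_left, Fin.val_castAdd, map_neg]
    rw [if_neg (by omega), if_pos (by omega)]
    have := pow_mul_inv_cube ha (r := 3 * (h - p) + e + (3 * (h - q) + 2 * e - 1)) (s := 0)
      (m := h + e + h - p - q) (by omega)
    rw [pow_add, pow_zero] at this
    linear_combination (ev (alpha (h + e + h - p - q))) * this
  · have hp := p.2
    have hq := q.2
    simp only [fullMat, rowWeight, colWeight, hMat, Matrix.fromBlocks_apply₁₂, Matrix.of_apply,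
      Sum.elim_inl, Sum.elim_inr, finSumFinEquiv_apply_left, finSumFinEquiv_apply_right,
      Fin.val_castAdd, Fin.val_natAdd, map_sub, mul_sub, sub_mul]
    congr 1
    · by_cases hc : h ≤ p + q
      · rw [if_pos hc, if_pos (by omega), show (p : ℕ) + (h + e + q) - (h + e + h) = p + q - h by omega]
        simp only [map_mul, map_pow, hg']
        rw [← pow_mul_inv_sq_cube hg (r := 3 * (q : ℕ) + 1 + 2 * e) (m := p + q - h) (by omega)]
        ring
      · rw [if_neg hc, if_neg (by omega), map_zero, mul_zero, zero_mul]
    · by_cases hc : (p : ℕ) + q ≤ h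
      · rw [if_pos hc, if_pos (by omega), show h + e + h - p - (h + e + q) = h - p - q by omega]
        simp only [map_mul, map_pow, hg']
        rw [← pow_mul_inv_cube ha (r := 3 * (h - p) + e) (m := h - p - q) (by omega)]
        ring
      · rw [if_neg hc, if_neg (by omega), map_zero, mul_zero, zero_mul]
  · have hp := p.2
    have hq := q.2
    simp only [fullMat, rowWeight, colWeight, hMat, Matrix.fromBlocks_apply₂₁, Matrix.of_apply,
      Sum.elim_inl, Sum.elim_inr, finSumFinEquiv_apply_left, finSumFinEquiv_apply_right,
      Fin.val_castAdd, Fin.val_natAdd, map_sub, mul_sub, sub_mul]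
    congr 1
    · by_cases hc : h ≤ p + q
      · rw [if_pos hc, if_pos (by omega), show h + e + (p : ℕ) + q - (h + e + h) = p + q - h by omega]
        simp only [map_mul, map_pow, hg']
        rw [← pow_mul_inv_sq_cube hg (r := 3 * (p : ℕ) + 1 + e) (m := p + q - h) (by omega)]
        ring
      · rw [if_neg hc, if_neg (by omega), map_zero, mul_zero, zero_mul]
    · by_cases hc : (p : ℕ) + q ≤ h
      · rw [if_pos hc, if_pos (by omega), show h + e + h - (h + e + p) - q = h - p - q by omega]
        simp only [map_mul, map_pow, hg']
        rw [← pow_mul_inv_cube ha (r := 3 * (h - q) + 2 * e - 1) (m := h - p - q) (by omega)]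
        ring
      · rw [if_neg hc, if_neg (by omega), map_zero, mul_zero, zero_mul]
  · have hp := p.2
    have hq := q.2
    simp only [fullMat, rowWeight, colWeight, hMat, Matrix.fromBlocks_apply₂₂, Matrix.of_apply,
      Sum.elim_inr, finSumFinEquiv_apply_right, Fin.val_natAdd, map_sub, mul_sub, sub_mul]
    congr 1
    · rw [if_pos (by omega), show h + e + (p : ℕ) + (h + e + q) - (h + e + h) = e + p + q by omega]
      have := pow_mul_inv_sq_cube hg (r := 3 * (p : ℕ) + 1 + e + (3 * (q : ℕ) + 1 + 2 * e)) (s := 0)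
        (m := e + p + q) (by omega)
      rw [pow_add, pow_zero] at this
      linear_combination (-ev (beta (e + p + q))) * this
    · by_cases hc : e + (p : ℕ) + q = 0
      · rw [if_pos hc, if_pos (by omega), show h + e + h - (h + e + p) - (h + e + q) = 0 by omega]
        obtain rfl : e = 0 := by omega
        have hp0 : (p : ℕ) = 0 := by omega
        have hq0 : (q : ℕ) = 0 := by omega
        simp only [map_mul, map_pow, hg', hp0, hq0]
        ring
      · rw [if_neg hc, if_neg (by omega), map_zero, mul_zero, zero_mul]

/-- The total weight falls short of n²+n by δ_n, with n = 2h+e; this deficit is the factor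
(1+2ζ)^{δ_n} of the theorem. -/
lemma sum_weight_a (h e : ℕ) (he : e ≤ 1) :
    (∑ p : Fin (h + e), (3 * (h - (p : ℕ)) + e)) + (∑ p : Fin (h + e), (3 * (h - (p : ℕ)) + 2 * e - 1)) +
      ThreeColour.delta (h + e + h) = (h + e + h) ^ 2 + (h + e + h) := by
  rw [← Finset.sum_range fun p => 3 * (h - p) + e, ← Finset.sum_range fun p => 3 * (h - p) + 2 * e - 1,
    ← Finset.sum_add_distrib]
  obtain rfl | rfl : e = 0 ∨ e = 1 := by omega
  · have h1 : ∑ p ∈ Finset.range h, (3 * (h - p) + 0 + (3 * (h - p) + 2 * 0 - 1)) = 3 * h ^ 2 + 2 * h := by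
      induction h with
      | zero => rfl
      | succ h ih =>
        rw [Finset.sum_range_succ']
        simp only [Nat.add_sub_add_right]
        rw [ih]
        simp only [Nat.sub_zero, add_zero, mul_zero]
        have : 3 * (h + 1) - 1 = 3 * h + 2 := by omega
        rw [this]
        ring
    rw [add_zero, h1, ThreeColour.delta, show (h + h) ^ 2 = 4 * h ^ 2 by ring,
      Nat.mul_div_cancel_left _ (by norm_num)]
    ring
  · have h1 : ∑ p ∈ Finset.range (h + 1), (3 * (h - p) + 1 + (3 * (h - p) + 2 * 1 - 1)) =
        3 * h ^ 2 + 5 * h + 2 := by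
      induction h with
      | zero => rfl
      | succ h ih =>
        rw [Finset.sum_range_succ']
        simp only [Nat.add_sub_add_right]
        rw [ih]
        simp only [Nat.sub_zero]
        have : 3 * (h + 1) + 2 * 1 - 1 = 3 * h + 4 := by omega
        rw [this]
        ring
    rw [h1, ThreeColour.delta, show (h + 1 + h) ^ 2 = 4 * (h ^ 2 + h) + 1 by ring]
    omega

/-- The analogous count for ζ+2, where the deficit from n² is n + δ_{n-1}. -/
lemma sum_weight_g (h e : ℕ) (he : e ≤ 1) :
    (∑ p : Fin h, (3 * (p : ℕ) + 1 + e)) + (∑ p : Fin h, (3 * (p : ℕ) + 1 + 2 * e)) +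
      (h + e + h + ThreeColour.delta (h + e + h - 1)) = (h + e + h) ^ 2 := by
  rw [← Finset.sum_range fun p => 3 * p + 1 + e, ← Finset.sum_range fun p => 3 * p + 1 + 2 * e,
    ← Finset.sum_add_distrib]
  have h1 : h + ∑ p ∈ Finset.range h, (3 * p + 1 + e + (3 * p + 1 + 2 * e)) =
      3 * h ^ 2 + 3 * h * e := by
    induction h with
    | zero => simp
    | succ h ih =>
      rw [Finset.sum_range_succ]
      linarith
  obtain rfl | rfl : e = 0 ∨ e = 1 := by omega
  · rcases h with _ | h
    · rfl
    · have h2 : ThreeColour.delta (h + 1 + 0 + (h + 1) - 1) = h ^ 2 + h := by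
        rw [ThreeColour.delta, show h + 1 + 0 + (h + 1) - 1 = 2 * h + 1 by omega,
          show (2 * h + 1) ^ 2 = 4 * (h ^ 2 + h) + 1 by ring]
        omega
      rw [h2]
      linarith
  · have h2 : ThreeColour.delta (h + 1 + h - 1) = h ^ 2 := by
      rw [ThreeColour.delta, show h + 1 + h - 1 = 2 * h by omega,
        show (2 * h) ^ 2 = 4 * h ^ 2 by ring, Nat.mul_div_cancel_left _ (by norm_num)]
    rw [h2]
    linarith

lemma map_det_fullMat (ev : ℚ[X] →+* K) (h e : ℕ) (he : e ≤ 1) (ha : ev aPoly ≠ 0)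
    (hg : ev X + 2 ≠ 0) :
    ev aPoly ^ ThreeColour.delta (h + e + h) *
        (ev X + 2) ^ (h + e + h + ThreeColour.delta (h + e + h - 1)) * ev (fullMat h e).det =
      ev aPoly ^ ((h + e + h) ^ 2 + (h + e + h)) * (ev X + 2) ^ (h + e + h) ^ 2 *
        (hMat ev (h + e + h)).det := by
  have h1 : (fullMat h e).map ev =
      Matrix.of fun r c => colWeight (ev aPoly) (ev X + 2) h e c *
        (Matrix.of fun r c => rowWeight (ev aPoly) (ev X + 2) h e r *
          ((hMat ev (h + e + h)).submatrix finSumFinEquiv finSumFinEquiv) r c) r c := by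
    ext r c
    rw [Matrix.map_apply, fullMat_apply ev h e he ha hg]
    simp only [Matrix.of_apply, Matrix.submatrix_apply]
    ring
  rw [RingHom.map_det, RingHom.mapMatrix_apply, h1, Matrix.det_mul_row, Matrix.det_mul_column,
    Matrix.det_submatrix_equiv_self, ← sum_weight_a h e he, ← sum_weight_g h e he]
  simp only [Fintype.prod_sum_type, rowWeight, colWeight, Sum.elim_inl, Sum.elim_inr,
    Finset.prod_pow_eq_pow_sum]
  simp only [pow_add]
  ring

/-- The two evaluations of the same determinant over ℚ(ζ) are combined, and the identity descends to
ℚ[ζ]. -/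
lemma detHat_X_eq (h e : ℕ) (he : e ≤ 1) :
    (1 + X) ^ ((h + e + h) ^ 2 + (h + e + h)) * detHat (X : ℚ[X]) (h + e + h) =
      (-1) ^ (h + e + h + 1).choose 2 * X ^ ((h + e + h) ^ 2 + (h + e + h)) *
        aPoly ^ ThreeColour.delta (h + e + h) *
        (X + 2) ^ (h + e + h + ThreeColour.delta (h + e + h - 1)) * (fullMat h e).det := by
  have hinj : Function.Injective (algebraMap ℚ[X] (RatFunc ℚ)) :=
    FaithfulSMul.algebraMap_injective _ _
  apply hinj
  have hg := ratFunc_X_add_two_ne_zero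
  have he' := ratFunc_one_add_X_ne_zero
  have h0 : (RatFunc.X : RatFunc ℚ) ≠ 0 := RatFunc.X_ne_zero
  rw [← RatFunc.algebraMap_X] at hg he' h0
  have h1 := det_hMat_eq_detHat (algebraMap ℚ[X] (RatFunc ℚ)) (h + e + h) h0 ratFunc_aPoly_ne_zero
    hg he' two_ne_zero
  have h2 := map_det_fullMat (algebraMap ℚ[X] (RatFunc ℚ)) h e he ratFunc_aPoly_ne_zero hg
  simp only [map_mul, map_pow, map_add, map_one, map_ofNat, map_neg, map_detHat]
  rw [← h1]
  linear_combination (-(-1) ^ (h + e + h + 1).choose 2 *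
    algebraMap ℚ[X] (RatFunc ℚ) X ^ ((h + e + h) ^ 2 + (h + e + h))) * h2

lemma one_add_X_ne_zero : (1 + X : ℚ[X]) ≠ 0 := fun h => by
  simpa using congrArg (eval 0) h

lemma X_add_two_ne_zero : (X + 2 : ℚ[X]) ≠ 0 := fun h => by
  simpa using congrArg (eval 0) h

lemma aPoly_ne_zero : (aPoly : ℚ[X]) ≠ 0 := fun h => by
  simpa [aPoly] using congrArg (eval 0) h

lemma isSpecialPolynomial_iff_det (h e : ℕ) (he : e ≤ 1) (p : ℚ[X]) :
    ThreeColour.IsSpecialPolynomial (h + e + h) p ↔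
      2 ^ ThreeColour.delta (h + e + h - 1) * (-1) ^ (h + e + h + 1).choose 2 * (fullMat h e).det =
        2 ^ (h + e + h) ^ 2 * (1 + X) ^ ((h + e + h) ^ 2 + (h + e + h)) * p := by
  have h1 := detHat_X_eq h e he
  rw [isSpecialPolynomial_iff, ← mul_right_inj' (pow_ne_zero ((h + e + h) ^ 2 + (h + e + h))
    one_add_X_ne_zero), mul_left_comm, h1]
  have hk : X ^ ((h + e + h) ^ 2 + (h + e + h)) * aPoly ^ ThreeColour.delta (h + e + h) *
        (X + 2) ^ (h + e + h + ThreeColour.delta (h + e + h - 1)) ≠ (0 : ℚ[X]) :=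
    mul_ne_zero (mul_ne_zero (pow_ne_zero _ X_ne_zero) (pow_ne_zero _ aPoly_ne_zero))
      (pow_ne_zero _ X_add_two_ne_zero)
  conv_rhs => rw [← mul_right_inj' hk]
  refine Eq.congr ?_ ?_ <;> ring

/-- In `detHat_X_eq` the power of 1+ζ on the left is coprime to ζ, 2ζ+1 and ζ+2, so it must divide
the cleared determinant. The quotient is p up to a constant. -/
lemma existsUnique_isSpecialPolynomial (n : ℕ) : ∃! p : ℚ[X], ThreeColour.IsSpecialPolynomial n p := by
  obtain ⟨h, e, he, rfl⟩ : ∃ h e, e ≤ 1 ∧ n = h + e + h :=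
    ⟨n / 2, n % 2, by omega, by omega⟩
  have h1 := detHat_X_eq h e he
  have hdvd : (1 + X) ^ ((h + e + h) ^ 2 + (h + e + h)) ∣ (fullMat h e).det := by
    have c1 : IsCoprime (1 + X : ℚ[X]) X := ⟨1, -1, by ring⟩
    have c2 : IsCoprime (1 + X : ℚ[X]) aPoly := ⟨2, -1, by rw [aPoly]; ring⟩
    have c3 : IsCoprime (1 + X : ℚ[X]) (X + 2) := ⟨-1, 1, by ring⟩
    have c4 : IsCoprime (1 + X : ℚ[X]) ((-1) ^ (h + e + h + 1).choose 2) :=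
      ⟨0, (-1) ^ (h + e + h + 1).choose 2, by rw [neg_one_pow_mul_self]; ring⟩
    refine IsCoprime.dvd_of_dvd_mul_left (IsCoprime.pow_left ?_) (Dvd.intro _ h1)
    exact (((c4.mul_right c1.pow_right).mul_right c2.pow_right).mul_right c3.pow_right)
  obtain ⟨q, hq⟩ := hdvd
  have h2 : (C (2⁻¹ : ℚ) * 2) = 1 := by
    rw [show (2 : ℚ[X]) = C 2 from rfl, ← C_mul, inv_mul_cancel₀ two_ne_zero, C_1]
  refine ⟨2 ^ ThreeColour.delta (h + e + h - 1) * (-1) ^ (h + e + h + 1).choose 2 *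
    C (2⁻¹) ^ (h + e + h) ^ 2 * q, ?_, ?_⟩
  · change ThreeColour.IsSpecialPolynomial _ _
    rw [isSpecialPolynomial_iff_det _ _ he, hq]
    have h3 : (C (2⁻¹ : ℚ) ^ (h + e + h) ^ 2 * 2 ^ (h + e + h) ^ 2) = 1 := by
      rw [← mul_pow, h2, one_pow]
    linear_combination (-2 ^ ThreeColour.delta (h + e + h - 1) * (-1) ^ (h + e + h + 1).choose 2 *
      (1 + X) ^ ((h + e + h) ^ 2 + (h + e + h)) * q) * h3
  · intro p hp
    rw [isSpecialPolynomial_iff_det _ _ he, hq] at hp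
    apply mul_left_cancel₀ (pow_ne_zero ((h + e + h) ^ 2 + (h + e + h)) one_add_X_ne_zero)
    apply mul_left_cancel₀ (pow_ne_zero ((h + e + h) ^ 2) (two_ne_zero (α := ℚ[X])))
    have h3 : (C (2⁻¹ : ℚ) ^ (h + e + h) ^ 2 * 2 ^ (h + e + h) ^ 2) = 1 := by
      rw [← mul_pow, h2, one_pow]
    linear_combination -hp - (2 ^ ThreeColour.delta (h + e + h - 1) * (-1) ^ (h + e + h + 1).choose 2 *
      (1 + X) ^ ((h + e + h) ^ 2 + (h + e + h)) * q) * h3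

end FullMatrix

end SpecialPoly

namespace SpecialPoly

/-! ### Triangular changes of family. -/

section Triangular

/-- Determinants of functionals on two families that differ by a triangular change. -/
lemma det_functional_triangular {R M : Type*} [CommRing R] [AddCommGroup M] [Module R M] {p q : ℕ}
    (L : Fin p ⊕ Fin q → M →ₗ[R] R) (φ ψ : Fin p ⊕ Fin q → M) (κ : Fin p ⊕ Fin q → R)
    (key : Fin p ⊕ Fin q → ℕ) (hkey : Function.Injective key)
    (h : ∀ r, ψ r - κ r • φ r ∈ Submodule.span R (φ '' {s | key s < key r})) :
    (Matrix.of fun r c => L c (ψ r)).det = (∏ r, κ r) * (Matrix.of fun r c => L c (φ r)).det := by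
  have h1 (r) : ∃ l : Fin p ⊕ Fin q → R, l r = κ r ∧ (∀ c, key r < key c → l c = 0) ∧
      ψ r = ∑ c, l c • φ c := by
    obtain ⟨l, hl, hx⟩ := (Finsupp.mem_span_image_iff_linearCombination R).1 (h r)
    have hl0 (c) (hc : key r ≤ key c) : l c = 0 := by
      by_contra hne
      exact absurd ((Finsupp.mem_supported R l).1 hl (Finsupp.mem_support_iff.2 hne)) (not_lt.2 hc)
    refine ⟨fun c => l c + if c = r then κ r else 0, ?_, ?_, ?_⟩
    · simp [hl0 r le_rfl]
    · intro c hc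
      have : c ≠ r := by
        rintro rfl
        exact lt_irrefl _ hc
      simp [this, hl0 c hc.le]
    · simp only [add_smul, Finset.sum_add_distrib, ite_smul, zero_smul, Finset.sum_ite_eq',
        Finset.mem_univ, if_true]
      rw [← sub_eq_iff_eq_add, ← hx, Finsupp.linearCombination_apply]
      exact Finsupp.sum_fintype _ _ (by simp)
  choose T hT1 hT2 hT3 using h1
  have h2 : (Matrix.of fun r c => L c (ψ r)) = Matrix.of T * (Matrix.of fun r c => L c (φ r)) := by
    ext r c
    rw [Matrix.of_apply, hT3, map_sum, Matrix.mul_apply]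
    simp
  rw [h2, Matrix.det_mul, det_of_ord_triangular _ key hkey]
  · congr 1
    exact Finset.prod_congr rfl fun r _ => hT1 r
  · exact hT2

end Triangular

/-! ### Chebyshev polynomials and the cubic parametrization. -/

section Chain

/-- The sequence with `χ_{r+4} = (27t + 2)χ_{r+2} - χ_r` and initial values depending on `v`. -/
noncomputable def chain (t v : ℚ[X]) : ℕ → ℚ[X]
  | 0 => 1
  | 1 => 3 * v - 1
  | 2 => 27 * t + 2 + (3 * v - 1)
  | 3 => (27 * t + 2) * (3 * v - 1) + 1
  | r + 4 => (27 * t + 2) * chain t v (r + 2) - chain t v r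

/-- The sequence `1, v, t, vt, t², vt², …`. -/
noncomputable def mono (t v : ℚ[X]) (k : ℕ) : ℚ[X] := t ^ (k / 2) * v ^ (k % 2)

/-- The leading coefficients of `chain` with respect to `mono`. -/
def monoLead (k : ℕ) : ℚ := 27 ^ (k / 2) * 3 ^ (k % 2)

lemma mul_mono (t v : ℚ[X]) (k : ℕ) : t * mono t v k = mono t v (k + 2) := by
  rw [mono, mono, Nat.add_mod_right, Nat.add_div_right _ (by norm_num), pow_succ]
  ring

/-- Each use of the recurrence multiplies by 27t and moves the index by two, so the change from
`mono` to `chain` is triangular with diagonal `monoLead`. -/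
lemma chain_sub_mem (t v : ℚ[X]) (r : ℕ) :
    chain t v r - monoLead r • mono t v r ∈ Submodule.span ℚ (mono t v '' {k | k < r}) := by
  have hmem {k m : ℕ} (hk : k < m) : mono t v k ∈ Submodule.span ℚ (mono t v '' {k | k < m}) :=
    Submodule.subset_span ⟨k, hk, rfl⟩
  have hmono {m m' : ℕ} (hm : m ≤ m') : Submodule.span ℚ (mono t v '' {k | k < m}) ≤
      Submodule.span ℚ (mono t v '' {k | k < m'}) :=
    Submodule.span_mono (Set.image_mono fun k hk => lt_of_lt_of_le hk hm)
  have hmul {m : ℕ} {f : ℚ[X]} (hf : f ∈ Submodule.span ℚ (mono t v '' {k | k < m})) :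
      t * f ∈ Submodule.span ℚ (mono t v '' {k | k < m + 2}) := by
    induction hf using Submodule.span_induction with
    | mem x hx =>
      obtain ⟨k, hk, rfl⟩ := hx
      rw [mul_mono]
      exact hmem (Nat.add_lt_add_right hk 2)
    | zero => simp
    | add x y _ _ hx hy => rw [mul_add]; exact add_mem hx hy
    | smul a x _ hx => rw [mul_smul_comm]; exact Submodule.smul_mem _ _ hx
  induction r using Nat.strong_induction_on with
  | _ r ih =>
    have c3 : (C 3 : ℚ[X]) = 3 := rfl
    have c6 : (C 6 : ℚ[X]) = 6 := rfl
    have c27 : (C 27 : ℚ[X]) = 27 := rfl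
    have h0 : mono t v 0 = 1 := by simp [mono]
    have h1 : mono t v 1 = v := by simp [mono]
    have h2 : mono t v 2 = t := by simp [mono]
    have h3 : mono t v 3 = t * v := by simp [mono]
    match r, ih with
    | 0, _ => simp [chain, monoLead, mono]
    | 1, _ =>
      have : chain t v 1 - monoLead 1 • mono t v 1 = (-1 : ℚ) • mono t v 0 := by
        rw [h0, h1]
        simp [chain, monoLead, smul_eq_C_mul, c3]
      rw [this]
      exact Submodule.smul_mem _ _ (hmem (by norm_num))
    | 2, _ =>
      have : chain t v 2 - monoLead 2 • mono t v 2 = (3 : ℚ) • mono t v 1 + (1 : ℚ) • mono t v 0 := by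
        rw [h0, h1, h2]
        simp [chain, monoLead, smul_eq_C_mul, c3, c27]
        ring
      rw [this]
      exact add_mem (Submodule.smul_mem _ _ (hmem (by norm_num)))
        (Submodule.smul_mem _ _ (hmem (by norm_num)))
    | 3, _ =>
      have : chain t v 3 - monoLead 3 • mono t v 3 = (-27 : ℚ) • mono t v 2 +
          ((6 : ℚ) • mono t v 1 + (-1 : ℚ) • mono t v 0) := by
        rw [h0, h1, h2, h3]
        simp [chain, monoLead, smul_eq_C_mul, c3, c6, c27]
        ring
      rw [this]
      exact add_mem (Submodule.smul_mem _ _ (hmem (by norm_num)))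
        (add_mem (Submodule.smul_mem _ _ (hmem (by norm_num)))
          (Submodule.smul_mem _ _ (hmem (by norm_num))))
    | r + 4, ih =>
      have hin {s : ℕ} (hs : s < r + 4) : chain t v s ∈
          Submodule.span ℚ (mono t v '' {k | k < r + 4}) := by
        have := add_mem (hmono hs.le (ih s hs)) (Submodule.smul_mem _ (monoLead s) (hmem hs))
        rwa [sub_add_cancel] at this
      have hl : monoLead (r + 4) = 27 * monoLead (r + 2) := by
        rw [monoLead, monoLead, show r + 4 = (r + 2) + 2 by ring, Nat.add_mod_right,
          Nat.add_div_right _ (by norm_num), pow_succ]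
        ring
      have : chain t v (r + 4) - monoLead (r + 4) • mono t v (r + 4) =
          (27 : ℚ) • (t * (chain t v (r + 2) - monoLead (r + 2) • mono t v (r + 2))) +
            ((2 : ℚ) • chain t v (r + 2) - chain t v r) := by
        rw [hl, ← mul_mono t v (r + 2), chain]
        simp only [smul_eq_C_mul, C_mul, map_ofNat]
        ring
      rw [this]
      exact add_mem (Submodule.smul_mem _ _ (hmul (ih (r + 2) (by omega))))
        (sub_mem (Submodule.smul_mem _ _ (hin (by omega))) (hin (by omega)))

/-- The Chebyshev polynomials `sin(eθ)/sin θ` in the variable `2 cos θ - 2`. -/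
noncomputable def cheb : ℕ → ℚ[X]
  | 0 => 0
  | 1 => 1
  | e + 2 => (X + 2) * cheb (e + 1) - cheb e

/-- The polynomial `27t + 2 = c³ - 3c`, with `c = X + 2`. -/
noncomputable def cubicT : ℚ[X] := C (1 / 27) * (X * (X + 3) ^ 2)

lemma twentySeven_mul_cubicT : 27 * cubicT + 2 = (X + 2) ^ 3 - 3 * (X + 2) := by
  have : (27 : ℚ[X]) * C (1 / 27) = 1 := by
    rw [show (27 : ℚ[X]) = C 27 from rfl, ← C_mul, mul_one_div_cancel (by norm_num), C_1]
  rw [cubicT]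
  linear_combination (X * (X + 3) ^ 2) * this

/-- With c = 2 cos θ one has c³ - 3c = 2 cos 3θ, so this is the addition theorem for sin(eθ) in
steps of 3θ. It explains the normalization of `cubicT`. -/
lemma cheb_add_six (e : ℕ) : cheb (e + 6) = (27 * cubicT + 2) * cheb (e + 3) - cheb e := by
  rw [twentySeven_mul_cubicT]
  simp only [cheb]
  ring

/-- The sequence `1, 2, 4, 5, 7, 8, …`. -/
def seqU (r : ℕ) : ℕ := 3 * (r / 2) + r % 2 + 1

/-- The sequence `1, 5, 7, 11, 13, …`. -/
def seqE (r : ℕ) : ℕ := 6 * (r / 2) + 4 * (r % 2) + 1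

/-- Here 3v - 1 = X + 2 is the Chebyshev polynomial of index 2; the indices prime to 3 then follow
by `cheb_add_six`. -/
lemma chain_eq_cheb (r : ℕ) : chain cubicT (C (1 / 3) * (X + 3)) r = cheb (seqU r) := by
  have h3 : 3 * (C (1 / 3 : ℚ) * (X + 3)) - 1 = X + 2 := by
    have : (3 : ℚ[X]) * C (1 / 3) = 1 := by
      rw [show (3 : ℚ[X]) = C 3 from rfl, ← C_mul, mul_one_div_cancel (by norm_num), C_1]
    linear_combination (X + 3) * this
  induction r using Nat.strong_induction_on with
  | _ r ih =>
    match r, ih with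
    | 0, _ => simp [chain, seqU, cheb]
    | 1, _ => rw [chain, h3]; simp [seqU, cheb]
    | 2, _ => rw [chain, h3, twentySeven_mul_cubicT]; simp [seqU, cheb]; ring
    | 3, _ => rw [chain, h3, twentySeven_mul_cubicT]; simp [seqU, cheb]; ring
    | r + 4, ih =>
      rw [chain, ih (r + 2) (by omega), ih r (by omega), show seqU (r + 4) = seqU r + 6 by
        simp only [seqU]; omega, show seqU (r + 2) = seqU r + 3 by simp only [seqU]; omega,
        cheb_add_six]

/-- For an odd number m = 2k+1, the sum of the Chebyshev polynomials of indices k+1 and k is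
sin(mθ/2)/sin(θ/2). The chain consists of those with m prime to 6. -/
lemma chain_eq_cheb_add_cheb (r : ℕ) : chain cubicT (C (1 / 3) * ((X + 2) * (X + 3))) r =
    cheb (seqE r / 2 + 1) + cheb (seqE r / 2) := by
  have h3 : 3 * (C (1 / 3 : ℚ) * ((X + 2) * (X + 3))) - 1 = (X + 2) * (X + 3) - 1 := by
    have : (3 : ℚ[X]) * C (1 / 3) = 1 := by
      rw [show (3 : ℚ[X]) = C 3 from rfl, ← C_mul, mul_one_div_cancel (by norm_num), C_1]
    linear_combination ((X + 2) * (X + 3)) * this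
  induction r using Nat.strong_induction_on with
  | _ r ih =>
    match r, ih with
    | 0, _ => simp [chain, seqE, cheb]
    | 1, _ => rw [chain, h3]; simp [seqE, cheb]; ring
    | 2, _ => rw [chain, h3, twentySeven_mul_cubicT]; simp [seqE, cheb]; ring
    | 3, _ => rw [chain, h3, twentySeven_mul_cubicT]; simp [seqE, cheb]; ring
    | r + 4, ih =>
      rw [chain, ih (r + 2) (by omega), ih r (by omega), show seqE (r + 4) / 2 = seqE r / 2 + 6 by
        simp only [seqE]; omega, show seqE (r + 2) / 2 = seqE r / 2 + 3 by simp only [seqE]; omega,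
        cheb_add_six, add_right_comm, cheb_add_six, add_right_comm]
      ring

lemma coeff_cheb (e j : ℕ) : (cheb e).coeff j = ((e + j).choose (2 * j + 1) : ℚ) := by
  have h : ∀ e, (∀ j, (cheb e).coeff j = ((e + j).choose (2 * j + 1) : ℚ)) ∧
      ∀ j, (cheb (e + 1)).coeff j = ((e + 1 + j).choose (2 * j + 1) : ℚ) := by
    intro e
    induction e with
    | zero =>
      refine ⟨fun j => ?_, fun j => ?_⟩
      · rw [Nat.choose_eq_zero_of_lt (by omega)]
        simp [cheb]
      · rcases j with _ | j
        · simp [cheb]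
        · rw [Nat.choose_eq_zero_of_lt (by omega)]
          simp [cheb, coeff_one]
    | succ e ih =>
      refine ⟨ih.2, fun j => ?_⟩
      rw [cheb, add_mul, coeff_sub, coeff_add, ih.1, show (2 : ℚ[X]) = C 2 from rfl, coeff_C_mul, ih.2]
      rcases j with _ | j
      · rw [mul_coeff_zero, coeff_X_zero]
        simp
        ring
      · rw [coeff_X_mul, ih.2]
        have : e + 1 + 1 + (j + 1) = (e + j + 1) + 1 + 1 := by ring
        rw [this, show e + 1 + (j + 1) = (e + j + 1) + 1 by ring, show e + 1 + j = e + j + 1 by ring,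
          show e + (j + 1) = e + j + 1 by ring, show 2 * (j + 1) + 1 = 2 * j + 1 + 1 + 1 by ring]
        simp only [Nat.choose_succ_succ']
        push_cast
        ring
  exact (h e).1 j

lemma choose_step (m q : ℕ) : ((m + 1).choose (q + 2) : ℚ) * ((q + 2) * (q + 1)) =
    m.choose q * ((m + 1) * (m - q)) := by
  have h1 : ((m + 1) * m.choose (q + 1) : ℚ) = (m + 1).choose (q + 2) * (q + 2) := by
    exact_mod_cast Nat.add_one_mul_choose_eq m (q + 1)
  have h2 : (m.choose (q + 1) * (q + 1) : ℚ) = m.choose q * (m - q) := by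
    rcases le_or_gt q m with h | h
    · rw [← Nat.cast_sub h]
      exact_mod_cast Nat.choose_succ_right_eq m q
    · rw [Nat.choose_eq_zero_of_lt h, Nat.choose_eq_zero_of_lt (by omega)]
      simp
  linear_combination (-(q + 1) : ℚ) * h1 + (m + 1 : ℚ) * h2

/-- The binomial coefficient in `coeff_cheb` is an odd polynomial in e. Apart from the factor e, a
determinant of such coefficients is therefore a Vandermonde determinant in the e². -/
lemma coeff_cheb_mul_factorial (e j : ℕ) : (cheb e).coeff j * (2 * j + 1).factorial =
    e * ∏ i ∈ Finset.range j, ((e : ℚ) ^ 2 - (i + 1) ^ 2) := by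
  rw [coeff_cheb]
  induction j with
  | zero => simp
  | succ j ih =>
    rw [Finset.prod_range_succ, ← mul_assoc, ← ih, show 2 * (j + 1) + 1 = 2 * j + 1 + 2 by ring,
      Nat.factorial_succ, Nat.factorial_succ]
    have := choose_step (e + j) (2 * j + 1)
    push_cast at this ⊢
    rw [← add_assoc e j 1]
    linear_combination ((2 * j + 1).factorial : ℚ) * this

lemma coeff_cheb_add_cheb_mul_factorial (k j : ℕ) :
    (cheb (k + 1) + cheb k).coeff j * ((2 * j + 1).factorial * 4 ^ j) =
      (2 * k + 1) * ∏ i ∈ Finset.range j, ((2 * k + 1 : ℚ) ^ 2 - (2 * i + 1) ^ 2) := by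
  rw [coeff_add, coeff_cheb, coeff_cheb]
  induction j with
  | zero => simp; ring
  | succ j ih =>
    rw [Finset.prod_range_succ, ← mul_assoc (2 * (k : ℚ) + 1), ← ih, show 2 * (j + 1) + 1 = 2 * j + 1 + 2 by ring,
      Nat.factorial_succ, Nat.factorial_succ, pow_succ]
    have h1 := choose_step (k + j) (2 * j + 1)
    have h2 := choose_step (k + 1 + j) (2 * j + 1)
    have h3 : (((k + j).choose (2 * j + 1) : ℚ)) * (k + j + 1) =
        (k + j + 1).choose (2 * j + 1) * (k - j) := by
      rcases le_or_gt (2 * j + 1) (k + j + 1) with h | h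
      · have h4 := Nat.choose_mul_succ_eq (k + j) (2 * j + 1)
        have h5 : ((k + j + 1 - (2 * j + 1) : ℕ) : ℚ) = k - j := by
          rw [Nat.cast_sub h]
          push_cast
          ring
        rw [← h5]
        exact_mod_cast h4
      · rw [Nat.choose_eq_zero_of_lt h, Nat.choose_eq_zero_of_lt (by omega)]
        simp
    rw [show k + 1 + j = k + j + 1 by ring] at *
    rw [show k + 1 + (j + 1) = k + j + 1 + 1 by ring, show k + (j + 1) = k + j + 1 by ring]
    push_cast at h1 h2 ⊢
    linear_combination ((2 * j + 1).factorial * 4 ^ j * 4 : ℚ) * (h1 + h2 - h3)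

end Chain

end SpecialPoly

namespace SpecialPoly

/-! ### Vandermonde products in interleaved order. -/

section Vandermonde

variable {R : Type*} [CommRing R]

/-- The product of the differences of the first `N` terms of a sequence. -/
def vdm (f : ℕ → R) (N : ℕ) : R := ∏ j ∈ Finset.range N, ∏ i ∈ Finset.range j, (f j - f i)

lemma vdm_succ (f : ℕ → R) (N : ℕ) :
    vdm f (N + 1) = vdm f N * ∏ i ∈ Finset.range N, (f N - f i) := Finset.prod_range_succ _ _

lemma vdm_congr {f g : ℕ → R} {N : ℕ} (h : ∀ i < N, f i = g i) : vdm f N = vdm g N := by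
  refine Finset.prod_congr rfl fun j hj => Finset.prod_congr rfl fun i hi => ?_
  have hj := Finset.mem_range.1 hj
  have hi := Finset.mem_range.1 hi
  rw [h j hj, h i (hi.trans hj)]

lemma det_vandermonde_eq_vdm (f : ℕ → R) (N : ℕ) :
    (Matrix.vandermonde fun i : Fin N => f i).det = vdm f N := by
  rw [Matrix.det_vandermonde, Finset.prod_comm' (t' := Finset.univ) (s' := fun j => Finset.Iio j)
    (by simp), vdm, Finset.prod_range]
  refine Finset.prod_congr rfl fun j _ => ?_
  rw [← Nat.Iio_eq_range, ← Fin.map_valEmbedding_Iio, Finset.prod_map]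
  rfl

lemma vdm_add (f : ℕ → R) (s N : ℕ) :
    vdm f (s + N) = vdm f s * vdm (fun i => f (s + i)) N *
      ∏ j ∈ Finset.range N, ∏ i ∈ Finset.range s, (f (s + j) - f i) := by
  induction N with
  | zero => simp [vdm]
  | succ N ih =>
    rw [← add_assoc, vdm_succ, ih, vdm_succ, Finset.prod_range_succ, Finset.prod_range_add]
    ring

lemma prod_range_two_mul {M : Type*} [CommMonoid M] (f : ℕ → M) (N : ℕ) :
    ∏ i ∈ Finset.range (2 * N), f i =
      (∏ i ∈ Finset.range N, f (2 * i)) * ∏ i ∈ Finset.range N, f (2 * i + 1) := by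
  induction N with
  | zero => simp
  | succ N ih =>
    rw [mul_add, mul_one, Finset.prod_range_succ, Finset.prod_range_succ, ih, Finset.prod_range_succ,
      Finset.prod_range_succ, mul_assoc, mul_mul_mul_comm]

lemma prod_range_unshuffle {M : Type*} [CommMonoid M] (f : ℕ → M) (N e : ℕ) (he : e ≤ 1) :
    (∏ i ∈ Finset.range (N + e), f (2 * i)) * ∏ i ∈ Finset.range N, f (2 * i + 1) =
      ∏ i ∈ Finset.range (N + e + N), f i := by
  obtain rfl | rfl : e = 0 ∨ e = 1 := by omega
  · rw [add_zero, ← prod_range_two_mul, two_mul]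
  · rw [show N + 1 + N = 2 * N + 1 by ring, Finset.prod_range_succ, Finset.prod_range_succ,
      prod_range_two_mul, mul_right_comm]

/-- The sign is that of the permutation listing the even positions before the odd ones. -/
lemma vdm_unshuffle (f : ℕ → R) (N e : ℕ) (he : e ≤ 1) :
    vdm (fun i => f (2 * i)) (N + e) * vdm (fun i => f (2 * i + 1)) N *
        (∏ j ∈ Finset.range N, ∏ i ∈ Finset.range (N + e), (f (2 * j + 1) - f (2 * i))) =
      (-1) ^ (N + e).choose 2 * vdm f (N + e + N) := by
  have key : ∀ N, (vdm (fun i => f (2 * i)) N * vdm (fun i => f (2 * i + 1)) N *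
        (∏ j ∈ Finset.range N, ∏ i ∈ Finset.range N, (f (2 * j + 1) - f (2 * i))) =
      (-1) ^ N.choose 2 * vdm f (2 * N)) →
      vdm (fun i => f (2 * i)) (N + 1) * vdm (fun i => f (2 * i + 1)) N *
        (∏ j ∈ Finset.range N, ∏ i ∈ Finset.range (N + 1), (f (2 * j + 1) - f (2 * i))) =
      (-1) ^ (N + 1).choose 2 * vdm f (2 * N + 1) := by
    intro N h
    simp only [vdm_succ, Finset.prod_range_succ, Finset.prod_mul_distrib]
    rw [prod_range_two_mul, choose_two_succ, pow_add]
    have : ∏ i ∈ Finset.range N, (f (2 * i + 1) - f (2 * N)) =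
        (-1) ^ N * ∏ i ∈ Finset.range N, (f (2 * N) - f (2 * i + 1)) := by
      rw [← Finset.card_range N, ← Finset.prod_const, Finset.card_range, ← Finset.prod_mul_distrib]
      exact Finset.prod_congr rfl fun _ _ => by ring
    rw [this]
    linear_combination ((∏ i ∈ Finset.range N, (f (2 * N) - f (2 * i))) * (-1) ^ N *
      ∏ i ∈ Finset.range N, (f (2 * N) - f (2 * i + 1))) * h
  have main : ∀ N, vdm (fun i => f (2 * i)) N * vdm (fun i => f (2 * i + 1)) N *
        (∏ j ∈ Finset.range N, ∏ i ∈ Finset.range N, (f (2 * j + 1) - f (2 * i))) =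
      (-1) ^ N.choose 2 * vdm f (2 * N) := by
    intro N
    induction N with
    | zero => simp [vdm]
    | succ N ih =>
      have h := key N ih
      rw [show 2 * (N + 1) = 2 * N + 1 + 1 by ring, vdm_succ _ (2 * N + 1),
        vdm_succ (fun i => f (2 * i + 1)), Finset.prod_range_succ _ N, Finset.prod_range_succ _ (2 * N),
        prod_range_two_mul, Finset.prod_range_succ (fun i => f (2 * N + 1) - f (2 * i)) N]
      linear_combination ((∏ i ∈ Finset.range N, (f (2 * N + 1) - f (2 * i + 1))) *
        ((∏ i ∈ Finset.range N, (f (2 * N + 1) - f (2 * i))) * (f (2 * N + 1) - f (2 * N)))) * h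
  obtain rfl | rfl : e = 0 ∨ e = 1 := by omega
  · rw [add_zero, main, two_mul]
  · rw [key N (main N)]
    congr 2
    ring

/-- Vandermonde determinants in the squares. -/
lemma det_odd_products {K : Type*} [Field K] (x b c : ℕ → K) (N : ℕ) :
    (Matrix.of fun r j : Fin N =>
        x r * (∏ i ∈ Finset.range j, (x r ^ 2 - b i)) / c j).det =
      (∏ r ∈ Finset.range N, x r) * vdm (fun r => x r ^ 2) N / ∏ j ∈ Finset.range N, c j := by
  have hp (j : ℕ) : (∏ i ∈ Finset.range j, (X - C (b i))).Monic :=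
    monic_prod_of_monic _ _ fun i _ => monic_X_sub_C _
  have h1 := Matrix.det_eval_matrixOfPolynomials_eq_det_vandermonde (fun r : Fin N => x r ^ 2)
    (fun j => ∏ i ∈ Finset.range j, (X - C (b i))) (fun j => by
      rw [natDegree_prod_of_monic _ _ fun i _ => monic_X_sub_C _]
      simp) (fun j => hp j)
  rw [det_vandermonde_eq_vdm fun r => x r ^ 2] at h1
  have h2 : (Matrix.of fun r j : Fin N => x r * (∏ i ∈ Finset.range j, (x r ^ 2 - b i)) / c j) =
      Matrix.of fun r j : Fin N => (c j)⁻¹ * (Matrix.of fun r j : Fin N => x r *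
        (Matrix.of fun r j : Fin N => (∏ i ∈ Finset.range j, (X - C (b i))).eval (x r ^ 2)) r j) r j := by
    ext r j
    simp only [Matrix.of_apply, eval_prod, eval_sub, eval_X, eval_C]
    ring
  rw [h2, Matrix.det_mul_row, Matrix.det_mul_column, ← h1, Finset.prod_inv_distrib,
    Finset.prod_range, Finset.prod_range]
  ring

/-- The key of the unshuffled order. -/
def blockKey {s N : ℕ} : Fin s ⊕ Fin N → ℕ := Sum.elim (fun i => 2 * i) (fun i => 2 * i + 1)

lemma blockKey_injective {s N : ℕ} : Function.Injective (blockKey : Fin s ⊕ Fin N → ℕ) := by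
  rintro (a | a) (b | b) h <;> simp [blockKey, Fin.ext_iff] at h ⊢ <;> omega

lemma prod_blockKey {M : Type*} [CommMonoid M] (f : ℕ → M) (N e : ℕ) (he : e ≤ 1) :
    ∏ r : Fin (N + e) ⊕ Fin N, f (blockKey r) = ∏ i ∈ Finset.range (N + e + N), f i := by
  rw [← prod_range_unshuffle f N e he, Fintype.prod_sum_type, Finset.prod_range, Finset.prod_range]
  rfl

lemma det_odd_products_block {K : Type*} [Field K] (x b c : ℕ → K) (N e : ℕ) (he : e ≤ 1) :
    (Matrix.of fun r j : Fin (N + e) ⊕ Fin N =>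
        x (blockKey r) * (∏ i ∈ Finset.range (ord j), (x (blockKey r) ^ 2 - b i)) / c (ord j)).det =
      (-1) ^ (N + e).choose 2 * ((∏ r ∈ Finset.range (N + e + N), x r) *
        vdm (fun r => x r ^ 2) (N + e + N) / ∏ j ∈ Finset.range (N + e + N), c j) := by
  set z : ℕ → K := fun i => if i < N + e then x (2 * i) else x (2 * (i - (N + e)) + 1) with hz
  have hz1 {i : ℕ} (hi : i < N + e) : z i = x (2 * i) := if_pos hi
  have hz2 (i : ℕ) : z (N + e + i) = x (2 * i + 1) := by
    simp only [hz]
    rw [if_neg (by omega), Nat.add_sub_cancel_left]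
  have hzk (r : Fin (N + e) ⊕ Fin N) : z (finSumFinEquiv r) = x (blockKey r) := by
    rcases r with r | r
    · rw [finSumFinEquiv_apply_left, Fin.val_castAdd, hz1 r.2]
      rfl
    · rw [finSumFinEquiv_apply_right, Fin.val_natAdd, hz2]
      rfl
  have hord (r : Fin (N + e) ⊕ Fin N) : ((finSumFinEquiv r : Fin (N + e + N)) : ℕ) = ord r := by
    rcases r with r | r <;> simp
  have hzk' (r : Fin (N + e) ⊕ Fin N) : z (ord r) = x (blockKey r) := by rw [← hord, hzk]
  have h1 := det_odd_products z b c (N + e + N)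
  rw [← Matrix.det_submatrix_equiv_self finSumFinEquiv] at h1
  have h2 : (∏ r ∈ Finset.range (N + e + N), z r) = ∏ r ∈ Finset.range (N + e + N), x r := by
    rw [← prod_range_unshuffle x N e he, Finset.prod_range_add]
    simp only [hz2]
    congr 1
    exact Finset.prod_congr rfl fun i hi => hz1 (Finset.mem_range.1 hi)
  have h3 : vdm (fun r => z r ^ 2) (N + e + N) =
      (-1) ^ (N + e).choose 2 * vdm (fun r => x r ^ 2) (N + e + N) := by
    rw [← vdm_unshuffle (fun r => x r ^ 2) N e he, vdm_add]
    simp only [hz2]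
    congr 1
    · congr 1
      exact vdm_congr fun i hi => by rw [hz1 hi]
    · refine Finset.prod_congr rfl fun j _ => Finset.prod_congr rfl fun i hi => ?_
      rw [hz1 (Finset.mem_range.1 hi)]
  rw [h2, h3] at h1
  rw [mul_left_comm, mul_div_assoc] at h1
  rw [← h1]
  congr 1
  ext r j
  simp only [Matrix.submatrix_apply, Matrix.of_apply, hzk', hord]

end Vandermonde

end SpecialPoly

namespace SpecialPoly

/-! ### Toeplitz determinants attached to Y²(Y-1) = cτ. -/

section Toeplitz

/-- Passing from coefficients of polynomials to coefficients along a series without constant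
term. -/
lemma det_coeff_aeval {K : Type*} [Field K] {p q : ℕ} (U : PowerSeries K) (φ : Fin p ⊕ Fin q → K[X]) :
    (Matrix.of fun r c => PowerSeries.coeff (ord c) (aeval (PowerSeries.X * U) (φ r))).det =
      PowerSeries.constantCoeff U ^ (p + q).choose 2 *
        (Matrix.of fun r c => (φ r).coeff (ord c)).det := by
  set L : Fin p ⊕ Fin q → K[X] →ₗ[K] K := fun c =>
    (PowerSeries.coeff (ord c)).comp (aeval (PowerSeries.X * U)).toLinearMap with hL
  have hLa (c) (f : K[X]) : L c f = PowerSeries.coeff (ord c) (aeval (PowerSeries.X * U) f) := rfl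
  have hN : (X ^ (p + q) : K[X]).Monic := monic_X_pow _
  have hd : (X ^ (p + q) : K[X]).natDegree = p + q := natDegree_X_pow _
  have h1 := det_functional hN hd L (fun c f => by
    rw [hLa, map_mul, map_pow, aeval_X, mul_pow, mul_assoc, PowerSeries.coeff_X_pow_mul',
      if_neg (not_le.2 (ord_lt c))]) φ
  have h2 := det_functional hN hd (fun c => lcoeff K (ord c)) (fun c f => by
    rw [lcoeff_apply, coeff_X_pow_mul', if_neg (not_le.2 (ord_lt c))]) φ
  have h3 : (Matrix.of fun r c : Fin p ⊕ Fin q => lcoeff K (ord c) (X ^ ord r)) = 1 := by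
    ext r c
    simp only [Matrix.of_apply, lcoeff_apply, coeff_X_pow, Matrix.one_apply]
    exact if_congr ⟨fun h => (ord_injective h).symm, fun h => by rw [h]⟩ rfl rfl
  rw [h3, Matrix.det_one, mul_one] at h2
  have h4 : (Matrix.of fun r c : Fin p ⊕ Fin q => L c (X ^ ord r)).det =
      PowerSeries.constantCoeff U ^ (p + q).choose 2 := by
    rw [← Matrix.det_transpose, det_of_ord_triangular _ ord ord_injective]
    · rw [← prod_pow_val, ← Finset.prod_range fun i => PowerSeries.constantCoeff U ^ i,
        ← prod_ord fun i => PowerSeries.constantCoeff U ^ i]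
      refine Finset.prod_congr rfl fun r _ => ?_
      rw [Matrix.transpose_apply, Matrix.of_apply, hLa, map_pow, aeval_X, mul_pow,
        PowerSeries.coeff_X_pow_mul', if_pos le_rfl, Nat.sub_self,
        PowerSeries.coeff_zero_eq_constantCoeff_apply, map_pow]
    · intro r c hrc
      rw [Matrix.transpose_apply, Matrix.of_apply, hLa, map_pow, aeval_X, mul_pow,
        PowerSeries.coeff_X_pow_mul', if_neg (not_le.2 hrc)]
  rw [h4, ← h2] at h1
  simp only [lcoeff_apply] at h1
  rw [mul_comm (_ ^ _), ← h1]
  rfl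

/-- The Toeplitz matrix of a sequence. -/
def toeplitz (v : ℕ → ℚ) (s N : ℕ) : Matrix (Fin N) (Fin N) ℚ := Matrix.of fun p q => v (s + q - p)

/-- The Toeplitz matrix is bordered by s identity rows, the coefficients of 1, τ, …, τ^{s-1}.
Together with the rows τ^k w they are the `mono` family, the even positions first. The condition N ≤
s+1 keeps s + q - p from truncating. -/
lemma det_toeplitz_eq_det_mono (S : PowerSeries ℚ) (t w : ℚ[X]) (ht : aeval S t = PowerSeries.X)
    (s N : ℕ) (hs : N ≤ s + 1) :
    (toeplitz (fun m => PowerSeries.coeff m (aeval S w)) s N).det =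
      (Matrix.of fun r c : Fin s ⊕ Fin N =>
        PowerSeries.coeff (ord c) (aeval S (mono t w (blockKey r)))).det := by
  have h : (Matrix.of fun r c : Fin s ⊕ Fin N =>
        PowerSeries.coeff (ord c) (aeval S (mono t w (blockKey r)))) =
      Matrix.fromBlocks 1 0 (Matrix.of fun (k : Fin N) (j : Fin s) =>
        PowerSeries.coeff (j : ℕ) (PowerSeries.X ^ (k : ℕ) * aeval S w))
        (toeplitz (fun m => PowerSeries.coeff m (aeval S w)) s N) := by
    have h1 (k : ℕ) : aeval S (mono t w (2 * k)) = PowerSeries.X ^ k := by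
      rw [mono, Nat.mul_div_cancel_left _ (by norm_num), Nat.mul_mod_right, pow_zero, mul_one, map_pow,
        ht]
    have h2 (k : ℕ) : aeval S (mono t w (2 * k + 1)) = PowerSeries.X ^ k * aeval S w := by
      rw [mono, show (2 * k + 1) / 2 = k by omega, show (2 * k + 1) % 2 = 1 by omega, pow_one, map_mul,
        map_pow, ht]
    ext (r | r) (c | c)
    · simp only [blockKey, Sum.elim_inl, Matrix.of_apply, h1, PowerSeries.coeff_X_pow, ord_inl,
        Matrix.fromBlocks_apply₁₁, Matrix.one_apply]
      exact if_congr ⟨fun h => (Fin.ext h).symm, fun h => by rw [h]⟩ rfl rfl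
    · simp only [blockKey, Sum.elim_inl, Matrix.of_apply, h1, PowerSeries.coeff_X_pow, ord_inr,
        Matrix.fromBlocks_apply₁₂, Matrix.zero_apply]
      rw [if_neg (by omega)]
    · simp only [blockKey, Sum.elim_inr, Matrix.of_apply, h2, ord_inl, Matrix.fromBlocks_apply₂₁]
    · simp only [blockKey, Sum.elim_inr, Matrix.of_apply, h2, ord_inr, Matrix.fromBlocks_apply₂₂,
        toeplitz, PowerSeries.coeff_X_pow_mul']
      rw [if_pos (by omega)]
  rw [h, Matrix.det_fromBlocks_zero₁₂, Matrix.det_one, one_mul]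

lemma prod_pow_sub_half (c : ℚ) (N e : ℕ) (he : e ≤ 1) :
    ∏ r ∈ Finset.range (N + e + N), c ^ (r - r / 2) = c ^ ((N + e) * N) := by
  rw [← prod_range_unshuffle _ N e he, Finset.prod_pow_eq_pow_sum, Finset.prod_pow_eq_pow_sum, ← pow_add]
  have h1 (i : ℕ) : 2 * i - 2 * i / 2 = i := by omega
  have h2 (i : ℕ) : 2 * i + 1 - (2 * i + 1) / 2 = i + 1 := by omega
  simp only [h1, h2, Finset.sum_add_distrib, Finset.sum_range_id, Finset.sum_const, Finset.card_range]
  rw [← Nat.choose_two_right, ← Nat.choose_two_right]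
  have h3 := sq_eq_choose N
  congr 1
  obtain rfl | rfl : e = 0 ∨ e = 1 := by omega
  · simp only [add_zero, smul_eq_mul]
    nlinarith
  · rw [choose_two_succ]
    simp only [smul_eq_mul]
    nlinarith

/-- In the variable 3(Y-1), `cubicT` takes the value Y²(Y-1) = cτ. The Toeplitz determinant thus
becomes one of coefficients of `mono` as polynomials, then by triangularity one of `chain`, which
the hypothesis `hw` makes a Vandermonde determinant in squares. -/
lemma det_toeplitz (Y : PowerSeries ℚ) (c : ℚ) (hc : c ≠ 0) (hY0 : PowerSeries.constantCoeff Y = 1)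
    (hY : Y ^ 2 * (Y - 1) = PowerSeries.C c * PowerSeries.X) (N e : ℕ) (he : e ≤ 1) (w : ℚ[X])
    (x b d : ℕ → ℚ)
    (hw : ∀ r j, (chain cubicT w r).coeff j = x r * (∏ i ∈ Finset.range j, (x r ^ 2 - b i)) / d j) :
    (toeplitz (fun m => PowerSeries.coeff m (aeval (3 * (Y - 1)) w)) (N + e) N).det *
        ∏ r ∈ Finset.range (N + e + N), (3 : ℚ) ^ (r / 2) =
      c ^ ((N + e) * N) * ((-1) ^ (N + e).choose 2 * ((∏ r ∈ Finset.range (N + e + N), x r) *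
        vdm (fun r => x r ^ 2) (N + e + N) / ∏ j ∈ Finset.range (N + e + N), d j)) := by
  obtain ⟨V, hV⟩ : PowerSeries.X ∣ Y - 1 := by
    rw [PowerSeries.X_dvd_iff, map_sub, hY0, map_one, sub_self]
  have hX : (PowerSeries.X : PowerSeries ℚ) ≠ 0 := PowerSeries.X_ne_zero
  have hV0 : PowerSeries.constantCoeff V = c := by
    have h1 : Y ^ 2 * V = PowerSeries.C c := by
      apply mul_left_cancel₀ hX
      rw [mul_left_comm, ← hV, hY, mul_comm]
    have := congrArg PowerSeries.constantCoeff h1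
    simpa [hY0] using this
  have hS : 3 * (Y - 1) = PowerSeries.X * (3 * V) := by
    rw [hV]
    ring
  have hU0 : PowerSeries.constantCoeff (3 * V) = 3 * c := by
    rw [map_mul, hV0, map_ofNat]
  have ht : aeval (3 * (Y - 1)) (C c⁻¹ * cubicT) = PowerSeries.X := by
    have e1 : algebraMap ℚ (PowerSeries ℚ) = PowerSeries.C := rfl
    have h27 : PowerSeries.C (1 / 27 : ℚ) * 27 = (1 : PowerSeries ℚ) := by
      rw [← map_ofNat (PowerSeries.C (R := ℚ)) 27, ← map_mul]
      norm_num
    have hcc : PowerSeries.C (c⁻¹) * PowerSeries.C c = (1 : PowerSeries ℚ) := by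
      rw [← map_mul, inv_mul_cancel₀ hc, map_one]
    simp only [cubicT, map_mul, map_pow, map_add, aeval_X, aeval_C, map_ofNat, e1]
    linear_combination PowerSeries.C c⁻¹ * (Y ^ 2 * (Y - 1)) * h27 + PowerSeries.C c⁻¹ * hY +
      PowerSeries.X * hcc
  rw [det_toeplitz_eq_det_mono _ (C c⁻¹ * cubicT) w ht _ _ (by omega), hS, det_coeff_aeval, hU0]
  have h1 : (Matrix.of fun r j : Fin (N + e) ⊕ Fin N =>
      (mono (C c⁻¹ * cubicT) w (blockKey r)).coeff (ord j)) =
      Matrix.of fun r j => c⁻¹ ^ (blockKey r / 2) * (Matrix.of fun r j : Fin (N + e) ⊕ Fin N =>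
        (mono cubicT w (blockKey r)).coeff (ord j)) r j := by
    ext r j
    rw [Matrix.of_apply, Matrix.of_apply, Matrix.of_apply, mono, mono, mul_pow, ← C_pow, mul_assoc,
      coeff_C_mul]
  rw [h1, Matrix.det_mul_column, prod_blockKey (fun k => c⁻¹ ^ (k / 2)) N e he]
  have h2 := det_functional_triangular (fun c : Fin (N + e) ⊕ Fin N => lcoeff ℚ (ord c))
    (fun r => mono cubicT w (blockKey r)) (fun r => chain cubicT w (blockKey r))
    (fun r => monoLead (blockKey r)) blockKey blockKey_injective (fun r => by
      refine Submodule.span_mono ?_ (chain_sub_mem cubicT w (blockKey r))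
      rintro _ ⟨k, hk, rfl⟩
      have hk : k < blockKey r := hk
      have hlt : blockKey r < N + e + N := by
        rcases r with r | r <;> simp only [blockKey, Sum.elim_inl, Sum.elim_inr] <;> omega
      rcases Nat.even_or_odd' k with ⟨i, rfl | rfl⟩
      · exact ⟨Sum.inl ⟨i, by omega⟩, hk, rfl⟩
      · exact ⟨Sum.inr ⟨i, by omega⟩, hk, rfl⟩)
  simp only [lcoeff_apply, hw] at h2
  rw [det_odd_products_block x b d N e he, prod_blockKey monoLead N e he] at h2
  rw [h2, ← prod_pow_sub_half c N e he, Nat.add_assoc, ← prod_pow_val (3 * c),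
    ← Finset.prod_range fun i => (3 * c) ^ i]
  generalize (Matrix.of fun r j : Fin (N + e) ⊕ Fin N => (mono cubicT w (blockKey r)).coeff (ord j)).det = D
  -- All powers of 3 and c balance factor by factor in r, using 27 = 3³ for the leading coefficients
  -- of the chain.
  have h3 : (∏ i ∈ Finset.range (N + (e + N)), (3 * c) ^ i) *
      (∏ i ∈ Finset.range (N + (e + N)), c⁻¹ ^ (i / 2)) *
      (∏ r ∈ Finset.range (N + (e + N)), (3 : ℚ) ^ (r / 2)) =
      (∏ r ∈ Finset.range (N + (e + N)), c ^ (r - r / 2)) *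
      ∏ r ∈ Finset.range (N + (e + N)), monoLead r := by
    rw [← Finset.prod_mul_distrib, ← Finset.prod_mul_distrib, ← Finset.prod_mul_distrib]
    refine Finset.prod_congr rfl fun r _ => ?_
    rw [monoLead]
    have hr := Nat.div_add_mod r 2
    generalize r / 2 = k at *
    generalize r % 2 = m at *
    subst hr
    rw [show 2 * k + m - k = k + m by omega, show (27 : ℚ) = 3 ^ 3 by norm_num, mul_pow]
    have h5 : c ^ k * c⁻¹ ^ k = 1 := by rw [← mul_pow, mul_inv_cancel₀ hc, one_pow]
    simp only [pow_add, two_mul, ← pow_mul, show 3 * k = k + k + k by ring]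
    linear_combination (3 ^ k * 3 ^ k * 3 ^ m * c ^ k * c ^ m * 3 ^ k) * h5
  linear_combination D * h3

end Toeplitz

end SpecialPoly

namespace SpecialPoly

/-! ### From Vandermonde products to the numbers A_n and C_n. -/

section Numbers

/-- The normalized Vandermonde determinant of the squares of `1, 2, 4, 5, …`. -/
def detU (d : ℕ) : ℚ := (∏ r ∈ Finset.range d, (seqU r : ℚ)) * vdm (fun r => (seqU r : ℚ) ^ 2) d /
  ∏ j ∈ Finset.range d, ((2 * j + 1).factorial : ℚ)

/-- The normalized Vandermonde determinant of the squares of `1, 5, 7, 11, …`. -/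
def detE (d : ℕ) : ℚ := (∏ r ∈ Finset.range d, (seqE r : ℚ)) * vdm (fun r => (seqE r : ℚ) ^ 2) d /
  ∏ j ∈ Finset.range d, ((2 * j + 1).factorial * 4 ^ j : ℚ)

/-- The product `c(c+3)⋯(c+3(n-1))`. -/
def stepProd (c : ℚ) (n : ℕ) : ℚ := ∏ k ∈ Finset.range n, (3 * (k : ℚ) + c)

lemma stepProd_succ (c : ℚ) (n : ℕ) : stepProd c (n + 1) = stepProd c n * (3 * n + c) :=
  Finset.prod_range_succ _ _

lemma stepProd_add (c : ℚ) (a b : ℕ) :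
    (∏ k ∈ Finset.range a, (3 * ((a : ℚ) - 1 - k) + c)) *
      (∏ k ∈ Finset.range b, (3 * ((a : ℚ) + k) + c)) = stepProd c (a + b) := by
  rw [stepProd, Finset.prod_range_add, ← Finset.prod_range_reflect (fun k : ℕ => 3 * (k : ℚ) + c) a]
  congr 1
  · refine Finset.prod_congr rfl fun k hk => ?_
    have := Finset.mem_range.1 hk
    rw [Nat.cast_sub (by omega), Nat.cast_sub (by omega)]
    push_cast
    ring
  · push_cast
    rfl

lemma detU_succ (d : ℕ) : detU (d + 1) * (2 * d + 1).factorial =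
    detU d * (seqU d * ∏ i ∈ Finset.range d, ((seqU d : ℚ) ^ 2 - (seqU i : ℚ) ^ 2)) := by
  have h1 : (∏ j ∈ Finset.range d, ((2 * j + 1).factorial : ℚ)) ≠ 0 :=
    Finset.prod_ne_zero_iff.2 fun j _ => by positivity
  have h2 : ((2 * d + 1).factorial : ℚ) ≠ 0 := by positivity
  rw [detU, detU, Finset.prod_range_succ, vdm_succ, Finset.prod_range_succ]
  field_simp

lemma detE_succ (d : ℕ) : detE (d + 1) * ((2 * d + 1).factorial * 4 ^ d) =
    detE d * (seqE d * ∏ i ∈ Finset.range d, ((seqE d : ℚ) ^ 2 - (seqE i : ℚ) ^ 2)) := by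
  have h1 : (∏ j ∈ Finset.range d, ((2 * j + 1).factorial * 4 ^ j : ℚ)) ≠ 0 :=
    Finset.prod_ne_zero_iff.2 fun j _ => by positivity
  have h2 : ((2 * d + 1).factorial : ℚ) ≠ 0 := by positivity
  rw [detE, detE, Finset.prod_range_succ, vdm_succ, Finset.prod_range_succ]
  field_simp

lemma seqU_even (m : ℕ) : (seqU (2 * m) : ℚ) = 3 * m + 1 := by
  have : seqU (2 * m) = 3 * m + 1 := by simp only [seqU]; omega
  rw [this]
  push_cast
  ring

lemma seqU_odd (m : ℕ) : (seqU (2 * m + 1) : ℚ) = 3 * m + 2 := by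
  have : seqU (2 * m + 1) = 3 * m + 2 := by simp only [seqU]; omega
  rw [this]
  push_cast
  ring

lemma seqE_even (m : ℕ) : (seqE (2 * m) : ℚ) = 6 * m + 1 := by
  have : seqE (2 * m) = 6 * m + 1 := by simp only [seqE]; omega
  rw [this]
  push_cast
  ring

lemma seqE_odd (m : ℕ) : (seqE (2 * m + 1) : ℚ) = 6 * m + 5 := by
  have : seqE (2 * m + 1) = 6 * m + 5 := by simp only [seqE]; omega
  rw [this]
  push_cast
  ring

/-- Each difference of squares factors as (x-y)(x+y). Over the two residue classes modulo 3, the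
factors assemble into complete progressions with step 3. -/
lemma detU_even (m : ℕ) : detU (2 * m + 1) * (4 * m + 1).factorial =
    detU (2 * m) * ((3 * m + 1) * (stepProd 2 (2 * m) * stepProd 3 (2 * m))) := by
  have h := detU_succ (2 * m)
  rw [show 2 * (2 * m) + 1 = 4 * m + 1 by ring] at h
  rw [h, prod_range_two_mul, two_mul m, ← stepProd_add 2, ← stepProd_add 3, ← two_mul]
  simp only [seqU_even, seqU_odd, ← Finset.prod_mul_distrib]
  congr 2
  exact Finset.prod_congr rfl fun k _ => by ring

lemma detU_odd (m : ℕ) : detU (2 * m + 2) * (4 * m + 3).factorial =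
    detU (2 * m + 1) * ((3 * m + 2) * (stepProd 1 (2 * m + 1) * stepProd 3 (2 * m + 1))) := by
  have h := detU_succ (2 * m + 1)
  rw [show 2 * (2 * m + 1) + 1 = 4 * m + 3 by ring] at h
  have e1 : 2 * m + 1 = m + 1 + m := by ring
  have e2 : 2 * m + 1 = m + (m + 1) := by ring
  have h1 := stepProd_add 1 (m + 1) m
  have h2 := stepProd_add 3 m (m + 1)
  rw [← e1] at h1
  rw [← e2] at h2
  have hA : ∏ i ∈ Finset.range (m + 1), ((seqU (2 * m + 1) : ℚ) ^ 2 - (seqU (2 * i) : ℚ) ^ 2) =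
      (∏ k ∈ Finset.range (m + 1), (3 * (((m + 1 : ℕ) : ℚ) - 1 - k) + 1)) *
        ∏ k ∈ Finset.range (m + 1), (3 * ((m : ℚ) + k) + 3) := by
    rw [← Finset.prod_mul_distrib]
    refine Finset.prod_congr rfl fun k _ => ?_
    rw [seqU_even, seqU_odd]
    push_cast
    ring
  have hB : ∏ i ∈ Finset.range m, ((seqU (2 * m + 1) : ℚ) ^ 2 - (seqU (2 * i + 1) : ℚ) ^ 2) =
      (∏ k ∈ Finset.range m, (3 * ((m : ℚ) - 1 - k) + 3)) *
        ∏ k ∈ Finset.range m, (3 * (((m + 1 : ℕ) : ℚ) + k) + 1) := by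
    rw [← Finset.prod_mul_distrib]
    refine Finset.prod_congr rfl fun k _ => ?_
    rw [seqU_odd, seqU_odd]
    push_cast
    ring
  rw [h, Finset.prod_range_succ, prod_range_two_mul, mul_right_comm,
    ← Finset.prod_range_succ (fun i => (seqU (2 * m + 1) : ℚ) ^ 2 - (seqU (2 * i) : ℚ) ^ 2), ← h1, ← h2,
    hA, hB, seqU_odd]
  ring

lemma detE_even (m : ℕ) : detE (2 * m + 1) * (4 * m + 1).factorial =
    detE (2 * m) * ((6 * m + 1) * (stepProd 1 (2 * m) * stepProd 3 (2 * m))) := by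
  have h := detE_succ (2 * m)
  rw [show 2 * (2 * m) + 1 = 4 * m + 1 by ring] at h
  have h1 := stepProd_add 1 m m
  have h2 := stepProd_add 3 m m
  rw [← two_mul] at h1 h2
  have hA : ∏ i ∈ Finset.range m, ((seqE (2 * m) : ℚ) ^ 2 - (seqE (2 * i) : ℚ) ^ 2) =
      4 ^ m * ((∏ k ∈ Finset.range m, (3 * ((m : ℚ) - 1 - k) + 3)) *
        ∏ k ∈ Finset.range m, (3 * ((m : ℚ) + k) + 1)) := by
    have h4 : (4 : ℚ) ^ m = ∏ _k ∈ Finset.range m, 4 := by simp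
    rw [h4, ← Finset.prod_mul_distrib, ← Finset.prod_mul_distrib]
    refine Finset.prod_congr rfl fun k _ => ?_
    rw [seqE_even m, seqE_even k]
    ring
  have hB : ∏ i ∈ Finset.range m, ((seqE (2 * m) : ℚ) ^ 2 - (seqE (2 * i + 1) : ℚ) ^ 2) =
      4 ^ m * ((∏ k ∈ Finset.range m, (3 * ((m : ℚ) - 1 - k) + 1)) *
        ∏ k ∈ Finset.range m, (3 * ((m : ℚ) + k) + 3)) := by
    have h4 : (4 : ℚ) ^ m = ∏ _k ∈ Finset.range m, 4 := by simp
    rw [h4, ← Finset.prod_mul_distrib, ← Finset.prod_mul_distrib]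
    refine Finset.prod_congr rfl fun k _ => ?_
    rw [seqE_even, seqE_odd]
    ring
  have h4 : (4 : ℚ) ^ (2 * m) ≠ 0 := by positivity
  apply mul_right_cancel₀ h4
  rw [mul_assoc, h, prod_range_two_mul, ← h1, ← h2, hA, hB, seqE_even, two_mul, pow_add]
  ring

lemma detE_odd (m : ℕ) : detE (2 * m + 2) * (4 * m + 3).factorial =
    detE (2 * m + 1) * ((6 * m + 5) * (stepProd 2 (2 * m + 1) * stepProd 3 (2 * m + 1))) := by
  have h := detE_succ (2 * m + 1)
  rw [show 2 * (2 * m + 1) + 1 = 4 * m + 3 by ring] at h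
  have e1 : 2 * m + 1 = m + 1 + m := by ring
  have e2 : 2 * m + 1 = m + (m + 1) := by ring
  have h1 := stepProd_add 2 (m + 1) m
  have h2 := stepProd_add 3 m (m + 1)
  rw [← e1] at h1
  rw [← e2] at h2
  have hA : ∏ i ∈ Finset.range (m + 1), ((seqE (2 * m + 1) : ℚ) ^ 2 - (seqE (2 * i) : ℚ) ^ 2) =
      4 ^ (m + 1) * ((∏ k ∈ Finset.range (m + 1), (3 * (((m + 1 : ℕ) : ℚ) - 1 - k) + 2)) *
        ∏ k ∈ Finset.range (m + 1), (3 * ((m : ℚ) + k) + 3)) := by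
    have h4 : (4 : ℚ) ^ (m + 1) = ∏ _k ∈ Finset.range (m + 1), 4 := by simp
    rw [h4, ← Finset.prod_mul_distrib, ← Finset.prod_mul_distrib]
    refine Finset.prod_congr rfl fun k _ => ?_
    rw [seqE_odd, seqE_even]
    push_cast
    ring
  have hB : ∏ i ∈ Finset.range m, ((seqE (2 * m + 1) : ℚ) ^ 2 - (seqE (2 * i + 1) : ℚ) ^ 2) =
      4 ^ m * ((∏ k ∈ Finset.range m, (3 * ((m : ℚ) - 1 - k) + 3)) *
        ∏ k ∈ Finset.range m, (3 * (((m + 1 : ℕ) : ℚ) + k) + 2)) := by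
    have h4 : (4 : ℚ) ^ m = ∏ _k ∈ Finset.range m, 4 := by simp
    rw [h4, ← Finset.prod_mul_distrib, ← Finset.prod_mul_distrib]
    refine Finset.prod_congr rfl fun k _ => ?_
    rw [seqE_odd m, seqE_odd k]
    push_cast
    ring
  have h4 : (4 : ℚ) ^ (2 * m + 1) ≠ 0 := by positivity
  apply mul_right_cancel₀ h4
  rw [mul_assoc, h, Finset.prod_range_succ, prod_range_two_mul, mul_right_comm,
    ← Finset.prod_range_succ (fun i => (seqE (2 * m + 1) : ℚ) ^ 2 - (seqE (2 * i) : ℚ) ^ 2), ← h1, ← h2,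
    hA, hB, seqE_odd]
  ring

lemma factorial_eq_stepProd (n : ℕ) : ((3 * n + 1).factorial : ℚ) =
    stepProd 1 n * stepProd 2 n * stepProd 3 n * (3 * n + 1) := by
  induction n with
  | zero => simp [stepProd]
  | succ n ih =>
    rw [stepProd_succ, stepProd_succ, stepProd_succ, show 3 * (n + 1) + 1 = 3 * n + 1 + 1 + 1 + 1 by ring,
      Nat.factorial_succ, Nat.factorial_succ, Nat.factorial_succ]
    push_cast
    rw [ih]
    ring

lemma three_pow_mul_factorial (n : ℕ) : (3 : ℚ) ^ n * n.factorial = stepProd 3 n := by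
  induction n with
  | zero => simp [stepProd]
  | succ n ih =>
    rw [stepProd_succ, ← ih, Nat.factorial_succ, pow_succ]
    push_cast
    ring

/-- Passing from n to n+1 drops n! from the denominator and adds (2n)! and (2n+1)!. -/
lemma A_succ (n : ℕ) : ThreeColour.A (n + 1) * ((2 * n).factorial * (2 * n + 1).factorial) =
    ThreeColour.A n * ((3 * n + 1).factorial * n.factorial) := by
  have h1 : (∏ k ∈ Finset.range (n + 1), ((n + 1 + k).factorial : ℚ)) * n.factorial =
      (∏ k ∈ Finset.range n, ((n + k).factorial : ℚ)) * ((2 * n).factorial * (2 * n + 1).factorial) := by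
    have h2 := Finset.prod_range_succ' (fun k => ((n + k).factorial : ℚ)) (n + 1)
    rw [Finset.prod_range_succ, Finset.prod_range_succ, add_zero, ← two_mul, ← add_assoc, ← two_mul] at h2
    rw [← mul_assoc, h2]
    congr 1
    refine Finset.prod_congr rfl fun k _ => ?_
    rw [show n + 1 + k = n + (k + 1) by ring]
  have h3 : (∏ k ∈ Finset.range (n + 1), ((n + 1 + k).factorial : ℚ)) ≠ 0 :=
    Finset.prod_ne_zero_iff.2 fun j _ => by positivity
  have h4 : (∏ k ∈ Finset.range n, ((n + k).factorial : ℚ)) ≠ 0 :=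
    Finset.prod_ne_zero_iff.2 fun j _ => by positivity
  rw [ThreeColour.A, ThreeColour.A, Finset.prod_range_succ, div_mul_eq_mul_div, div_mul_eq_mul_div,
    div_eq_div_iff h3 h4]
  linear_combination (-(∏ k ∈ Finset.range n, ((3 * k + 1).factorial : ℚ)) * (3 * n + 1).factorial) * h1

lemma C_succ (n : ℕ) : ThreeColour.C (n + 1) * ((3 * n + 1) * ((2 * n).factorial * (2 * n + 1).factorial)) =
    ThreeColour.C n * ((3 * n + 2) * ((3 * n + 1).factorial * n.factorial)) := by
  have h1 : (∏ k ∈ Finset.range n, (3 * (k : ℚ) + 1)) ≠ 0 :=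
    Finset.prod_ne_zero_iff.2 fun j _ => by positivity
  have h2 : (3 * (n : ℚ) + 1) ≠ 0 := by positivity
  rw [ThreeColour.C, ThreeColour.C, Finset.prod_range_succ, Finset.prod_range_succ]
  have := A_succ n
  field_simp
  linear_combination this

lemma A_step (n : ℕ) : ThreeColour.A (n + 2) * 3 ^ (n + 1).choose 2 *
      ((2 * n + 2).factorial * (2 * n + 3).factorial) =
    ThreeColour.A (n + 1) * 3 ^ n.choose 2 *
      (stepProd 1 (n + 1) * stepProd 2 (n + 1) * stepProd 3 (n + 1) * (3 * n + 4) * (n + 1) *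
        stepProd 3 n) := by
  have h := A_succ (n + 1)
  rw [factorial_eq_stepProd, Nat.factorial_succ n] at h
  rw [choose_two_succ, pow_add]
  have h3 := three_pow_mul_factorial n
  push_cast at h
  linear_combination 3 ^ n.choose 2 * 3 ^ n * h + (ThreeColour.A (n + 1) * 3 ^ n.choose 2 *
      (stepProd 1 (n + 1) * stepProd 2 (n + 1) * stepProd 3 (n + 1) * (3 * n + 4) * (n + 1))) * h3

lemma C_step (n : ℕ) : ThreeColour.C (n + 2) * 3 ^ (n + 1).choose 2 *
      ((2 * n + 2).factorial * (2 * n + 3).factorial) =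
    ThreeColour.C (n + 1) * 3 ^ n.choose 2 *
      (stepProd 1 (n + 1) * stepProd 2 (n + 1) * stepProd 3 (n + 1) * (3 * n + 5) * (n + 1) *
        stepProd 3 n) := by
  have h := C_succ (n + 1)
  rw [factorial_eq_stepProd, Nat.factorial_succ n] at h
  rw [choose_two_succ, pow_add]
  have h3 := three_pow_mul_factorial n
  have h4 : (3 * (n : ℚ) + 4) ≠ 0 := by positivity
  push_cast at h
  apply mul_right_cancel₀ h4
  linear_combination 3 ^ n.choose 2 * 3 ^ n * h + (ThreeColour.C (n + 1) * 3 ^ n.choose 2 *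
      (stepProd 1 (n + 1) * stepProd 2 (n + 1) * stepProd 3 (n + 1) * (3 * n + 4) * (3 * n + 5) *
        (n + 1))) * h3

/-- One factor stays fixed while the other advances by two, so each step uses an even and an odd
ratio of the same sequence; their product is the ratio of consecutive A's or C's. -/
lemma detU_detE_step_odd (m : ℕ) :
    (detE (2 * m + 1) * detU (2 * m) = ThreeColour.A (2 * m + 1) * 3 ^ (2 * m).choose 2 →
      2 * (detU (2 * m + 2) * detE (2 * m + 1)) =
        ThreeColour.A (2 * m + 2) * 3 ^ (2 * m + 1).choose 2) ∧
    (2 * (detU (2 * m + 1) * detE (2 * m)) = ThreeColour.C (2 * m + 1) * 3 ^ (2 * m).choose 2 →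
      detE (2 * m + 2) * detU (2 * m + 1) =
        ThreeColour.C (2 * m + 2) * 3 ^ (2 * m + 1).choose 2) := by
  have hA := A_step (2 * m)
  have hC := C_step (2 * m)
  rw [show 2 * (2 * m) + 2 = 4 * m + 1 + 1 by ring, Nat.factorial_succ (4 * m + 1),
    show 2 * (2 * m) + 3 = 4 * m + 3 by ring] at hA hC
  have h1 := detU_even m
  have h2 := detU_odd m
  have h3 := detE_even m
  have h4 := detE_odd m
  have e1 := stepProd_succ 1 (2 * m)
  have e2 := stepProd_succ 2 (2 * m)
  have f1 : ((4 * m + 1).factorial : ℚ) ≠ 0 := by positivity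
  have f2 : ((4 * m + 3).factorial : ℚ) ≠ 0 := by positivity
  have f3 : (4 * (m : ℚ) + 2) ≠ 0 := by positivity
  push_cast at hA hC e1 e2
  generalize ((4 * m + 1).factorial : ℚ) = F1 at *
  generalize ((4 * m + 3).factorial : ℚ) = F2 at *
  constructor
  · intro h
    apply mul_right_cancel₀ (mul_ne_zero (mul_ne_zero f1 f2) f3)
    rw [← h] at hA
    rw [e2] at hA
    linear_combination -hA + 2 * F1 * (4 * m + 2) * detE (2 * m + 1) * h2 +
      2 * (4 * m + 2) * detE (2 * m + 1) * (3 * m + 2) * stepProd 1 (2 * m + 1) *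
        stepProd 3 (2 * m + 1) * h1
  · intro h
    apply mul_right_cancel₀ (mul_ne_zero (mul_ne_zero f1 f2) f3)
    rw [← h] at hC
    rw [e1] at hC
    linear_combination -hC + F1 * (4 * m + 2) * detU (2 * m + 1) * h4 +
      (4 * m + 2) * detU (2 * m + 1) * (6 * m + 5) * stepProd 2 (2 * m + 1) *
        stepProd 3 (2 * m + 1) * h3

lemma detU_detE_step_even (m : ℕ) :
    (2 * (detU (2 * m + 2) * detE (2 * m + 1)) =
        ThreeColour.A (2 * m + 2) * 3 ^ (2 * m + 1).choose 2 →
      detE (2 * m + 3) * detU (2 * m + 2) = ThreeColour.A (2 * m + 3) * 3 ^ (2 * m + 2).choose 2) ∧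
    (detE (2 * m + 2) * detU (2 * m + 1) = ThreeColour.C (2 * m + 2) * 3 ^ (2 * m + 1).choose 2 →
      2 * (detU (2 * m + 3) * detE (2 * m + 2)) =
        ThreeColour.C (2 * m + 3) * 3 ^ (2 * m + 2).choose 2) := by
  have hA := A_step (2 * m + 1)
  have hC := C_step (2 * m + 1)
  rw [show 2 * (2 * m + 1) + 2 = 4 * m + 3 + 1 by ring, Nat.factorial_succ (4 * m + 3),
    show 2 * (2 * m + 1) + 3 = 4 * m + 5 by ring, show 2 * m + 1 + 2 = 2 * m + 3 by ring,
    show 2 * m + 1 + 1 = 2 * m + 2 by ring] at hA hC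
  have h1 := detU_even (m + 1)
  have h2 := detU_odd m
  have h3 := detE_even (m + 1)
  have h4 := detE_odd m
  rw [show 2 * (m + 1) + 1 = 2 * m + 3 by ring, show 4 * (m + 1) + 1 = 4 * m + 5 by ring,
    show 2 * (m + 1) = 2 * m + 2 by ring] at h1 h3
  have e1 := stepProd_succ 1 (2 * m + 1)
  have e2 := stepProd_succ 2 (2 * m + 1)
  have f1 : ((4 * m + 3).factorial : ℚ) ≠ 0 := by positivity
  have f2 : ((4 * m + 5).factorial : ℚ) ≠ 0 := by positivity
  have f3 : (4 * (m : ℚ) + 4) ≠ 0 := by positivity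
  rw [show 2 * m + 1 + 1 = 2 * m + 2 by ring] at e1 e2
  push_cast at hA hC e1 e2 h1 h3
  generalize ((4 * m + 3).factorial : ℚ) = F1 at *
  generalize ((4 * m + 5).factorial : ℚ) = F2 at *
  constructor
  · intro h
    apply mul_right_cancel₀ (mul_ne_zero (mul_ne_zero f1 f2) f3)
    rw [← h] at hA
    rw [e2] at hA
    rw [e1] at hA h3
    linear_combination -hA + F1 * (4 * m + 4) * detU (2 * m + 2) * h3 +
      (4 * m + 4) * detU (2 * m + 2) * (6 * m + 7) * (stepProd 1 (2 * m + 1) * (3 * (2 * m + 1) + 1)) *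
        stepProd 3 (2 * m + 2) * h4
  · intro h
    apply mul_right_cancel₀ (mul_ne_zero (mul_ne_zero f1 f2) f3)
    rw [← h] at hC
    rw [e1] at hC
    rw [e2] at hC h1
    linear_combination -hC + 2 * F1 * (4 * m + 4) * detE (2 * m + 2) * h1 +
      2 * (4 * m + 4) * detE (2 * m + 2) * (3 * m + 4) *
        (stepProd 2 (2 * m + 1) * (3 * (2 * m + 1) + 2)) * stepProd 3 (2 * m + 2) * h2

/-- A zigzag induction: the two step lemmas advance the two factors alternately, and the companion
identities are recovered in `detU_mul_detE`. -/
lemma detE_mul_detU (m : ℕ) :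
    detE (2 * m + 1) * detU (2 * m) = ThreeColour.A (2 * m + 1) * 3 ^ (2 * m).choose 2 ∧
    2 * (detU (2 * m + 1) * detE (2 * m)) = ThreeColour.C (2 * m + 1) * 3 ^ (2 * m).choose 2 := by
  induction m with
  | zero => norm_num [detE, detU, ThreeColour.A, ThreeColour.C, vdm, seqU, seqE]
  | succ m ih =>
    have h1 := detU_detE_step_odd m
    have h2 := detU_detE_step_even m
    exact ⟨h2.1 (h1.1 ih.1), h2.2 (h1.2 ih.2)⟩

lemma detU_mul_detE (m : ℕ) :
    2 * (detU (2 * m + 2) * detE (2 * m + 1)) = ThreeColour.A (2 * m + 2) * 3 ^ (2 * m + 1).choose 2 ∧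
    detE (2 * m + 2) * detU (2 * m + 1) = ThreeColour.C (2 * m + 2) * 3 ^ (2 * m + 1).choose 2 :=
  ⟨(detU_detE_step_odd m).1 (detE_mul_detU m).1, (detU_detE_step_odd m).2 (detE_mul_detU m).2⟩

end Numbers

end SpecialPoly

namespace SpecialPoly

/-! ### The cleared determinant at ζ = -2 and ζ = -1/2. -/

section DegenerateValues

/-- Reversing the columns makes the matrix Toeplitz. -/
lemma hankel_rev (v : ℕ → ℚ) (h e : ℕ) :
    (Matrix.of fun p q : Fin (h + e) => v (h + e + h - p - q)).det =
      (-1) ^ (h + e).choose 2 * (toeplitz v (h + 1) (h + e)).det := by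
  have h1 := det_rev (Matrix.of fun p q : Fin (h + e) => v (h + e + h - p - q))
  have h2 : (Matrix.of fun i j : Fin (h + e) =>
      (Matrix.of fun p q : Fin (h + e) => v (h + e + h - p - q)) i (Fin.rev j)) =
      toeplitz v (h + 1) (h + e) := by
    ext i j
    simp only [Matrix.of_apply, toeplitz, Fin.val_rev]
    congr 1
    omega
  rw [h2] at h1
  rw [h1, ← mul_assoc, neg_one_pow_mul_self, one_mul]

lemma hankel_rev' (v : ℕ → ℚ) (h e : ℕ) :
    (Matrix.of fun p q : Fin h => v (e + p + q + 1)).det =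
      (-1) ^ h.choose 2 * (toeplitz v (h + e) h).det := by
  have h1 := det_rev (Matrix.of fun p q : Fin h => v (e + p + q + 1))
  have h2 : (Matrix.of fun i j : Fin h =>
      (Matrix.of fun p q : Fin h => v (e + p + q + 1)) i (Fin.rev j)) =
      (toeplitz v (h + e) h).transpose := by
    ext i j
    simp only [Matrix.of_apply, toeplitz, Fin.val_rev, Matrix.transpose_apply]
    congr 1
    omega
  rw [h2, Matrix.det_transpose] at h1
  rw [h1, ← mul_assoc, neg_one_pow_mul_self, one_mul]

/-- In the upper right block every entry carries positive powers of both a and ζ+2, so it vanishes,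
as does the corner term of the lower right block. -/
lemma eval_det_fullMat (h e : ℕ) (he : e ≤ 1) (z : ℚ) (hz : (X + 2 : ℚ[X]).eval z = 0 ∨ aPoly.eval z = 0) :
    (fullMat h e).det.eval z =
      (Matrix.of fun p q : Fin (h + e) => -(alpha (h + e + h - p - q)).eval z).det *
        (Matrix.of fun p q : Fin h => (beta (e + p + q)).eval z).det := by
  have h0 : (fullMat h e).map (evalRingHom z) = Matrix.fromBlocks
      (Matrix.of fun p q : Fin (h + e) => -(alpha (h + e + h - p - q)).eval z) 0
      (Matrix.of fun p q => (fullMat h e (Sum.inr p) (Sum.inl q)).eval z)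
      (Matrix.of fun p q : Fin h => (beta (e + p + q)).eval z) := by
    ext (p | p) (q | q)
    · simp [fullMat]
    · have hp := p.2
      have hq := q.2
      simp only [fullMat, Matrix.map_apply, Matrix.fromBlocks_apply₁₂, Matrix.of_apply,
        coe_evalRingHom, Matrix.zero_apply]
      have e1 : (if h ≤ (p : ℕ) + q then aPoly ^ (3 * (h - p) + e) * (X + 2) ^ (3 * (h - p) + 2 * e - 1) *
          beta (p + q - h) else 0).eval z = 0 := by
        split_ifs with hc
        · rw [eval_mul, eval_mul, eval_pow, eval_pow]
          rcases hz with hz | hz <;> rw [hz, zero_pow (by omega)] <;> simp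
        · simp
      have e2 : (if (p : ℕ) + q ≤ h then aPoly ^ (3 * (q : ℕ) + 1 + e) * (X + 2) ^ (3 * (q : ℕ) + 1 + 2 * e) *
          alpha (h - p - q) else 0).eval z = 0 := by
        split_ifs with hc
        · rw [eval_mul, eval_mul, eval_pow, eval_pow]
          rcases hz with hz | hz <;> rw [hz, zero_pow (by omega)] <;> simp
        · simp
      rw [eval_sub, e1, e2, sub_zero]
    · simp
    · simp only [fullMat, Matrix.map_apply, Matrix.fromBlocks_apply₂₂, Matrix.of_apply, coe_evalRingHom]
      have e1 : (if e + (p : ℕ) + q = 0 then aPoly * (X + 2) ^ 2 * alpha 0 else 0).eval z = 0 := by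
        split_ifs with hc
        · rw [eval_mul, eval_mul, eval_pow]
          rcases hz with hz | hz <;> rw [hz] <;> simp
        · simp
      rw [eval_sub, e1, sub_zero]
  rw [← coe_evalRingHom, RingHom.map_det, RingHom.mapMatrix_apply, h0, Matrix.det_fromBlocks_zero₁₂]
  simp only [coe_evalRingHom]

lemma det_toeplitz_U (Y : PowerSeries ℚ) (c : ℚ) (hc : c ≠ 0) (hY0 : PowerSeries.constantCoeff Y = 1)
    (hY : Y ^ 2 * (Y - 1) = PowerSeries.C c * PowerSeries.X) (N e : ℕ) (he : e ≤ 1) :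
    (toeplitz (fun m => PowerSeries.coeff m Y) (N + e) N).det *
        ∏ r ∈ Finset.range (N + e + N), (3 : ℚ) ^ (r / 2) =
      c ^ ((N + e) * N) * ((-1) ^ (N + e).choose 2 * detU (N + e + N)) := by
  have h := det_toeplitz Y c hc hY0 hY N e he (C (1 / 3) * (X + 3)) (fun r => seqU r)
    (fun i => ((i : ℚ) + 1) ^ 2) (fun j => ((2 * j + 1).factorial : ℚ)) (fun r j => by
      rw [chain_eq_cheb, eq_div_iff (by positivity), coeff_cheb_mul_factorial])
  have hw : aeval (3 * (Y - 1)) (C (1 / 3 : ℚ) * (X + 3)) = Y := by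
    have e1 : algebraMap ℚ (PowerSeries ℚ) = PowerSeries.C := rfl
    have h3 : PowerSeries.C (1 / 3 : ℚ) * 3 = (1 : PowerSeries ℚ) := by
      rw [← map_ofNat (PowerSeries.C (R := ℚ)) 3, ← map_mul]
      norm_num
    simp only [map_mul, map_add, aeval_X, aeval_C, map_ofNat, e1]
    linear_combination Y * h3
  rw [hw] at h
  exact h

lemma det_toeplitz_E (Y : PowerSeries ℚ) (c : ℚ) (hc : c ≠ 0) (hY0 : PowerSeries.constantCoeff Y = 1)
    (hY : Y ^ 2 * (Y - 1) = PowerSeries.C c * PowerSeries.X) (N e : ℕ) (he : e ≤ 1) :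
    (toeplitz (fun m => PowerSeries.coeff m (3 * Y ^ 2 - Y)) (N + e) N).det *
        ∏ r ∈ Finset.range (N + e + N), (3 : ℚ) ^ (r / 2) =
      c ^ ((N + e) * N) * ((-1) ^ (N + e).choose 2 * detE (N + e + N)) := by
  have h := det_toeplitz Y c hc hY0 hY N e he (C (1 / 3) * ((X + 2) * (X + 3))) (fun r => seqE r)
    (fun i => (2 * (i : ℚ) + 1) ^ 2) (fun j => ((2 * j + 1).factorial * 4 ^ j : ℚ)) (fun r j => by
      have hE : (seqE r : ℚ) = 2 * (seqE r / 2 : ℕ) + 1 := by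
        have : seqE r = 2 * (seqE r / 2) + 1 := by simp only [seqE]; omega
        exact_mod_cast this
      rw [chain_eq_cheb_add_cheb, eq_div_iff (by positivity), coeff_cheb_add_cheb_mul_factorial, hE])
  have hw : aeval (3 * (Y - 1)) (C (1 / 3 : ℚ) * ((X + 2) * (X + 3))) = 3 * Y ^ 2 - Y := by
    have e1 : algebraMap ℚ (PowerSeries ℚ) = PowerSeries.C := rfl
    have h3 : PowerSeries.C (1 / 3 : ℚ) * 3 = (1 : PowerSeries ℚ) := by
      rw [← map_ofNat (PowerSeries.C (R := ℚ)) 3, ← map_mul]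
      norm_num
    simp only [map_mul, map_add, aeval_X, aeval_C, map_ofNat, e1]
    linear_combination (3 * Y ^ 2 - Y) * h3
  rw [hw] at h
  exact h

lemma constantCoeff_map_serY (ev : ℚ[X] →+* ℚ) :
    PowerSeries.constantCoeff (PowerSeries.map ev serY) = 1 := by
  rw [serY]
  simp

/-- The reciprocal of `serZ` at a root of `(ζ + 2)(2ζ + 1)`. -/
lemma exists_recip_serZ (z : ℚ) (hz0 : z ≠ 0) (hz : (aPoly * (X + 2)).eval z = 0) :
    ∃ Y : PowerSeries ℚ, PowerSeries.constantCoeff Y = 1 ∧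
      Y ^ 2 * (Y - 1) = PowerSeries.C (-z ^ 2) * PowerSeries.X ∧
      PowerSeries.X * PowerSeries.map (evalRingHom z) serZ ^ 2 = 1 - Y ∧
      PowerSeries.C z * (PowerSeries.X * PowerSeries.map (evalRingHom z) serZ) = (1 - Y) * Y := by
  set Z := PowerSeries.map (evalRingHom z) serZ with hZ
  have hZeq : Z = PowerSeries.C z + PowerSeries.X * (Z ^ 2 * Z) := by
    have := congrArg (PowerSeries.map (evalRingHom z)) serZ_spec
    simp only [map_add, map_mul, PowerSeries.map_C, PowerSeries.map_X, map_sub, ← hZ, coe_evalRingHom,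
      eval_X, map_pow] at this
    rw [← map_add PowerSeries.C, ← map_mul PowerSeries.C] at this
    rw [eval_mul, eval_add, eval_X] at hz
    rwa [hz, map_zero, sub_zero] at this
  have hZ0 : PowerSeries.constantCoeff Z = z := by
    have := congrArg PowerSeries.constantCoeff hZeq
    simpa using this
  have hZi : Z * Z⁻¹ = 1 := PowerSeries.mul_inv_cancel _ (by rw [hZ0]; exact hz0)
  have hzi : PowerSeries.C z * PowerSeries.C z⁻¹ = (1 : PowerSeries ℚ) := by
    rw [← map_mul, mul_inv_cancel₀ hz0, map_one]
  -- Z = z + σZ³ divided by Z; the reciprocal z/Z then satisfies a cubic of the same form as Y.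
  have h1 : PowerSeries.X * Z ^ 2 = 1 - PowerSeries.C z * Z⁻¹ := by
    linear_combination (1 - PowerSeries.X * Z ^ 2) * hZi - Z⁻¹ * hZeq
  refine ⟨PowerSeries.C z * Z⁻¹, ?_, ?_, h1, ?_⟩
  · rw [map_mul, PowerSeries.constantCoeff_inv, hZ0, PowerSeries.constantCoeff_C,
      mul_inv_cancel₀ hz0]
  · rw [map_neg, map_pow]
    linear_combination (PowerSeries.C z * Z⁻¹) ^ 2 * h1 -
      PowerSeries.C z ^ 2 * PowerSeries.X * (Z * Z⁻¹ + 1) * hZi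
  · linear_combination (PowerSeries.C z * Z⁻¹) * h1 - PowerSeries.C z * PowerSeries.X * Z * hZi

/-- The two Toeplitz determinants come with these two normalizations; their product is the power of
3 accompanying A and C. -/
lemma prod_three_pow_half (n : ℕ) :
    (∏ r ∈ Finset.range (n + 1), (3 : ℚ) ^ (r / 2)) * ∏ r ∈ Finset.range n, (3 : ℚ) ^ (r / 2) =
      3 ^ n.choose 2 := by
  induction n with
  | zero => simp
  | succ n ih =>
    rw [Finset.prod_range_succ _ (n + 1), Finset.prod_range_succ _ n, choose_two_succ, pow_add, ← ih,
      Finset.prod_range_succ _ n]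
    have : (3 : ℚ) ^ n = 3 ^ ((n + 1) / 2) * 3 ^ (n / 2) := by
      rw [← pow_add]
      congr 1
      omega
    rw [this]
    ring

/-- At ζ = -2 the cubic for Y loses its linear term and -α has generating function 3Y²-Y. Since
(1+ζ)(2+ζ) = 0, β has generating function Z², so β_m is minus the next coefficient of the reciprocal
series Y'. -/
lemma det_fullMat_neg_two (h e : ℕ) (he : e ≤ 1) :
    (fullMat h e).det.eval (-2) * 3 ^ (h + e + h).choose 2 =
      ((-1) ^ (h + e).choose 2 * (2 ^ ((h + 1) * (h + e)) * ((-1) ^ (h + 1).choose 2 *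
        detE (h + e + h + 1)))) *
      ((-1) ^ h * ((-1) ^ h.choose 2 * ((-4) ^ ((h + e) * h) * ((-1) ^ (h + e).choose 2 *
        detU (h + e + h))))) := by
  rw [eval_det_fullMat h e he (-2) (Or.inl (by norm_num))]
  set Y := PowerSeries.map (evalRingHom (-2 : ℚ)) serY with hYdef
  have hY0 : PowerSeries.constantCoeff Y = 1 := constantCoeff_map_serY _
  have ha : aPoly.eval (-2) = -3 := by norm_num [aPoly]
  have hY : Y ^ 2 * (Y - 1) = PowerSeries.C 2 * PowerSeries.X := by
    have := congrArg (PowerSeries.map (evalRingHom (-2 : ℚ))) serY_spec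
    simp only [map_add, map_mul, PowerSeries.map_C, PowerSeries.map_X, map_sub, ← hYdef,
      coe_evalRingHom, eval_X, map_pow, map_one] at this
    rw [this, eval_ofNat, map_neg, map_ofNat]
    ring
  obtain ⟨Y', hY0', hY', hZ1, hZ2⟩ := exists_recip_serZ (-2) (by norm_num) (by simp)
  have hα (m : ℕ) : -(alpha m).eval (-2) = PowerSeries.coeff m (3 * Y ^ 2 - Y) := by
    rw [alpha, ← coe_evalRingHom, ← PowerSeries.coeff_map, ← map_neg]
    congr 1
    simp only [map_mul, map_sub, PowerSeries.map_C, ← hYdef, coe_evalRingHom, ha]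
    have : (1 + X : ℚ[X]).eval (-2) = -1 := by norm_num
    rw [this, map_neg, map_neg, map_one, map_ofNat]
    ring
  have hβ (m : ℕ) : (beta m).eval (-2) = -PowerSeries.coeff (m + 1) Y' := by
    rw [beta, ← coe_evalRingHom, ← PowerSeries.coeff_map]
    simp only [map_mul, map_sub, PowerSeries.map_C, coe_evalRingHom, eval_add, eval_X,
      eval_ofNat, neg_add_cancel, mul_zero, map_zero, sub_zero]
    rw [← sq, ← PowerSeries.coeff_succ_X_mul, hZ1, map_sub, PowerSeries.coeff_one, if_neg (by omega),
      zero_sub]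
  simp only [hα, hβ]
  have h1 := det_toeplitz_E Y 2 two_ne_zero hY0 hY (h + e) (1 - e) (by omega)
  have h2 := det_toeplitz_U Y' (-(-2) ^ 2) (by norm_num) hY0' hY' h e he
  rw [show h + e + (1 - e) = h + 1 by omega, show h + 1 + (h + e) = h + e + h + 1 by ring] at h1
  have h3 : (Matrix.of fun p q : Fin h => -PowerSeries.coeff (e + p + q + 1) Y') =
      -(Matrix.of fun p q : Fin h => PowerSeries.coeff (e + p + q + 1) Y') := rfl
  rw [h3, Matrix.det_neg, Fintype.card_fin, hankel_rev (fun m => PowerSeries.coeff m (3 * Y ^ 2 - Y)),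
    hankel_rev' (fun m => PowerSeries.coeff m Y'), ← prod_three_pow_half, ← h1]
  rw [show (-(-2) ^ 2 : ℚ) = -4 by norm_num] at h2
  rw [← h2]
  ring

/-- At ζ = -1/2, a = 0 and the roles are exchanged: -α is half of Y, while β is a multiple of the
shifted coefficients of 3Y'²-Y'. -/
lemma det_fullMat_neg_half (h e : ℕ) (he : e ≤ 1) :
    (fullMat h e).det.eval (-1 / 2) * 3 ^ (h + e + h).choose 2 =
      ((1 / 2) ^ (h + e) * ((-1) ^ (h + e).choose 2 * ((1 / 2) ^ ((h + 1) * (h + e)) *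
        ((-1) ^ (h + 1).choose 2 * detU (h + e + h + 1))))) *
      ((-1 / 2) ^ h * ((-1) ^ h.choose 2 * ((-1 / 4) ^ ((h + e) * h) * ((-1) ^ (h + e).choose 2 *
        detE (h + e + h))))) := by
  have ha : aPoly.eval (-1 / 2) = 0 := by norm_num [aPoly]
  rw [eval_det_fullMat h e he (-1 / 2) (Or.inr ha)]
  set Y := PowerSeries.map (evalRingHom (-1 / 2 : ℚ)) serY with hYdef
  have hY0 : PowerSeries.constantCoeff Y = 1 := constantCoeff_map_serY _
  have hY : Y ^ 2 * (Y - 1) = PowerSeries.C (1 / 2) * PowerSeries.X := by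
    have := congrArg (PowerSeries.map (evalRingHom (-1 / 2 : ℚ))) serY_spec
    simp only [map_add, map_mul, PowerSeries.map_C, PowerSeries.map_X, map_sub, ← hYdef,
      coe_evalRingHom, eval_X, map_pow, map_one, ha, map_zero] at this
    rw [this, show (-1 / 2 : ℚ) = -(1 / 2) by norm_num, map_neg]
    ring
  obtain ⟨Y', hY0', hY', hZ1, hZ2⟩ := exists_recip_serZ (-1 / 2) (by norm_num) (by simp [ha])
  have hα (m : ℕ) : -(alpha m).eval (-1 / 2) = (1 / 2) * PowerSeries.coeff m Y := by
    rw [alpha, ← coe_evalRingHom, ← PowerSeries.coeff_map, ← map_neg, ← PowerSeries.coeff_C_mul]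
    congr 1
    simp only [map_mul, map_sub, PowerSeries.map_C, ← hYdef, coe_evalRingHom, ha, map_zero]
    have : (1 + X : ℚ[X]).eval (-1 / 2) = 1 / 2 := by norm_num
    rw [this]
    ring
  have hβ (m : ℕ) : (beta m).eval (-1 / 2) =
      (-1 / 2) * PowerSeries.coeff (m + 1) (3 * Y' ^ 2 - Y') := by
    rw [beta, ← coe_evalRingHom, ← PowerSeries.coeff_map, ← PowerSeries.coeff_succ_X_mul]
    have hc : ((1 + X) * (X + 2) : ℚ[X]).eval (-1 / 2) = 3 / 4 := by norm_num
    have h34 : (PowerSeries.C (3 / 4) : PowerSeries ℚ) = PowerSeries.C (-3 / 2) * PowerSeries.C (-1 / 2) := by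
      rw [← map_mul]
      norm_num
    have h1 : PowerSeries.X * PowerSeries.map (evalRingHom (-1 / 2)) (serZ *
        (serZ - PowerSeries.C ((1 + X) * (X + 2)))) =
        1 + PowerSeries.C (-1 / 2) * (3 * Y' ^ 2 - Y') := by
      have h12 : (PowerSeries.C (-1 / 2) : PowerSeries ℚ) * 2 = -1 := by
        rw [← map_ofNat (PowerSeries.C (R := ℚ)) 2, ← map_mul]
        norm_num
      have h32 : (PowerSeries.C (-3 / 2) : PowerSeries ℚ) = 3 * PowerSeries.C (-1 / 2) := by
        rw [← map_ofNat (PowerSeries.C (R := ℚ)) 3, ← map_mul]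
        norm_num
      rw [map_mul, map_sub, PowerSeries.map_C, coe_evalRingHom, hc, h34]
      rw [h32] 
      linear_combination hZ1 - 3 * PowerSeries.C (-1 / 2) * hZ2 - Y' * h12
    rw [h1, map_add, PowerSeries.coeff_C_mul, PowerSeries.coeff_one, if_neg (by omega), zero_add]
  simp only [hα, hβ]
  -- The block of size h+e has shift h+1 = (h+e) + (1-e), so the parity parameter is flipped here.
  have h1 := det_toeplitz_U Y (1 / 2) (by norm_num) hY0 hY (h + e) (1 - e) (by omega)
  have h2 := det_toeplitz_E Y' (-(-1 / 2) ^ 2) (by norm_num) hY0' hY' h e he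
  rw [show h + e + (1 - e) = h + 1 by omega, show h + 1 + (h + e) = h + e + h + 1 by ring] at h1
  have h3 : (Matrix.of fun p q : Fin h => (-1 / 2) * PowerSeries.coeff (e + p + q + 1) (3 * Y' ^ 2 - Y')) =
      (-1 / 2 : ℚ) • (Matrix.of fun p q : Fin h => PowerSeries.coeff (e + p + q + 1) (3 * Y' ^ 2 - Y')) := rfl
  have h4 : (Matrix.of fun p q : Fin (h + e) => (1 / 2) * PowerSeries.coeff (h + e + h - p - q) Y) =
      (1 / 2 : ℚ) • (Matrix.of fun p q : Fin (h + e) => PowerSeries.coeff (h + e + h - p - q) Y) := rfl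
  rw [h3, h4, Matrix.det_smul, Matrix.det_smul, Fintype.card_fin, Fintype.card_fin,
    hankel_rev (fun m => PowerSeries.coeff m Y),
    hankel_rev' (fun m => PowerSeries.coeff m (3 * Y' ^ 2 - Y')), ← prod_three_pow_half, ← h1]
  rw [show (-(-1 / 2) ^ 2 : ℚ) = -1 / 4 by norm_num] at h2
  rw [← h2]
  ring

end DegenerateValues

end SpecialPoly

namespace SpecialPoly

/-! ### Signs and powers of two at ζ = -2 and ζ = -1/2. -/

section DegenerateFinal

lemma choose_two_two_mul (h : ℕ) : (2 * h).choose 2 = 4 * h.choose 2 + h := by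
  have h1 := sq_eq_choose (2 * h)
  have h2 := sq_eq_choose h
  nlinarith

lemma delta_two_mul_sub_one_add (h : ℕ) : ThreeColour.delta (2 * h - 1) + h = h ^ 2 := by
  rcases h with _ | h
  · rfl
  · have : (2 * (h + 1) - 1) ^ 2 = 4 * (h ^ 2 + h) + 1 := by
      rw [show 2 * (h + 1) - 1 = 2 * h + 1 by omega]
      ring
    rw [ThreeColour.delta, this]
    have : (h + 1) ^ 2 = h ^ 2 + h + (h + 1) := by ring
    omega

lemma delta_two_mul (h : ℕ) : ThreeColour.delta (2 * h) = h ^ 2 := by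
  rw [ThreeColour.delta, show (2 * h) ^ 2 = 4 * h ^ 2 by ring, Nat.mul_div_cancel_left _ (by norm_num)]

lemma eval_special (h e : ℕ) (he : e ≤ 1) (p : ℚ[X]) (z : ℚ)
    (hp : ThreeColour.IsSpecialPolynomial (h + e + h) p) :
    2 ^ ThreeColour.delta (h + e + h - 1) * (-1) ^ (h + e + h + 1).choose 2 *
        (fullMat h e).det.eval z =
      2 ^ (h + e + h) ^ 2 * (1 + z) ^ ((h + e + h) ^ 2 + (h + e + h)) * p.eval z := by
  rw [isSpecialPolynomial_iff_det h e he] at hp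
  have := congrArg (eval z) hp
  simpa only [eval_mul, eval_pow, eval_ofNat, eval_neg, eval_one, eval_add, eval_X] using this

lemma neg_one_pow_sq_add (n : ℕ) : (-1 : ℚ) ^ (n ^ 2 + n) = 1 := by
  rw [sq_eq_choose, add_assoc, ← two_mul, ← mul_add, pow_mul, neg_one_sq, one_pow]

lemma eval_neg_two_even (h : ℕ) (p : ℚ[X]) (hp : ThreeColour.IsSpecialPolynomial (2 * h) p) :
    p.eval (-2) = ThreeColour.A (2 * h + 1) := by
  have e1 : h + 0 + h = 2 * h := by ring
  have h1 := eval_special h 0 (by norm_num) p (-2) (by rwa [e1])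
  have h2 := det_fullMat_neg_two h 0 (by norm_num)
  have h3 := (detE_mul_detU h).1
  rw [e1] at h1 h2
  rw [show (1 + -2 : ℚ) = -1 by norm_num, neg_one_pow_sq_add] at h1
  have hc : (3 : ℚ) ^ (2 * h).choose 2 ≠ 0 := by positivity
  have hd : (2 : ℚ) ^ (2 * h) ^ 2 ≠ 0 := by positivity
  apply mul_left_cancel₀ hc
  apply mul_left_cancel₀ hd
  have hT := sq_eq_choose h
  -- All signs, including the one from (-4)^{h²}, are collected; after reduction to `h.choose 2` the
  -- total exponent is visibly even.
  have hs : (-1 : ℚ) ^ (2 * h + 1).choose 2 * (-1) ^ (h + 0).choose 2 * (-1) ^ (h + 1).choose 2 *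
      (-1) ^ h * (-1) ^ h.choose 2 * (-1) ^ ((h + 0) * h) * (-1) ^ (h + 0).choose 2 = 1 := by
    rw [choose_two_succ, choose_two_succ, choose_two_two_mul, add_zero, ← sq, hT]
    simp only [← pow_add]
    exact Even.neg_one_pow ⟨5 * h.choose 2 + 3 * h, by ring⟩
  have h22 : (2 : ℚ) ^ ThreeColour.delta (2 * h - 1) * 2 ^ ((h + 1) * (h + 0)) * 4 ^ ((h + 0) * h) =
      2 ^ (2 * h) ^ 2 := by
    have := delta_two_mul_sub_one_add h
    rw [show (4 : ℚ) = 2 ^ 2 by norm_num, ← pow_mul, ← pow_add, ← pow_add]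
    congr 1
    nlinarith
  rw [show (-4 : ℚ) = (-1) * 4 by norm_num, mul_pow] at h2
  rw [mul_comm (3 ^ _) (ThreeColour.A _), ← h3]
  calc _ = (2 : ℚ) ^ ThreeColour.delta (2 * h - 1) * (-1) ^ (2 * h + 1).choose 2 *
        (eval (-2) (fullMat h 0).det * 3 ^ (2 * h).choose 2) := by
        linear_combination (-3 ^ (2 * h).choose 2) * h1
    _ = ((-1 : ℚ) ^ (2 * h + 1).choose 2 * (-1) ^ (h + 0).choose 2 * (-1) ^ (h + 1).choose 2 *
      (-1) ^ h * (-1) ^ h.choose 2 * (-1) ^ ((h + 0) * h) * (-1) ^ (h + 0).choose 2) *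
      ((2 : ℚ) ^ ThreeColour.delta (2 * h - 1) * 2 ^ ((h + 1) * (h + 0)) * 4 ^ ((h + 0) * h)) *
      (detE (2 * h + 1) * detU (2 * h)) := by
        rw [h2]
        ring
    _ = _ := by
        rw [hs, h22, one_mul]

lemma eval_neg_two_odd (h : ℕ) (p : ℚ[X]) (hp : ThreeColour.IsSpecialPolynomial (2 * h + 1) p) :
    p.eval (-2) = (-1) ^ (h + 1) * ThreeColour.C (2 * h + 2) := by
  have e1 : h + 1 + h = 2 * h + 1 := by ring
  have h1 := eval_special h 1 (by norm_num) p (-2) (by rwa [e1])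
  have h2 := det_fullMat_neg_two h 1 (by norm_num)
  have h3 := (detU_mul_detE h).2
  rw [e1] at h1 h2
  rw [show 2 * h + 1 - 1 = 2 * h by omega, delta_two_mul] at h1
  rw [show 2 * h + 1 + 1 = 2 * h + 2 by ring] at h1 h2
  rw [show (1 + -2 : ℚ) = -1 by norm_num, neg_one_pow_sq_add] at h1
  have hc : (3 : ℚ) ^ (2 * h + 1).choose 2 ≠ 0 := by positivity
  have hd : (2 : ℚ) ^ (2 * h + 1) ^ 2 ≠ 0 := by positivity
  apply mul_left_cancel₀ hc
  apply mul_left_cancel₀ hd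
  have hT := sq_eq_choose h
  have hs : (-1 : ℚ) ^ (2 * h + 2).choose 2 * (-1) ^ (h + 1).choose 2 * (-1) ^ (h + 1).choose 2 *
      (-1) ^ h * (-1) ^ h.choose 2 * (-1) ^ ((h + 1) * h) * (-1) ^ (h + 1).choose 2 =
      (-1) ^ (h + 1) := by
    have e2 : (-1 : ℚ) ^ (2 * (5 * h.choose 2 + 5 * h)) = 1 := by rw [pow_mul, neg_one_sq, one_pow]
    rw [show 2 * h + 2 = 2 * (h + 1) by ring, choose_two_two_mul, choose_two_succ,
      show (h + 1) * h = h ^ 2 + h by ring, hT]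
    simp only [← pow_add]
    refine (congrArg (fun m => (-1 : ℚ) ^ m) (?_ : _ = h + 1 + 2 * (5 * h.choose 2 + 5 * h))).trans ?_
    · ring
    · rw [pow_add, e2, mul_one]
  have h22 : (2 : ℚ) ^ h ^ 2 * 2 ^ ((h + 1) * (h + 1)) * 4 ^ ((h + 1) * h) =
      2 ^ (2 * h + 1) ^ 2 := by
    rw [show (4 : ℚ) = 2 ^ 2 by norm_num, ← pow_mul, ← pow_add, ← pow_add]
    congr 1
    ring
  rw [show (-4 : ℚ) = (-1) * 4 by norm_num, mul_pow] at h2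
  calc _ = (2 : ℚ) ^ h ^ 2 * (-1) ^ (2 * h + 2).choose 2 *
        (eval (-2) (fullMat h 1).det * 3 ^ (2 * h + 1).choose 2) := by
        linear_combination (-3 ^ (2 * h + 1).choose 2) * h1
    _ = ((-1 : ℚ) ^ (2 * h + 2).choose 2 * (-1) ^ (h + 1).choose 2 * (-1) ^ (h + 1).choose 2 *
      (-1) ^ h * (-1) ^ h.choose 2 * (-1) ^ ((h + 1) * h) * (-1) ^ (h + 1).choose 2) *
      ((2 : ℚ) ^ h ^ 2 * 2 ^ ((h + 1) * (h + 1)) * 4 ^ ((h + 1) * h)) *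
      (detE (2 * h + 2) * detU (2 * h + 1)) := by
        rw [h2]
        ring
    _ = _ := by
        rw [hs, h22, h3]
        ring

lemma eval_neg_half_even (h : ℕ) (p : ℚ[X]) (hp : ThreeColour.IsSpecialPolynomial (2 * h) p) :
    p.eval (-1 / 2) = ThreeColour.C (2 * h + 1) / 2 ^ (2 * h ^ 2 + 2 * h + 1) := by
  have e1 : h + 0 + h = 2 * h := by ring
  have h1 := eval_special h 0 (by norm_num) p (-1 / 2) (by rwa [e1])
  have h2 := det_fullMat_neg_half h 0 (by norm_num)
  have h3 := (detE_mul_detU h).2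
  rw [e1] at h1 h2
  have hc : (3 : ℚ) ^ (2 * h).choose 2 ≠ 0 := by positivity
  rw [eq_div_iff (by positivity)]
  apply mul_left_cancel₀ hc
  have hT := sq_eq_choose h
  have hs : (-1 : ℚ) ^ (2 * h + 1).choose 2 * (-1) ^ (h + 0).choose 2 * (-1) ^ (h + 1).choose 2 *
      (-1) ^ h * (-1) ^ h.choose 2 * (-1) ^ ((h + 0) * h) * (-1) ^ (h + 0).choose 2 = 1 := by
    rw [choose_two_succ, choose_two_succ, choose_two_two_mul, add_zero, ← sq, hT]
    simp only [← pow_add]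
    exact Even.neg_one_pow ⟨5 * h.choose 2 + 3 * h, by ring⟩
  have h22 : (2 : ℚ) ^ ThreeColour.delta (2 * h - 1) * ((2 : ℚ) ^ (2 * h) * (2 ^ (2 * h ^ 2 + 2 * h + 1))) =
      2 * (2 ^ (h + 0) * 2 ^ ((h + 1) * (h + 0)) * 2 ^ h * 4 ^ ((h + 0) * h)) := by
    have := delta_two_mul_sub_one_add h
    rw [show (4 : ℚ) = 2 ^ 2 by norm_num, ← pow_mul, ← pow_add, ← pow_add, ← pow_add, ← pow_add, ← pow_add,
      ← pow_succ']
    congr 1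
    nlinarith
  have hi (m : ℕ) : ((1 / 2 : ℚ)) ^ m * 2 ^ m = 1 := by
    rw [← mul_pow, one_div_mul_cancel two_ne_zero, one_pow]
  have hi4 (m : ℕ) : ((1 / 4 : ℚ)) ^ m * 4 ^ m = 1 := by
    rw [← mul_pow, one_div_mul_cancel (by norm_num), one_pow]
  rw [show (-1 / 2 : ℚ) = (-1) * (1 / 2) by norm_num, show (-1 / 4 : ℚ) = (-1) * (1 / 4) by norm_num,
    mul_pow, mul_pow] at h2
  rw [show (-1 / 2 : ℚ) = (-1) * (1 / 2) by norm_num] at h1 ⊢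
  rw [show (1 + -1 * (1 / 2) : ℚ) = 1 / 2 by norm_num, pow_add] at h1
  rw [mul_comm (3 ^ _) (ThreeColour.C _), ← h3]
  have h4 : p.eval (-1 * (1 / 2)) = 2 ^ ThreeColour.delta (2 * h - 1) * 2 ^ (2 * h) *
      (-1) ^ (2 * h + 1).choose 2 * (fullMat h 0).det.eval (-1 * (1 / 2)) := by
    linear_combination (-2 ^ (2 * h)) * h1 - p.eval (-1 * (1 / 2)) * hi ((2 * h) ^ 2) -
      p.eval (-1 * (1 / 2)) * ((1 / 2) ^ (2 * h) ^ 2 * 2 ^ (2 * h) ^ 2) * (hi (2 * h))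
  calc _ = (2 : ℚ) ^ ThreeColour.delta (2 * h - 1) * (2 ^ (2 * h) * (2 ^ (2 * h ^ 2 + 2 * h + 1))) *
        (-1) ^ (2 * h + 1).choose 2 *
        (eval (-1 * (1 / 2)) (fullMat h 0).det * 3 ^ (2 * h).choose 2) := by
        rw [h4]
        ring
    _ = ((-1 : ℚ) ^ (2 * h + 1).choose 2 * (-1) ^ (h + 0).choose 2 * (-1) ^ (h + 1).choose 2 *
      (-1) ^ h * (-1) ^ h.choose 2 * (-1) ^ ((h + 0) * h) * (-1) ^ (h + 0).choose 2) *
      (((1 / 2) ^ (h + 0) * 2 ^ (h + 0)) * ((1 / 2) ^ ((h + 1) * (h + 0)) * 2 ^ ((h + 1) * (h + 0))) *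
        ((1 / 2) ^ h * 2 ^ h) * ((1 / 4) ^ ((h + 0) * h) * 4 ^ ((h + 0) * h))) *
      (2 * (detU (2 * h + 1) * detE (2 * h))) := by
        rw [h2, h22]
        ring
    _ = _ := by
        rw [hs, hi, hi, hi, hi4]
        ring

lemma eval_neg_half_odd (h : ℕ) (p : ℚ[X]) (hp : ThreeColour.IsSpecialPolynomial (2 * h + 1) p) :
    p.eval (-1 / 2) = (-1) ^ (h + 1) * (ThreeColour.A (2 * h + 2) / 2 ^ (2 * (h + 1) ^ 2)) := by
  have e1 : h + 1 + h = 2 * h + 1 := by ring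
  have h1 := eval_special h 1 (by norm_num) p (-1 / 2) (by rwa [e1])
  have h2 := det_fullMat_neg_half h 1 (by norm_num)
  have h3 := (detU_mul_detE h).1
  rw [e1] at h1 h2
  rw [show 2 * h + 1 - 1 = 2 * h by omega, delta_two_mul] at h1
  rw [show 2 * h + 1 + 1 = 2 * h + 2 by ring] at h1 h2
  have hc : (3 : ℚ) ^ (2 * h + 1).choose 2 ≠ 0 := by positivity
  rw [← mul_div_assoc, eq_div_iff (by positivity)]
  apply mul_left_cancel₀ hc
  have hT := sq_eq_choose h
  have hs : (-1 : ℚ) ^ (2 * h + 2).choose 2 * (-1) ^ (h + 1).choose 2 * (-1) ^ (h + 1).choose 2 *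
      (-1) ^ h * (-1) ^ h.choose 2 * (-1) ^ ((h + 1) * h) * (-1) ^ (h + 1).choose 2 =
      (-1) ^ (h + 1) := by
    have e2 : (-1 : ℚ) ^ (2 * (5 * h.choose 2 + 5 * h)) = 1 := by rw [pow_mul, neg_one_sq, one_pow]
    rw [show 2 * h + 2 = 2 * (h + 1) by ring, choose_two_two_mul, choose_two_succ,
      show (h + 1) * h = h ^ 2 + h by ring, hT]
    simp only [← pow_add]
    refine (congrArg (fun m => (-1 : ℚ) ^ m) (?_ : _ = h + 1 + 2 * (5 * h.choose 2 + 5 * h))).trans ?_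
    · ring
    · rw [pow_add, e2, mul_one]
  have h22 : (2 : ℚ) ^ h ^ 2 * (2 ^ (2 * h + 1) * (2 ^ (2 * (h + 1) ^ 2))) =
      2 * (2 ^ (h + 1) * 2 ^ ((h + 1) * (h + 1)) * 2 ^ h * 4 ^ ((h + 1) * h)) := by
    rw [show (4 : ℚ) = 2 ^ 2 by norm_num, ← pow_mul, ← pow_add, ← pow_add, ← pow_add, ← pow_add, ← pow_add,
      ← pow_succ']
    congr 1
    ring
  have hi (m : ℕ) : ((1 / 2 : ℚ)) ^ m * 2 ^ m = 1 := by
    rw [← mul_pow, one_div_mul_cancel two_ne_zero, one_pow]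
  have hi4 (m : ℕ) : ((1 / 4 : ℚ)) ^ m * 4 ^ m = 1 := by
    rw [← mul_pow, one_div_mul_cancel (by norm_num), one_pow]
  rw [show (-1 / 2 : ℚ) = (-1) * (1 / 2) by norm_num, show (-1 / 4 : ℚ) = (-1) * (1 / 4) by norm_num,
    mul_pow, mul_pow] at h2
  rw [show (-1 / 2 : ℚ) = (-1) * (1 / 2) by norm_num] at h1 ⊢
  rw [show (1 + -1 * (1 / 2) : ℚ) = 1 / 2 by norm_num, pow_add (1 / 2 : ℚ)] at h1
  have h4 : p.eval (-1 * (1 / 2)) = 2 ^ h ^ 2 * 2 ^ (2 * h + 1) *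
      (-1) ^ (2 * h + 2).choose 2 * (fullMat h 1).det.eval (-1 * (1 / 2)) := by
    linear_combination (-2 ^ (2 * h + 1)) * h1 - p.eval (-1 * (1 / 2)) * hi ((2 * h + 1) ^ 2) -
      p.eval (-1 * (1 / 2)) * ((1 / 2) ^ (2 * h + 1) ^ 2 * 2 ^ (2 * h + 1) ^ 2) * (hi (2 * h + 1))
  calc _ = (2 : ℚ) ^ h ^ 2 * (2 ^ (2 * h + 1) * (2 ^ (2 * (h + 1) ^ 2))) *
        (-1) ^ (2 * h + 2).choose 2 *
        (eval (-1 * (1 / 2)) (fullMat h 1).det * 3 ^ (2 * h + 1).choose 2) := by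
        rw [h4]
        ring
    _ = ((-1 : ℚ) ^ (2 * h + 2).choose 2 * (-1) ^ (h + 1).choose 2 * (-1) ^ (h + 1).choose 2 *
      (-1) ^ h * (-1) ^ h.choose 2 * (-1) ^ ((h + 1) * h) * (-1) ^ (h + 1).choose 2) *
      (((1 / 2) ^ (h + 1) * 2 ^ (h + 1)) * ((1 / 2) ^ ((h + 1) * (h + 1)) * 2 ^ ((h + 1) * (h + 1))) *
        ((1 / 2) ^ h * 2 ^ h) * ((1 / 4) ^ ((h + 1) * h) * 4 ^ ((h + 1) * h))) *
      (2 * (detU (2 * h + 2) * detE (2 * h + 1))) := by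
        rw [h2, h22]
        ring
    _ = _ := by
        rw [hs, hi, hi, hi, hi4, h3]
        ring

lemma eval_neg_two_of_isSpecialPolynomial {n : ℕ} {p : ℚ[X]}
    (hp : ThreeColour.IsSpecialPolynomial n p) :
    p.eval (-2) = if Even n then ThreeColour.A (n + 1)
      else (-1) ^ ((n + 1) / 2) * ThreeColour.C (n + 1) := by
  rcases Nat.even_or_odd' n with ⟨h, rfl | rfl⟩
  · rw [if_pos (even_two_mul h), eval_neg_two_even h p hp]
  · rw [if_neg (by simp), eval_neg_two_odd h p hp, show (2 * h + 1 + 1) / 2 = h + 1 by omega]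

lemma eval_neg_half_of_isSpecialPolynomial {n : ℕ} {p : ℚ[X]}
    (hp : ThreeColour.IsSpecialPolynomial n p) :
    p.eval (-1 / 2) =
      if Even n then ThreeColour.C (n + 1) / 2 ^ ((n ^ 2 + 2 * n + 2) / 2)
      else (-1) ^ ((n + 1) / 2) * (ThreeColour.A (n + 1) / 2 ^ ((n + 1) ^ 2 / 2)) := by
  rcases Nat.even_or_odd' n with ⟨h, rfl | rfl⟩
  · rw [if_pos (even_two_mul h), eval_neg_half_even h p hp,
      show ((2 * h) ^ 2 + 2 * (2 * h) + 2) / 2 = 2 * h ^ 2 + 2 * h + 1 by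
        rw [show (2 * h) ^ 2 + 2 * (2 * h) + 2 = 2 * (2 * h ^ 2 + 2 * h + 1) by ring]
        omega]
  · rw [if_neg (by simp), eval_neg_half_odd h p hp, show (2 * h + 1 + 1) / 2 = h + 1 by omega,
      show (2 * h + 1 + 1) ^ 2 / 2 = 2 * (h + 1) ^ 2 by
        rw [show (2 * h + 1 + 1) ^ 2 = 2 * (2 * (h + 1) ^ 2) by ring]
        omega]

end DegenerateFinal

end SpecialPoly

namespace SpecialPoly

/-! ### Sorting rows by parity and decoupling the two blocks. -/

section ParityBlocks

/-- Exchange `inl k` and `inr k` for the indices `k` in `s`. -/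
def swapOn {n : ℕ} (s : Finset (Fin n)) : Fin n ⊕ Fin (n + 1) → Fin n ⊕ Fin (n + 1) :=
  Sum.elim (fun k => if k ∈ s then Sum.inr k.castSucc else Sum.inl k)
    (Fin.lastCases (Sum.inr (Fin.last n)) fun k => if k ∈ s then Sum.inl k else Sum.inr k.castSucc)

lemma swapOn_inr_castSucc {n : ℕ} (s : Finset (Fin n)) (k : Fin n) :
    swapOn s (Sum.inr k.castSucc) = if k ∈ s then Sum.inl k else Sum.inr k.castSucc := by
  simp [swapOn]

lemma swapOn_inr_last {n : ℕ} (s : Finset (Fin n)) :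
    swapOn s (Sum.inr (Fin.last n)) = Sum.inr (Fin.last n) := by
  simp [swapOn]

lemma swapOn_inl {n : ℕ} (s : Finset (Fin n)) (k : Fin n) :
    swapOn s (Sum.inl k) = if k ∈ s then Sum.inr k.castSucc else Sum.inl k := rfl

/-- One transposition for each element of s. -/
lemma det_swapOn {R : Type*} [CommRing R] {n : ℕ} (s : Finset (Fin n))
    (ψ : Fin n ⊕ Fin (n + 1) → Fin n ⊕ Fin (n + 1) → R) :
    (Matrix.of fun r => ψ (swapOn s r)).det = (-1) ^ s.card * (Matrix.of ψ).det := by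
  induction s using Finset.induction_on with
  | empty =>
    have : swapOn (∅ : Finset (Fin n)) = id := by
      funext r
      rcases r with k | k
      · simp [swapOn_inl]
      · induction k using Fin.lastCases with
        | last => exact swapOn_inr_last _
        | cast k => simp [swapOn_inr_castSucc]
    simp [this]
  | insert a s ha ih =>
    have h1 : swapOn (insert a s) = swapOn s ∘ Equiv.swap (Sum.inl a) (Sum.inr a.castSucc) := by
      funext r
      rw [Function.comp_apply]
      rcases r with k | k
      · by_cases hk : k = a
        · subst hk
          rw [Equiv.swap_apply_left, swapOn_inl, swapOn_inr_castSucc, if_pos (by simp), if_neg ha]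
        · rw [Equiv.swap_apply_of_ne_of_ne (by simpa using hk) (by simp), swapOn_inl, swapOn_inl]
          simp [hk]
      · induction k using Fin.lastCases with
        | last =>
          rw [Equiv.swap_apply_of_ne_of_ne (by simp) (by simpa using (Fin.castSucc_lt_last a).ne'),
            swapOn_inr_last, swapOn_inr_last]
        | cast k =>
          by_cases hk : k = a
          · subst hk
            rw [Equiv.swap_apply_right, swapOn_inl, swapOn_inr_castSucc, if_pos (by simp), if_neg ha]
          · rw [Equiv.swap_apply_of_ne_of_ne (by simp) (by simpa using hk), swapOn_inr_castSucc,
              swapOn_inr_castSucc]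
            simp [hk]
    have h2 := Matrix.det_permute (Equiv.swap (Sum.inl a) (Sum.inr a.castSucc))
      (Matrix.of fun r => ψ (swapOn s r))
    rw [ih, Equiv.Perm.sign_swap (by simp)] at h2
    rw [h1, Finset.card_insert_of_notMem ha, pow_succ]
    rw [show (-1 : R) ^ s.card * -1 * (Matrix.of ψ).det =
      ((-1 : ℤˣ) : ℤ) * ((-1) ^ s.card * (Matrix.of ψ).det) by push_cast; ring, ← h2]
    rfl

/-- A determinant whose rows are even or odd, expanded at two opposite points. -/
lemma det_parity {R : Type*} [CommRing R] {n : ℕ} (f : Fin n → ℕ → R) (g : Fin (n + 1) → ℕ → R)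
    (s : R) (hs : s * s = 1) :
    (Matrix.of fun r c : Fin n ⊕ Fin (n + 1) => Sum.elim
      (fun k => Sum.elim (fun j : Fin n => f k j) (fun j : Fin (n + 1) => -s * f k j) c)
      (fun k => Sum.elim (fun j : Fin n => g k j) (fun j : Fin (n + 1) => s * g k j) c) r).det =
    2 ^ n * (Matrix.of fun k j : Fin n => f k j).det *
      (s ^ (n + 1) * (Matrix.of fun k j : Fin (n + 1) => g k j).det) := by
  set M := Matrix.of fun r c : Fin n ⊕ Fin (n + 1) => Sum.elim
      (fun k => Sum.elim (fun j : Fin n => f k j) (fun j : Fin (n + 1) => -s * f k j) c)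
      (fun k => Sum.elim (fun j : Fin n => g k j) (fun j : Fin (n + 1) => s * g k j) c) r with hM
  -- The column operation subtracts s times the expansion at the second point: rows of one symmetry
  -- are doubled, rows of the other cancel.
  set E : Matrix (Fin n ⊕ Fin (n + 1)) (Fin n ⊕ Fin (n + 1)) R :=
    Matrix.fromBlocks 1 0 (Matrix.of fun i j => if i = j.castSucc then -s else 0) 1 with hE
  have hdE : E.det = 1 := by
    rw [hE, Matrix.det_fromBlocks_zero₁₂, Matrix.det_one, Matrix.det_one, one_mul]
  have h1 : M * E = Matrix.fromBlocks ((2 : R) • Matrix.of fun k j : Fin n => f k j)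
      (Matrix.of fun (k : Fin n) (j : Fin (n + 1)) => -s * f k j) 0
      (s • Matrix.of fun k j : Fin (n + 1) => g k j) := by
    ext r c
    rw [Matrix.mul_apply, Fintype.sum_sum_type]
    rcases r with k | k <;> rcases c with j | j
    · simp [hM, hE, Matrix.one_apply]
      linear_combination f k j * hs
    · simp [hM, hE, Matrix.one_apply]
    · simp [hM, hE, Matrix.one_apply]
      linear_combination (-g k j) * hs
    · simp [hM, hE, Matrix.one_apply]
  rw [← mul_one M.det, ← hdE, ← Matrix.det_mul, h1, Matrix.det_fromBlocks_zero₂₁, Matrix.det_smul,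
    Matrix.det_smul, Fintype.card_fin, Fintype.card_fin]

end ParityBlocks

/-! ### Chebyshev polynomials expanded at c = 2 and c = -2. -/

section ChebyshevDeterminants

lemma vdm_const_mul {R : Type*} [CommRing R] (c : R) (f : ℕ → R) (N : ℕ) :
    vdm (fun r => c * f r) N = c ^ N.choose 2 * vdm f N := by
  induction N with
  | zero => simp [vdm]
  | succ N ih =>
    rw [vdm_succ, vdm_succ, ih, choose_two_succ, pow_add]
    simp only [← mul_sub]
    rw [Finset.prod_mul_distrib, Finset.prod_const, Finset.card_range]
    ring

lemma det_cheb (e : ℕ → ℕ) (N : ℕ) :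
    (Matrix.of fun r j : Fin N => (cheb (e r)).coeff j).det =
      (∏ r ∈ Finset.range N, (e r : ℚ)) * vdm (fun r => (e r : ℚ) ^ 2) N /
        ∏ j ∈ Finset.range N, ((2 * j + 1).factorial : ℚ) := by
  rw [← det_odd_products (fun r => (e r : ℚ)) (fun i => (i + 1 : ℚ) ^ 2)
    (fun j => ((2 * j + 1).factorial : ℚ))]
  congr 1
  ext r j
  have : ((2 * (j : ℕ) + 1).factorial : ℚ) ≠ 0 := by positivity
  rw [Matrix.of_apply, Matrix.of_apply, eq_div_iff this, coeff_cheb_mul_factorial]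

lemma det_cheb_seqU (N : ℕ) :
    (Matrix.of fun r j : Fin N => (cheb (2 * seqU r)).coeff j).det =
      2 ^ N * 4 ^ N.choose 2 * detU N := by
  rw [det_cheb fun r => 2 * seqU r, detU]
  have h (r : ℕ) : ((2 * seqU r : ℕ) : ℚ) ^ 2 = 4 * (seqU r : ℚ) ^ 2 := by
    push_cast
    ring
  simp only [h]
  rw [vdm_const_mul]
  push_cast
  rw [Finset.prod_mul_distrib, Finset.prod_const, Finset.card_range]
  ring

lemma prod_pow_range {M : Type*} [CommMonoid M] (c : M) (n : ℕ) :
    ∏ j ∈ Finset.range n, c ^ j = c ^ n.choose 2 := by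
  rw [← prod_pow_val, Finset.prod_range]

lemma det_cheb_seqE (N : ℕ) :
    (Matrix.of fun r j : Fin N => (cheb (seqE r)).coeff j).det = 4 ^ N.choose 2 * detE N := by
  rw [det_cheb, detE, Finset.prod_mul_distrib, prod_pow_range]
  field_simp

lemma coeff_aeval_powerSeries_X (f : ℚ[X]) (j : ℕ) :
    PowerSeries.coeff j (aeval (PowerSeries.X : PowerSeries ℚ) f) = f.coeff j := by
  have : aeval (PowerSeries.X : PowerSeries ℚ) =
      (coeToPowerSeries.algHom ℚ : ℚ[X] →ₐ[ℚ] PowerSeries ℚ) := by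
    ext
    simp
  rw [this]
  simp

/-- X ↦ -4 - X is the reflection c ↦ -c, under which the Chebyshev polynomials are even or odd. -/
lemma aeval_reflect_cheb (e : ℕ) :
    aeval (-4 - PowerSeries.X : PowerSeries ℚ) (cheb (e + 1)) =
      (-1) ^ e * aeval (PowerSeries.X : PowerSeries ℚ) (cheb (e + 1)) := by
  have h : ∀ e, aeval (-4 - PowerSeries.X : PowerSeries ℚ) (cheb (e + 1)) =
      (-1) ^ e * aeval (PowerSeries.X : PowerSeries ℚ) (cheb (e + 1)) ∧
      aeval (-4 - PowerSeries.X : PowerSeries ℚ) (cheb (e + 2)) =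
      (-1) ^ (e + 1) * aeval (PowerSeries.X : PowerSeries ℚ) (cheb (e + 2)) := by
    intro e
    induction e with
    | zero =>
      simp [cheb, map_ofNat]
      ring
    | succ e ih =>
      refine ⟨ih.2, ?_⟩
      rw [show cheb (e + 1 + 2) = (X + 2) * cheb (e + 2) - cheb (e + 1) from rfl]
      simp only [map_sub, map_mul, map_add, aeval_X, map_ofNat, ih.1, ih.2]
      ring
  exact (h e).1

/-- The functionals expanding at `X = 0` and at `X = -4`. -/
noncomputable def oppositeCoeff (n : ℕ) : Fin n ⊕ Fin (n + 1) → ℚ[X] →ₗ[ℚ] ℚ :=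
  Sum.elim (fun j => localCoeff PowerSeries.X 1 j) (fun j => localCoeff (-4 - PowerSeries.X) 1 j)

lemma oppositeCoeff_inl_cheb {n : ℕ} (j : Fin n) (e : ℕ) :
    oppositeCoeff n (Sum.inl j) (cheb e) = (cheb e).coeff j := by
  rw [oppositeCoeff, Sum.elim_inl, localCoeff_apply, one_mul, coeff_aeval_powerSeries_X]

lemma oppositeCoeff_inr_cheb {n : ℕ} (j : Fin (n + 1)) (e : ℕ) :
    oppositeCoeff n (Sum.inr j) (cheb (e + 1)) = (-1) ^ e * (cheb (e + 1)).coeff j := by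
  rw [oppositeCoeff, Sum.elim_inr, localCoeff_apply, one_mul, aeval_reflect_cheb,
    show ((-1) ^ e : PowerSeries ℚ) = PowerSeries.C ((-1) ^ e) by simp, PowerSeries.coeff_C_mul,
    coeff_aeval_powerSeries_X]

/-- The indices `3k + 2` and `3k + 1`. -/
def chebIndex (n : ℕ) : Fin n ⊕ Fin (n + 1) → ℕ :=
  Sum.elim (fun k => 3 * (k : ℕ) + 2) (fun k => 3 * (k : ℕ) + 1)

/-- Exchanging 3k+1 and 3k+2 for k of parity opposite to n separates the even indices, which are
2·(1,2,4,5,…), from the odd ones 1,5,7,11,…. -/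
lemma chebIndex_swapOn (n : ℕ) (r : Fin n ⊕ Fin (n + 1)) :
    chebIndex n (swapOn (Finset.univ.filter fun k : Fin n => ((k : ℕ) + n) % 2 = 1) r) =
      Sum.elim (fun k : Fin n => if n % 2 = 0 then 2 * seqU k else seqE k)
        (fun k : Fin (n + 1) => if n % 2 = 0 then seqE k else 2 * seqU k) r := by
  rcases r with k | k
  · rw [swapOn_inl]
    split_ifs with h1 h2 h2 <;> simp [chebIndex, seqU, seqE] at h1 ⊢ <;> omega
  · induction k using Fin.lastCases with
    | last =>
      rw [swapOn_inr_last]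
      simp only [chebIndex, Sum.elim_inr, Fin.val_last, seqU, seqE]
      split_ifs <;> omega
    | cast k =>
      rw [swapOn_inr_castSucc]
      split_ifs with h1 h2 h2 <;> simp [chebIndex, seqU, seqE] at h1 ⊢ <;> omega

lemma card_filter_parity (n : ℕ) :
    (Finset.univ.filter fun k : Fin n => ((k : ℕ) + n) % 2 = 1).card = (n + 1) / 2 := by
  have h : ∀ n, ((Finset.range n).filter fun k => k % 2 = 1).card = n / 2 ∧
      ((Finset.range n).filter fun k => k % 2 = 0).card = (n + 1) / 2 := by
    intro n
    induction n with
    | zero => simp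
    | succ n ih =>
      rw [Finset.range_add_one, Finset.filter_insert, Finset.filter_insert]
      split_ifs with h1 h2 h2
      · omega
      · rw [Finset.card_insert_of_notMem (by simp), ih.1, ih.2]
        omega
      · rw [Finset.card_insert_of_notMem (by simp), ih.1, ih.2]
        omega
      · omega
  have h2 : (Finset.univ.filter fun k : Fin n => ((k : ℕ) + n) % 2 = 1).card =
      ((Finset.range n).filter fun k => (k + n) % 2 = 1).card := by
    rw [Finset.card_filter, Finset.card_filter, Finset.sum_range]
  rw [h2]
  rcases Nat.mod_two_eq_zero_or_one n with h3 | h3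
  · rw [Finset.filter_congr (q := fun k => k % 2 = 1) (fun k _ => by omega), (h n).1]
    omega
  · rw [Finset.filter_congr (q := fun k => k % 2 = 0) (fun k _ => by omega), (h n).2]

/-- After sorting, `det_parity` factors the determinant into one Vandermonde of each kind, of sizes
n and n+1. For either parity of n the product is the one that yields A rather than C. -/
lemma det_oppositeCoeff_cheb (n : ℕ) :
    (Matrix.of fun r c => oppositeCoeff n c (cheb (chebIndex n r))).det =
      (-1) ^ ((n + 1) / 2) * 4 ^ n * 4 ^ n ^ 2 * (3 ^ n.choose 2 * ThreeColour.A (n + 1)) := by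
  have h1 := det_swapOn (Finset.univ.filter fun k : Fin n => ((k : ℕ) + n) % 2 = 1)
    (fun r c => oppositeCoeff n c (cheb (chebIndex n r)))
  simp only [chebIndex_swapOn] at h1
  rw [card_filter_parity] at h1
  have h4 : (4 : ℚ) ^ n ^ 2 = 4 ^ n.choose 2 * 4 ^ (n + 1).choose 2 := by
    rw [← pow_add, choose_two_succ, sq_eq_choose]
    congr 1
    ring
  have hs := neg_one_pow_mul_self (R := ℚ) ((n + 1) / 2)
  have h22 : (4 : ℚ) ^ n = 2 ^ n * 2 ^ n := by rw [← mul_pow]; norm_num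
  have hU (m : ℕ) : ∃ e, 2 * seqU m = e + 1 ∧ Odd e := ⟨2 * seqU m - 1, by simp only [seqU]; omega,
    ⟨seqU m - 1, by simp only [seqU]; omega⟩⟩
  have hE (m : ℕ) : ∃ e, seqE m = e + 1 ∧ Even e := ⟨seqE m - 1, by simp only [seqE]; omega,
    ⟨3 * (m / 2) + 2 * (m % 2), by simp only [seqE]; omega⟩⟩
  have h1' := congrArg (fun y => (-1) ^ ((n + 1) / 2) * y) h1
  simp only [← mul_assoc] at h1'
  rw [hs, one_mul] at h1'
  rw [← h1']
  clear h1' h1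
  rcases Nat.even_or_odd' n with ⟨m, rfl | rfl⟩
  · have h3 := det_parity (fun (k : Fin (2 * m)) j => (cheb (2 * seqU k)).coeff j)
      (fun (k : Fin (2 * m + 1)) j => (cheb (seqE k)).coeff j) 1 (one_mul 1)
    rw [det_cheb_seqU, det_cheb_seqE] at h3
    have h5 := (detE_mul_detU m).1
    rw [show (Matrix.of fun r c => oppositeCoeff (2 * m) c (cheb (Sum.elim
      (fun k : Fin (2 * m) => if 2 * m % 2 = 0 then 2 * seqU k else seqE k)
        (fun k : Fin (2 * m + 1) => if 2 * m % 2 = 0 then seqE k else 2 * seqU k) r))) = _ from ?_, h3, h4, h22]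
    · linear_combination ((-1) ^ ((2 * m + 1) / 2) * 2 ^ (2 * m) * 2 ^ (2 * m) *
        4 ^ (2 * m).choose 2 * 4 ^ (2 * m + 1).choose 2) * h5
    · ext r c
      rcases r with k | k <;> rcases c with j | j <;>
        simp only [Matrix.of_apply, Sum.elim_inl, Sum.elim_inr, Nat.mul_mod_right, if_true]
      · exact oppositeCoeff_inl_cheb _ _
      · obtain ⟨e, he, hev⟩ := hU k
        rw [he, oppositeCoeff_inr_cheb, hev.neg_one_pow]
      · exact oppositeCoeff_inl_cheb _ _
      · obtain ⟨e, he, hev⟩ := hE k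
        rw [he, oppositeCoeff_inr_cheb, hev.neg_one_pow]
  · have h3 := det_parity (fun (k : Fin (2 * m + 1)) j => (cheb (seqE k)).coeff j)
      (fun (k : Fin (2 * m + 1 + 1)) j => (cheb (2 * seqU k)).coeff j) (-1) (by norm_num)
    rw [det_cheb_seqU, det_cheb_seqE, show 2 * m + 1 + 1 = 2 * (m + 1) by ring, pow_mul, neg_one_sq,
      one_pow] at h3
    have h5 := (detU_mul_detE m).1
    rw [show (Matrix.of fun r c => oppositeCoeff (2 * m + 1) c (cheb (Sum.elim
      (fun k : Fin (2 * m + 1) => if (2 * m + 1) % 2 = 0 then 2 * seqU k else seqE k)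
        (fun k : Fin (2 * m + 1 + 1) => if (2 * m + 1) % 2 = 0 then seqE k else 2 * seqU k) r))) = _ from ?_, h3, h4, h22]
    · rw [show 2 * m + 1 + 1 = 2 * m + 2 by ring, show 2 * (m + 1) = 2 * m + 2 by ring]
      rw [pow_succ (2 : ℚ) (2 * m + 1)]
      linear_combination ((-1) ^ ((2 * m + 2) / 2) * 2 ^ (2 * m + 1) * 2 ^ (2 * m + 1) *
        4 ^ (2 * m + 1).choose 2 * 4 ^ (2 * m + 2).choose 2) * h5
    · have h6 : ¬ (2 * m + 1) % 2 = 0 := by omega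
      ext r c
      rcases r with k | k <;> rcases c with j | j <;>
        simp only [Matrix.of_apply, Sum.elim_inl, Sum.elim_inr, if_neg h6]
      · exact oppositeCoeff_inl_cheb _ _
      · obtain ⟨e, he, hev⟩ := hE k
        rw [he, oppositeCoeff_inr_cheb, hev.neg_one_pow]
        norm_num
      · exact oppositeCoeff_inl_cheb _ _
      · obtain ⟨e, he, hev⟩ := hU k
        rw [he, oppositeCoeff_inr_cheb, hev.neg_one_pow]

end ChebyshevDeterminants

end SpecialPoly

namespace SpecialPoly

/-! ### The value at ζ = 1. -/

section ValueAtOne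

/-- The polynomial `c³ - 3c`, with `c = X + 2`. -/
noncomputable def cubicC : ℚ[X] := (X + 2) ^ 3 - 3 * (X + 2)

/-- The transform of `famW` at `ζ = 1` under `x = (c-1)/(c+1)`. -/
noncomputable def famT (n : ℕ) : Fin n ⊕ Fin (n + 1) → ℚ[X] :=
  Sum.elim (fun k => (4 * (X + 2) ^ 3 + 4) * (-2 * cubicC - 4) ^ (k : ℕ) * (2 * cubicC - 4) ^ (n - 1 - k))
    (fun k => (-2 * cubicC - 4) ^ (k : ℕ) * (2 * cubicC - 4) ^ (n - k))

/-- With s = c+1 the hypothesis is Y = (c-1)/(c+1). Clearing s³ turns P, Q, W into -2T-4, 2T-4 and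
4c³+4, where T = c³-3c. -/
lemma aeval_famW_one {n : ℕ} (Y s : PowerSeries ℚ) (h : s * Y = s - 2) (r : Fin n ⊕ Fin (n + 1)) :
    s ^ (3 * n) * aeval Y (famW (1 : ℚ) n r) = aeval (s - 3) (famT n r) := by
  have hP : s ^ 3 * aeval Y (polyP (1 : ℚ)) = aeval (s - 3) (-2 * cubicC - 4) := by
    simp only [polyP, cubicC, map_sub, map_mul, map_pow, map_add, map_neg, aeval_X, map_ofNat, map_one]
    rw [show s ^ 3 * (Y ^ 2 * (Y - (2 * 1 + 1))) = (s * Y) ^ 2 * (s * Y - 3 * s) by ring, h]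
    ring
  have hQ : s ^ 3 * aeval Y (polyQ (1 : ℚ)) = aeval (s - 3) (2 * cubicC - 4) := by
    simp only [polyQ, cubicC, map_sub, map_mul, map_pow, map_add, aeval_X, map_ofNat, map_one]
    rw [show s ^ 3 * ((1 + 2) * Y - 1) = s ^ 2 * (3 * (s * Y) - s) by ring, h]
    ring
  have hw : s ^ 3 * aeval Y (polyW (1 : ℚ)) = aeval (s - 3) (4 * (X + 2) ^ 3 + 4 : ℚ[X]) := by
    simp only [polyW, map_mul, map_pow, map_add, aeval_X, map_ofNat, map_one]
    rw [show s ^ 3 * ((1 + 2) * Y ^ 2 + 1) = s * (3 * (s * Y) ^ 2 + s ^ 2) by ring, h]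
    ring
  rcases r with k | k
  · simp only [famW, famT, Sum.elim_inl, map_mul, map_pow]
    have hk : n = k + (n - 1 - k) + 1 := by omega
    rw [← map_pow, ← hP, ← hQ, map_pow, ← hw]
    conv_lhs => rw [show s ^ (3 * n) = s ^ 3 * (s ^ 3) ^ (k : ℕ) * (s ^ 3) ^ (n - 1 - k) by
      rw [← pow_mul, ← pow_mul, ← pow_add, ← pow_add]; congr 1; omega]
    ring
  · simp only [famW, famT, Sum.elim_inr, map_mul, map_pow]
    rw [← hP, ← hQ]
    conv_lhs => rw [show s ^ (3 * n) = (s ^ 3) ^ (k : ℕ) * (s ^ 3) ^ (n - k) by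
      rw [← pow_mul, ← pow_mul, ← pow_add]; congr 1; omega]
    ring

/-- The powers of `cubicC` and their multiples by `c`. -/
noncomputable def famPow (n : ℕ) : Fin n ⊕ Fin (n + 1) → ℚ[X] :=
  Sum.elim (fun k => (X + 2) * cubicC ^ (k : ℕ)) (fun k => cubicC ^ (k : ℕ))

variable {n : ℕ} (L : Fin n ⊕ Fin (n + 1) → ℚ[X] →ₗ[ℚ] ℚ)

/-- A triangular expansion: `(y + z)^m = y^m + ⋯`. -/
lemma mul_add_C_pow_sub (V : Submodule ℚ ℚ[X]) (u y : ℚ[X]) (z : ℚ) (m : ℕ)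
    (h : ∀ i < m, u * y ^ i ∈ V) : u * (y + C z) ^ m - u * y ^ m ∈ V := by
  rw [add_pow, Finset.sum_range_succ, Nat.sub_self, pow_zero, mul_one, Nat.choose_self, Nat.cast_one,
    mul_one, mul_add, add_sub_cancel_right, Finset.mul_sum]
  refine Submodule.sum_mem _ fun i hi => ?_
  rw [show u * (y ^ i * C z ^ (m - i) * (m.choose i : ℚ[X])) =
    C (z ^ (m - i) * m.choose i) * (u * y ^ i) by simp; ring, ← smul_eq_C_mul]
  exact Submodule.smul_mem _ _ (h i (Finset.mem_range.1 hi))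

/-- The keys ordering `inr k` before `inl k`. -/
def lowKey (n : ℕ) : Fin n ⊕ Fin (n + 1) → ℕ :=
  Sum.elim (fun k => 2 * (k : ℕ) + 1) (fun k => 2 * (k : ℕ))

lemma lowKey_injective (n : ℕ) : Function.Injective (lowKey n) := by
  rintro (a | a) (b | b) h <;> simp [lowKey] at h ⊢ <;> omega

/-- The reversed keys. -/
def highKey (n : ℕ) : Fin n ⊕ Fin (n + 1) → ℕ :=
  Sum.elim (fun k => 2 * (n - k) + 1) (fun k => 2 * (n - k))

lemma highKey_injective (n : ℕ) : Function.Injective (highKey n) := by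
  rintro (a | a) (b | b) h <;> simp [highKey] at h ⊢ <;> omega

/-- The family `famT` with the factor of degree three replaced by `c`. -/
noncomputable def famT1 (n : ℕ) : Fin n ⊕ Fin (n + 1) → ℚ[X] :=
  Sum.elim (fun k => (X + 2) * (-2 * cubicC - 4) ^ (k : ℕ) * (2 * cubicC - 4) ^ (n - 1 - k))
    (fun k => (-2 * cubicC - 4) ^ (k : ℕ) * (2 * cubicC - 4) ^ (n - k))

/-- The powers of `-2 cubicC - 4` and their multiples by `c`. -/
noncomputable def famT2 (n : ℕ) : Fin n ⊕ Fin (n + 1) → ℚ[X] :=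
  Sum.elim (fun k => (X + 2) * (-2 * cubicC - 4) ^ (k : ℕ)) (fun k => (-2 * cubicC - 4) ^ (k : ℕ))

/-- 4c³+4 = 12c + (4T+4), and 4T+4 is a combination of -2T-4 and 2T-4, which only adds rows of the
other half. -/
lemma det_famT : (Matrix.of fun r c => L c (famT n r)).det =
    12 ^ n * (Matrix.of fun r c => L c (famT1 n r)).det := by
  rw [det_functional_triangular L (famT1 n) (famT n) (Sum.elim (fun _ => 12) (fun _ => 1))
    (Sum.elim (fun k => n + 1 + (k : ℕ)) (fun k => (k : ℕ)))]
  · simp [Fintype.prod_sum_type]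
  · rintro (a | a) (b | b) h <;> simp at h ⊢ <;> omega
  · rintro (k | k)
    · have h1 : famT n (Sum.inl k) - (12 : ℚ) • famT1 n (Sum.inl k) =
          (-3 / 2 : ℚ) • famT1 n (Sum.inr k.succ) + (1 / 2 : ℚ) • famT1 n (Sum.inr k.castSucc) := by
        simp only [famT, famT1, Sum.elim_inl, Sum.elim_inr, Fin.val_succ, Fin.val_castSucc]
        rw [show n - (k + 1) = n - 1 - (k : ℕ) by omega, show n - (k : ℕ) = n - 1 - k + 1 by omega]
        have e1 : C (-3 / 2 : ℚ) = -3 * C (1 / 2) := by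
          rw [show (-3 / 2 : ℚ) = (-3) * (1 / 2) by norm_num, C_mul]
          simp [map_ofNat]
        have e2 : (2 : ℚ[X]) * C (1 / 2) = 1 := by
          rw [show (2 : ℚ[X]) = C 2 from rfl, ← C_mul, mul_one_div_cancel (by norm_num), C_1]
        simp only [smul_eq_C_mul, e1]
        rw [show C (12 : ℚ) = 12 from rfl, pow_succ _ (k : ℕ), pow_succ _ (n - 1 - (k : ℕ))]
        generalize (-2 * cubicC - 4) ^ (k : ℕ) = A
        generalize (2 * cubicC - 4) ^ (n - 1 - (k : ℕ)) = B
        rw [cubicC]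
        linear_combination (-4 * A * B * ((X + 2) ^ 3 - 3 * (X + 2) + 1)) * e2
      refine (congrArg (· ∈ _) h1).mpr ?_
      refine add_mem (Submodule.smul_mem _ _ (Submodule.subset_span ⟨_, ?_, rfl⟩))
        (Submodule.smul_mem _ _ (Submodule.subset_span ⟨_, ?_, rfl⟩))
      · simp
        omega
      · simp
    · simp [famT, famT1]

lemma two_mul_cubicC_sub (m : ℕ) :
    (2 * cubicC - 4) ^ m = C ((-1) ^ m) * ((-2 * cubicC - 4) + C 8) ^ m := by
  rw [C_pow, ← mul_pow]
  congr 1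
  rw [show (C 8 : ℚ[X]) = 8 from rfl, C_neg, C_1]
  ring

lemma pow_mul_add_C_pow_sub (V : Submodule ℚ ℚ[X]) (u y : ℚ[X]) (z : ℚ) (m k : ℕ)
    (h : ∀ i, 0 < i → i ≤ m → u * y ^ (k + i) ∈ V) :
    u * y ^ k * (y + C z) ^ m - C (z ^ m) * (u * y ^ k) ∈ V := by
  rw [add_pow, Finset.sum_range_succ', Nat.sub_zero, pow_zero, one_mul, Nat.choose_zero_right,
    Nat.cast_one, mul_one, C_pow, mul_add, mul_comm (C z ^ m), add_sub_cancel_right, Finset.mul_sum]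
  refine Submodule.sum_mem _ fun i hi => ?_
  rw [show u * y ^ k * (y ^ (i + 1) * C z ^ (m - (i + 1)) * (m.choose (i + 1) : ℚ[X])) =
    C (z ^ (m - (i + 1)) * m.choose (i + 1)) * (u * y ^ (k + (i + 1))) by
      simp; ring, ← smul_eq_C_mul]
  exact Submodule.smul_mem _ _ (h _ (Nat.succ_pos _) (by simpa using hi))

lemma prod_pow_rev {M : Type*} [CommMonoid M] (c : M) (n m : ℕ) (h : n ≤ m) :
    ∏ k : Fin n, c ^ (m - 1 - (k : ℕ)) = c ^ (n.choose 2 + n * (m - n)) := by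
  rw [← Finset.prod_range fun k => c ^ (m - 1 - k), Finset.prod_pow_eq_pow_sum]
  congr 1
  induction n with
  | zero => simp
  | succ n ih =>
    rw [Finset.sum_range_succ, ih (by omega), choose_two_succ]
    obtain ⟨d, rfl⟩ := Nat.exists_eq_add_of_le h
    rw [show n + 1 + d - n = d + 1 by omega, show n + 1 + d - 1 - n = d by omega,
      show n + 1 + d - (n + 1) = d by omega]
    ring

/-- Since 2T-4 = -((-2T-4)+8), expanding in powers of -2T-4 is triangular with the lowest power
leading; hence the reversed keys and the factors -8. -/
lemma det_famT1 : (Matrix.of fun r c => L c (famT1 n r)).det =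
    (-8) ^ n ^ 2 * (Matrix.of fun r c => L c (famT2 n r)).det := by
  rw [det_functional_triangular L (famT2 n) (famT1 n)
    (Sum.elim (fun k => (-8) ^ (n - 1 - (k : ℕ))) (fun k => (-8) ^ (n + 1 - 1 - (k : ℕ)))) (highKey n)
    (highKey_injective n)]
  · rw [Fintype.prod_sum_type]
    simp only [Sum.elim_inl, Sum.elim_inr]
    rw [prod_pow_rev _ _ _ le_rfl, prod_pow_rev _ _ _ le_rfl, ← pow_add, choose_two_succ, sq_eq_choose]
    congr 2
    simp
    ring
  · have h8 (m : ℕ) : (-8 : ℚ) ^ m = (-1) ^ m * 8 ^ m := by rw [← mul_pow]; norm_num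
    rintro (k | k)
    · simp only [famT1, Sum.elim_inl, famT2, two_mul_cubicC_sub, h8]
      rw [mul_left_comm, smul_eq_C_mul, C_mul, mul_assoc (C _), ← mul_sub, ← smul_eq_C_mul]
      refine Submodule.smul_mem _ _ (pow_mul_add_C_pow_sub _ _ _ _ _ _ fun i hi him => ?_)
      exact Submodule.subset_span ⟨Sum.inl ⟨k + i, by omega⟩, by simp [highKey]; omega, rfl⟩
    · simp only [famT1, Sum.elim_inr, famT2, two_mul_cubicC_sub, h8, Nat.add_sub_cancel]
      rw [mul_left_comm, smul_eq_C_mul, C_mul, mul_assoc (C _), ← mul_sub, ← smul_eq_C_mul]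
      refine Submodule.smul_mem _ _ ?_
      have := pow_mul_add_C_pow_sub (Submodule.span ℚ (famT2 n '' {s | highKey n s < highKey n (Sum.inr k)}))
        1 (-2 * cubicC - 4) 8 (n - k) k fun i hi him => by
        rw [one_mul]
        exact Submodule.subset_span ⟨Sum.inr ⟨k + i, by omega⟩, by simp [highKey]; omega, rfl⟩
      rwa [one_mul] at this

lemma det_famT2 : (Matrix.of fun r c => L c (famT2 n r)).det =
    (-2) ^ n ^ 2 * (Matrix.of fun r c => L c (famPow n r)).det := by
  rw [det_functional_triangular L (famPow n) (famT2 n)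
    (Sum.elim (fun k => (-2) ^ (k : ℕ)) (fun k => (-2) ^ (k : ℕ))) (lowKey n) (lowKey_injective n)]
  · rw [Fintype.prod_sum_type]
    simp only [Sum.elim_inl, Sum.elim_inr]
    rw [prod_pow_val, prod_pow_val, ← pow_add, choose_two_succ, sq_eq_choose]
    congr 2
    ring
  · have h2 (m : ℕ) : (-2 * cubicC - 4) ^ m = C ((-2) ^ m) * (cubicC + C 2) ^ m := by
      rw [C_pow, ← mul_pow]
      congr 1
      rw [show (C 2 : ℚ[X]) = 2 from rfl, C_neg, show (C 2 : ℚ[X]) = 2 from rfl]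
      ring
    rintro (k | k)
    · simp only [famPow, Sum.elim_inl, famT2, h2]
      rw [mul_left_comm, smul_eq_C_mul, ← mul_sub, ← smul_eq_C_mul]
      refine Submodule.smul_mem _ _ (mul_add_C_pow_sub _ _ _ _ _ fun i hi => ?_)
      exact Submodule.subset_span ⟨Sum.inl ⟨i, by omega⟩, by simp [lowKey]; omega, rfl⟩
    · simp only [famPow, Sum.elim_inr, famT2, h2]
      rw [smul_eq_C_mul, ← mul_sub, ← smul_eq_C_mul]
      refine Submodule.smul_mem _ _ ?_
      have := mul_add_C_pow_sub (Submodule.span ℚ (famPow n '' {s | lowKey n s < lowKey n (Sum.inr k)}))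
        1 cubicC 2 k fun i hi => by
        rw [one_mul]
        exact Submodule.subset_span ⟨Sum.inr ⟨i, by omega⟩, by simp [lowKey]; omega, rfl⟩
      rwa [one_mul, one_mul] at this

/-- The functions `1, c, T, cT, T², …` with `T = cubicC`. -/
noncomputable def powC (r : ℕ) : ℚ[X] := cubicC ^ (r / 2) * (X + 2) ^ (r % 2)

/-- By `cheb_add_six` two steps in r amount to multiplication by T = c³-3c, so the Chebyshev
polynomials of index prime to 3 are unitriangular over 1, c, T, cT, …. -/
lemma cheb_seqU_sub_mem (r : ℕ) :
    cheb (seqU r) - powC r ∈ Submodule.span ℚ (powC '' Set.Iio r) := by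
  have hmono {a b : ℕ} (hab : a ≤ b) :
      Submodule.span ℚ (powC '' Set.Iio a) ≤ Submodule.span ℚ (powC '' Set.Iio b) :=
    Submodule.span_mono (Set.image_mono (Set.Iio_subset_Iio hab))
  have hin {a b : ℕ} (hab : a < b) : powC a ∈ Submodule.span ℚ (powC '' Set.Iio b) :=
    Submodule.subset_span ⟨a, hab, rfl⟩
  have hT (a : ℕ) : cubicC * powC a = powC (a + 2) := by
    rw [powC, powC, Nat.add_mod_right, Nat.add_div_right _ (by norm_num), pow_succ]
    ring
  have hmul {a : ℕ} {f : ℚ[X]} (hf : f ∈ Submodule.span ℚ (powC '' Set.Iio a)) :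
      cubicC * f ∈ Submodule.span ℚ (powC '' Set.Iio (a + 2)) := by
    refine Submodule.span_induction ?_ (by simp) (fun x y _ _ hx hy => by
      rw [mul_add]; exact add_mem hx hy) (fun c x _ hx => by
      rw [mul_smul_comm]; exact Submodule.smul_mem _ _ hx) hf
    rintro _ ⟨b, hb, rfl⟩
    rw [hT]
    exact hin (Nat.add_lt_add_right hb 2)
  induction r using Nat.strong_induction_on with
  | _ r ih =>
    match r, ih with
    | 0, _ => simp [seqU, cheb, powC]
    | 1, _ => simp [seqU, cheb, powC]
    | 2, _ =>
      have : cheb (seqU 2) - powC 2 = powC 1 := by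
        simp [seqU, cheb, powC, cubicC]
        ring
      rw [this]
      exact hin (by norm_num)
    | 3, _ =>
      have : cheb (seqU 3) - powC 3 = powC 0 := by
        simp [seqU, cheb, powC, cubicC]
        ring
      rw [this]
      exact hin (by norm_num)
    | r + 4, ih =>
      have h1 : cheb (seqU (r + 4)) - powC (r + 4) =
          cubicC * (cheb (seqU (r + 2)) - powC (r + 2)) - ((cheb (seqU r) - powC r) + powC r) := by
        rw [show seqU (r + 4) = seqU r + 6 by simp only [seqU]; omega,
          show seqU (r + 2) = seqU r + 3 by simp only [seqU]; omega, cheb_add_six,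
          twentySeven_mul_cubicT, mul_sub, hT, ← cubicC]
        ring
      rw [h1]
      exact sub_mem (hmul (ih (r + 2) (by omega)))
        (add_mem (hmono (by omega) (ih r (by omega))) (hin (by omega)))

lemma det_cheb_chebIndex : (Matrix.of fun r c => L c (cheb (chebIndex n r))).det =
    (Matrix.of fun r c => L c (famPow n r)).det := by
  have hp (r : Fin n ⊕ Fin (n + 1)) : famPow n r = powC (lowKey n r) := by
    rcases r with k | k
    · simp only [famPow, lowKey, Sum.elim_inl, powC]
      rw [show (2 * (k : ℕ) + 1) / 2 = k by omega, show (2 * (k : ℕ) + 1) % 2 = 1 by omega]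
      ring
    · simp only [famPow, lowKey, Sum.elim_inr, powC]
      rw [show 2 * (k : ℕ) / 2 = k by omega, show 2 * (k : ℕ) % 2 = 0 by omega]
      ring
  have hs (r : Fin n ⊕ Fin (n + 1)) : chebIndex n r = seqU (lowKey n r) := by
    rcases r with k | k <;> simp only [chebIndex, lowKey, Sum.elim_inl, Sum.elim_inr, seqU] <;> omega
  rw [det_functional_triangular L (famPow n) _ (fun _ => 1) (lowKey n) (lowKey_injective n)]
  · simp
  · intro r
    rw [one_smul, hs, hp]
    refine Submodule.span_mono ?_ (cheb_seqU_sub_mem _)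
    rintro _ ⟨m, hm, rfl⟩
    have hm : m < lowKey n r := hm
    have hlt : m < 2 * n + 1 := by
      rcases r with k | k <;> simp only [lowKey, Sum.elim_inl, Sum.elim_inr] at hm <;> omega
    have : ∃ s, lowKey n s = m := by
      rcases Nat.even_or_odd' m with ⟨k, rfl | rfl⟩
      · exact ⟨Sum.inr ⟨k, by omega⟩, rfl⟩
      · exact ⟨Sum.inl ⟨k, by omega⟩, rfl⟩
    obtain ⟨s, rfl⟩ := this
    exact ⟨s, hm, hp s⟩

/-- At ζ = 1 the points are b = 1/3 and a = 3. The expansions are Y = (c-1)/(c+1) at c = 2+τ and at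
c = -2-τ, so the weights s^{3n} turn the local functionals into `oppositeCoeff`. -/
lemma det_localCoeff_famW_one (n : ℕ) :
    coefDet (famW (1 : ℚ) n) ((X - C (1 / 3)) ^ n * (X - C 3) ^ (n + 1)) *
      ((2 / 9) ^ n.choose 2 * 27 ^ (n * n) *
        ((8 / 3) ^ (n * (n + 1)) * (-2) ^ (n + 1).choose 2 * (-1) ^ (n * (n + 1)))) =
      12 ^ n * 16 ^ n ^ 2 * ((-1) ^ ((n + 1) / 2) * 4 ^ n * 4 ^ n ^ 2 *
        (3 ^ n.choose 2 * ThreeColour.A (n + 1))) := by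
  have h3 : ((3 + PowerSeries.X : PowerSeries ℚ))⁻¹ * (3 + PowerSeries.X) = 1 :=
    PowerSeries.inv_mul_cancel _ (by simp [map_ofNat])
  have h1 : ((1 + PowerSeries.X : PowerSeries ℚ))⁻¹ * (1 + PowerSeries.X) = 1 :=
    PowerSeries.inv_mul_cancel _ (by simp)
  have key := det_localCoeff (p := n) (q := n + 1) (3 : ℚ) (1 / 3)
    (PowerSeries.C (-2) * (1 + PowerSeries.X)⁻¹) (PowerSeries.C (2 / 3) * (3 + PowerSeries.X)⁻¹)
    ((-1 - PowerSeries.X) ^ (3 * n)) ((3 + PowerSeries.X) ^ (3 * n)) (famW 1 n)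
  have hm : (Matrix.of fun r c : Fin n ⊕ Fin (n + 1) => (Sum.elim
      (fun j : Fin n => localCoeff (PowerSeries.C (1 / 3 : ℚ) + PowerSeries.X *
        (PowerSeries.C (2 / 3) * (3 + PowerSeries.X)⁻¹)) ((3 + PowerSeries.X) ^ (3 * n)) j)
      (fun j : Fin (n + 1) => localCoeff (PowerSeries.C (3 : ℚ) + PowerSeries.X *
        (PowerSeries.C (-2) * (1 + PowerSeries.X)⁻¹)) ((-1 - PowerSeries.X) ^ (3 * n)) j) c) (famW 1 n r)) =
      Matrix.of fun r c => oppositeCoeff n c (famT n r) := by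
    have e3 : (3 : PowerSeries ℚ) * PowerSeries.C (1 / 3) = 1 := by
      rw [show (3 : PowerSeries ℚ) = PowerSeries.C 3 from rfl, ← map_mul, mul_one_div_cancel (by norm_num),
        map_one]
    have e23 : (PowerSeries.C (2 / 3 : ℚ)) = 2 * PowerSeries.C (1 / 3) := by
      rw [show (2 / 3 : ℚ) = 2 * (1 / 3) by norm_num, map_mul, map_ofNat]
    ext r c
    rcases c with j | j <;> simp only [Matrix.of_apply, Sum.elim_inl, Sum.elim_inr, oppositeCoeff,
      localCoeff_apply, one_mul]
    · rw [aeval_famW_one]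
      · congr 3
        ring
      · rw [e23]
        linear_combination (2 * PowerSeries.C (1 / 3) * PowerSeries.X) * h3 + (1 + PowerSeries.X) * e3
    · rw [aeval_famW_one]
      · congr 3
        ring
      · rw [show PowerSeries.C (3 : ℚ) = 3 from rfl, show PowerSeries.C (-2 : ℚ) = -2 by simp [map_ofNat]]
        linear_combination (2 * PowerSeries.X) * h1
  rw [hm, det_famT, det_famT1, det_famT2, ← det_cheb_chebIndex, det_oppositeCoeff_cheb] at key
  have h16 : (16 : ℚ) ^ n ^ 2 = (-8) ^ n ^ 2 * (-2) ^ n ^ 2 := by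
    rw [← mul_pow]
    norm_num
  rw [h16]
  simp only [mul_assoc] at key ⊢
  rw [key]
  congr 1
  have c3 : PowerSeries.constantCoeff ((3 + PowerSeries.X : PowerSeries ℚ)) = 3 := by
    simp [map_ofNat]
  have c1 : PowerSeries.constantCoeff ((1 + PowerSeries.X : PowerSeries ℚ)) = 1 := by
    simp
  have c1' : PowerSeries.constantCoeff ((-1 - PowerSeries.X : PowerSeries ℚ)) = -1 := by
    simp
  simp only [map_mul, map_pow, PowerSeries.constantCoeff_inv, c1, c3, c1', PowerSeries.constantCoeff_C]
  rw [Finset.prod_mul_distrib, Finset.prod_mul_distrib, Finset.prod_mul_distrib, prod_pow_val,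
    prod_pow_val]
  simp only [Finset.prod_const, Finset.card_univ, Fintype.card_fin]
  have e1 : ((3 : ℚ) ^ (3 * n)) ^ n = 27 ^ (n * n) := by
    rw [pow_mul, ← pow_mul]
    norm_num
  have e2 : (((-1 : ℚ)) ^ (3 * n)) ^ (n + 1) = (-1) ^ (n * (n + 1)) := by
    rw [pow_mul, ← pow_mul]
    norm_num
  have e4 : (((3 : ℚ) - 1 / 3) ^ n) ^ (n + 1) = (8 / 3) ^ (n * (n + 1)) := by
    rw [← pow_mul]
    norm_num
  rw [e1, e2, e4]
  norm_num
  ring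

lemma neg_one_pow_choose_two_succ (n : ℕ) : (-1 : ℚ) ^ (n + 1).choose 2 = (-1) ^ ((n + 1) / 2) := by
  rcases Nat.even_or_odd' n with ⟨m, rfl | rfl⟩
  · rw [choose_two_succ, choose_two_two_mul, show (2 * m + 1) / 2 = m by omega,
      show 4 * m.choose 2 + m + 2 * m = m + 2 * (2 * m.choose 2 + m) by ring, pow_add, pow_mul _ 2]
    simp
  · rw [show 2 * m + 1 + 1 = 2 * (m + 1) by ring, choose_two_two_mul,
      show 2 * (m + 1) / 2 = m + 1 by omega,
      show 4 * (m + 1).choose 2 + (m + 1) = (m + 1) + 2 * (2 * (m + 1).choose 2) by ring, pow_add,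
      pow_mul _ 2]
    simp

lemma delta_add_delta (n : ℕ) : ThreeColour.delta (n - 1) + ThreeColour.delta n = n.choose 2 := by
  induction n with
  | zero => rfl
  | succ n ih =>
    rw [Nat.add_sub_cancel, delta_succ, choose_two_succ]
    omega

lemma eval_one_of_isSpecialPolynomial {n : ℕ} {p : ℚ[X]} (hp : ThreeColour.IsSpecialPolynomial n p) :
    p.eval 1 = 2 ^ ThreeColour.delta (n + 1) * ThreeColour.A (n + 1) := by
  rw [isSpecialPolynomial_iff] at hp
  have h1 := congrArg (evalRingHom (1 : ℚ)) hp
  simp only [map_mul, map_pow, map_add, map_ofNat, coe_evalRingHom, eval_X, one_pow, mul_one, aPoly,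
    map_one] at h1
  rw [show eval 1 (detHat (X : ℚ[X]) n) = detHat 1 n by
    have := map_detHat (evalRingHom (1 : ℚ)) X n
    simpa using this] at h1
  have h2 := coefDet_famV_eq_detHat (1 : ℚ) n (by norm_num) (by norm_num)
  have h3 := coefDet_famV (1 : ℚ) n ((X - C (1 / (1 + 2))) ^ n * (X - C (2 * 1 + 1)) ^ (n + 1))
  have h4 := det_localCoeff_famW_one n
  rw [show (1 / (1 + 2) : ℚ) = 1 / 3 by norm_num, show (2 * 1 + 1 : ℚ) = 3 by norm_num] at h2 h3
  rw [show (2 + 1 : ℚ) = 3 by norm_num] at h1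
  rw [show (1 * (1 + 1) : ℚ) = 2 by norm_num] at h3
  rw [show (1 + 2 : ℚ) = 3 by norm_num] at h1 h2 h3
  rw [show (1 + 1 : ℚ) = 2 by norm_num] at h2
  generalize coefDet (famW (1 : ℚ) n) _ = cW at h3 h4
  generalize coefDet (famV (1 : ℚ) n) _ = cV at h2 h3
  generalize detHat (1 : ℚ) n = H at h1 h2
  have hq : (-2 : ℚ) ^ (n + 1).choose 2 = (-1) ^ ((n + 1) / 2) * (2 ^ n.choose 2 * 2 ^ n) := by
    rw [← neg_one_pow_choose_two_succ, ← pow_add, ← choose_two_succ, ← mul_pow]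
    norm_num
  have hu : (3 : ℚ) ^ (n + ThreeColour.delta (n - 1)) * 3 ^ ThreeColour.delta n =
      3 ^ n * 3 ^ n.choose 2 := by
    rw [← pow_add, ← pow_add, add_assoc, delta_add_delta]
  have hn1 : (-1 : ℚ) ^ (n * (n + 1)) = 1 := (Nat.even_mul_succ_self n).neg_one_pow
  have hnn (x : ℚ) : x ^ n ^ 2 = (x ^ n.choose 2) ^ 2 * x ^ n := by
    rw [← pow_mul, ← pow_add, sq_eq_choose, mul_comm]
  have hnn1 (x : ℚ) : x ^ (n * (n + 1)) = (x ^ n.choose 2) ^ 2 * (x ^ n) ^ 2 := by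
    rw [← pow_mul, ← pow_mul, ← pow_add, mul_add, ← sq, sq_eq_choose]
    congr 1
    ring
  have hp (x : ℚ) (k m : ℕ) : (x ^ k) ^ m = (x ^ m) ^ k := pow_right_comm _ _ _
  have g4 (k : ℕ) : (4 : ℚ) ^ k = (2 ^ k) ^ 2 := by rw [hp]; norm_num
  have g16 (k : ℕ) : (16 : ℚ) ^ k = (2 ^ k) ^ 4 := by rw [hp]; norm_num
  have g27 (k : ℕ) : (27 : ℚ) ^ k = (3 ^ k) ^ 3 := by rw [hp]; norm_num
  have g12 (k : ℕ) : (12 : ℚ) ^ k = (2 ^ k) ^ 2 * 3 ^ k := by rw [hp, ← mul_pow]; norm_num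
  have g29 (k : ℕ) : (2 / 9 : ℚ) ^ k = 2 ^ k / (3 ^ k) ^ 2 := by rw [hp, ← div_pow]; norm_num
  have g83 (k : ℕ) : (8 / 3 : ℚ) ^ k = (2 ^ k) ^ 3 / 3 ^ k := by rw [hp, ← div_pow]; norm_num
  rw [delta_succ, pow_add]
  rw [mul_assoc _ (3 ^ _) (3 ^ _), hu] at h1
  rw [hn1, hq, hnn1, g29, g83, g83, ← sq, hnn, hnn, hnn, g12, g16, g16, g4, g4, g27, g27] at h4
  rw [hnn] at h1
  rw [pow_add, pow_add, hnn, hnn] at h2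
  have hs := neg_one_pow_mul_self (R := ℚ) ((n + 1) / 2)
  have ha : (2 : ℚ) ^ n ≠ 0 := by positivity
  have hb : (2 : ℚ) ^ n.choose 2 ≠ 0 := by positivity
  have hu0 : (3 : ℚ) ^ n ≠ 0 := by positivity
  have hv : (3 : ℚ) ^ n.choose 2 ≠ 0 := by positivity
  have hs0 : (-1 : ℚ) ^ ((n + 1) / 2) ≠ 0 := by simp
  generalize (2 : ℚ) ^ n = a at *
  generalize (2 : ℚ) ^ n.choose 2 = b at *
  generalize (3 : ℚ) ^ n = u at *
  generalize (3 : ℚ) ^ n.choose 2 = v at *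
  generalize (-1 : ℚ) ^ ((n + 1) / 2) = s at *
  generalize (2 : ℚ) ^ ThreeColour.delta (n - 1) = D at *
  generalize ThreeColour.A (n + 1) = A at *
  -- Every constant is a power of 2 or 3 with exponent linear in n, `n.choose 2` and δ; with these
  -- powers as independent symbols the rest is algebra.
  have h5 : cW * v = a ^ 3 * b ^ 4 * A := by
    field_simp at h4
    linear_combination h4
  have h7 : v * u * a ^ 2 * b ^ 2 * A = H := by
    apply mul_left_cancel₀ (mul_ne_zero (pow_ne_zero 2 hb) ha)
    apply mul_left_cancel₀ ha
    linear_combination h2 - (v ^ 2 * u) * h3 - (v * u * a) * h5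
  apply mul_left_cancel₀ (mul_ne_zero (mul_ne_zero (pow_ne_zero 2 hb) ha) (mul_ne_zero hu0 hv))
  linear_combination -h1 - D * h7

end ValueAtOne

end SpecialPoly

namespace SpecialPoly

/-! ### Top coefficients of determinants of polynomials. -/

section DegreeDet

lemma natDegree_prod_coeff_prod {R : Type*} [CommRing R] {ι : Type*} (s : Finset ι) (f : ι → R[X])
    (d : ι → ℕ) (h : ∀ i ∈ s, (f i).natDegree ≤ d i) :
    (∏ i ∈ s, f i).natDegree ≤ ∑ i ∈ s, d i ∧
      (∏ i ∈ s, f i).coeff (∑ i ∈ s, d i) = ∏ i ∈ s, (f i).coeff (d i) := by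
  classical
  induction s using Finset.induction_on with
  | empty => simp
  | insert a s ha ih =>
    have ih' := ih fun i hi => h i (Finset.mem_insert_of_mem hi)
    have h1 := h a (Finset.mem_insert_self a s)
    rw [Finset.prod_insert ha, Finset.prod_insert ha, Finset.sum_insert ha]
    exact ⟨natDegree_mul_le_of_le h1 ih'.1, by
      rw [coeff_mul_add_eq_of_natDegree_le h1 ih'.1, ih'.2]⟩

/-- The top coefficient of a determinant of polynomials with degrees bounded by `r i + c j`. -/
lemma natDegree_det_coeff_det {R : Type*} [CommRing R] {n : ℕ} (M : Matrix (Fin n) (Fin n) R[X])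
    (r c : Fin n → ℕ) (h : ∀ i j, (M i j).natDegree ≤ r i + c j) :
    M.det.natDegree ≤ ∑ i, r i + ∑ i, c i ∧
      M.det.coeff (∑ i, r i + ∑ i, c i) = (Matrix.of fun i j => (M i j).coeff (r i + c j)).det := by
  -- Every permutation has the same degree bound, so the top coefficient is itself a determinant.
  have hs (σ : Equiv.Perm (Fin n)) : ∑ i, (r (σ i) + c i) = ∑ i, r i + ∑ i, c i := by
    rw [Finset.sum_add_distrib, Equiv.sum_comp σ r]
  have hp (σ : Equiv.Perm (Fin n)) := natDegree_prod_coeff_prod Finset.univ (fun i => M (σ i) i)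
    (fun i => r (σ i) + c i) fun i _ => h _ _
  simp only [hs] at hp
  have hsgn (σ : Equiv.Perm (Fin n)) : (((Equiv.Perm.sign σ : ℤˣ) : ℤ) : R[X]) =
      C (((Equiv.Perm.sign σ : ℤˣ) : ℤ) : R) := by simp
  rw [Matrix.det_apply', Matrix.det_apply']
  simp only [hsgn]
  refine ⟨natDegree_sum_le_of_forall_le _ _ fun σ _ => (natDegree_C_mul_le _ _).trans (hp σ).1, ?_⟩
  rw [finsetSum_coeff]
  refine Finset.sum_congr rfl fun σ _ => ?_
  rw [coeff_C_mul, (hp σ).2]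
  rfl

end DegreeDet

/-! ### Degrees in ζ and the leading parts of the local series. -/

section WeightedSeries

/-- The coefficients of `F` of index `m < k` have degree at most `wm + d`. -/
def DegLE (w d k : ℕ) (F : PowerSeries ℚ[X]) : Prop :=
  ∀ m < k, (PowerSeries.coeff m F).natDegree ≤ w * m + d

/-- The coefficients of weight `wm + d`. -/
noncomputable def topSeries (w d : ℕ) (F : PowerSeries ℚ[X]) : PowerSeries ℚ :=
  PowerSeries.mk fun m => (PowerSeries.coeff m F).coeff (w * m + d)

variable {w d d' k : ℕ} {F G : PowerSeries ℚ[X]}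

lemma DegLE.mono (h : DegLE w d k F) (hd : d ≤ d') : DegLE w d' k F := fun m hm =>
  (h m hm).trans (Nat.add_le_add_left hd _)

lemma DegLE.add (hF : DegLE w d k F) (hG : DegLE w d k G) : DegLE w d k (F + G) := fun m hm => by
  rw [map_add]
  exact natDegree_add_le_of_degree_le (hF m hm) (hG m hm)

lemma DegLE.sub (hF : DegLE w d k F) (hG : DegLE w d k G) : DegLE w d k (F - G) := fun m hm => by
  rw [map_sub]
  exact natDegree_sub_le_of_le (hF m hm) (hG m hm) |>.trans (max_self _).le

lemma DegLE.mul (hF : DegLE w d k F) (hG : DegLE w d' k G) : DegLE w (d + d') k (F * G) := fun m hm => by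
  rw [PowerSeries.coeff_mul]
  refine natDegree_sum_le_of_forall_le _ _ fun p hp => ?_
  have hpm := Finset.HasAntidiagonal.mem_antidiagonal.1 hp
  refine (natDegree_mul_le_of_le (hF p.1 (by omega)) (hG p.2 (by omega))).trans ?_
  rw [← hpm]
  exact le_of_eq (by ring)

lemma degLE_C {f : ℚ[X]} (hf : f.natDegree ≤ d) : DegLE w d k (PowerSeries.C f) := fun m _ => by
  rw [PowerSeries.coeff_C]
  split_ifs with h
  · exact hf.trans (Nat.le_add_left _ _)
  · simp

lemma DegLE.X_mul (hF : DegLE w (d + w) k F) : DegLE w d (k + 1) (PowerSeries.X * F) := fun m hm => by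
  rcases m with _ | m
  · simp
  · rw [PowerSeries.coeff_succ_X_mul]
    exact (hF m (by omega)).trans (le_of_eq (by ring))

lemma topSeries_mul (hF : ∀ k, DegLE w d k F) (hG : ∀ k, DegLE w d' k G) :
    topSeries w (d + d') (F * G) = topSeries w d F * topSeries w d' G := by
  ext m
  rw [topSeries, PowerSeries.coeff_mk, PowerSeries.coeff_mul, PowerSeries.coeff_mul, finsetSum_coeff]
  refine Finset.sum_congr rfl fun p hp => ?_
  rw [← Finset.HasAntidiagonal.mem_antidiagonal.1 hp, show w * (p.1 + p.2) + (d + d') =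
    (w * p.1 + d) + (w * p.2 + d') by ring, coeff_mul_add_eq_of_natDegree_le (hF _ _ p.1.lt_succ_self)
    (hG _ _ p.2.lt_succ_self), topSeries, topSeries, PowerSeries.coeff_mk, PowerSeries.coeff_mk]

lemma topSeries_sub : topSeries w d (F - G) = topSeries w d F - topSeries w d G := by
  ext m
  simp [topSeries]

lemma topSeries_X_mul : topSeries w d (PowerSeries.X * F) = PowerSeries.X * topSeries w (d + w) F := by
  ext m
  rcases m with _ | m
  · simp [topSeries]
  · rw [topSeries, PowerSeries.coeff_mk, PowerSeries.coeff_succ_X_mul, PowerSeries.coeff_succ_X_mul,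
      topSeries, PowerSeries.coeff_mk]
    congr 1
    ring

lemma topSeries_C (f : ℚ[X]) :
    topSeries w d (PowerSeries.C f) = PowerSeries.C (f.coeff d) := by
  ext m
  rw [topSeries, PowerSeries.coeff_mk, PowerSeries.coeff_C, PowerSeries.coeff_C]
  split_ifs with h
  · simp [h]
  · simp

lemma natDegree_aPoly : aPoly.natDegree = 1 := by rw [aPoly]; compute_degree!

lemma coeff_aPoly : aPoly.coeff 1 = 2 := by simp [aPoly, coeff_one, ← C_ofNat]

lemma natDegree_X_add_two_mul_aPoly_le : ((X + 2) * aPoly).natDegree ≤ 2 := by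
  rw [aPoly]; compute_degree

lemma coeff_X_add_two_mul_aPoly : ((X + 2) * aPoly).coeff 2 = 2 := by
  have : (X + 2) * aPoly = C 2 * X ^ 2 + C 5 * X + C 2 := by
    rw [aPoly, show (C 2 : ℚ[X]) = 2 from rfl, show (C 5 : ℚ[X]) = 5 from rfl]
    ring
  rw [this]
  simp

/-- τ is given weight 2, matching the degree of (ζ+2)a in the recursion for U; the cubic term of
that recursion has one extra τ. -/
lemma degLE_serY (k : ℕ) : DegLE 2 0 k serY := by
  have hU : ∀ k, DegLE 2 2 k serU := by
    intro k
    induction k with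
    | zero => exact fun m hm => absurd hm (Nat.not_lt_zero m)
    | succ k ih =>
      rw [serU_spec]
      refine (degLE_C (by compute_degree)).add (DegLE.X_mul ?_)
      have h1 : DegLE 2 4 k (PowerSeries.C ((X + 2) * aPoly) * serU) :=
        (degLE_C (d := 2) natDegree_X_add_two_mul_aPoly_le).mul ih
      have h2 : DegLE 2 4 k (2 * serU ^ 2) := by
        rw [two_mul, sq]
        exact (ih.mul ih).add (ih.mul ih)
      have h3 : DegLE 2 4 k (PowerSeries.X * serU ^ 3) := by
        have : DegLE 2 6 k (serU ^ 3) := by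
          rw [pow_succ, sq]
          exact (ih.mul ih).mul ih
        exact fun m hm => (DegLE.X_mul (d := 4) this) m (by omega)
      exact (h1.sub h2).sub h3
  rw [serY]
  refine DegLE.add ?_ fun m hm => DegLE.X_mul (d := 0) (hU k) m (by omega)
  rw [← map_one PowerSeries.C]
  exact degLE_C (by simp)

lemma natDegree_alpha_le (m : ℕ) : (alpha m).natDegree ≤ 2 * m + 1 :=
  ((degLE_serY (m + 1)).mul (((degLE_C (d := 1) natDegree_aPoly.le).mul (degLE_serY (m + 1))).sub
    (degLE_C (d := 1) (by compute_degree)))).mono (by norm_num) m m.lt_succ_self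

lemma natDegree_beta_le (m : ℕ) : (beta m).natDegree ≤ 3 * m + 3 := by
  have hc : DegLE 3 2 (m + 1) (PowerSeries.C (aPoly * (X + 2))) :=
    degLE_C (by rw [mul_comm]; exact natDegree_X_add_two_mul_aPoly_le)
  have hZ : ∀ k ≤ m + 1, DegLE 3 1 k serZ := by
    intro k
    induction k with
    | zero => exact fun _ m hm => absurd hm (Nat.not_lt_zero m)
    | succ k ih =>
      intro hk
      have ih := ih (by omega)
      rw [serZ_spec]
      refine (degLE_C (by simp)).add (DegLE.X_mul ?_)
      rw [sq]
      exact (ih.mul ih).mul ((ih.mono (by norm_num)).sub fun j hj => hc j (by omega))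
  exact ((hZ _ le_rfl).mul (((hZ _ le_rfl).mono (d' := 2) (by norm_num)).sub
    (degLE_C (by compute_degree)))) m m.lt_succ_self

/-- The top coefficients of the `alpha m`. -/
noncomputable def alphaTop : PowerSeries ℚ := PowerSeries.mk fun m => (alpha m).coeff (2 * m + 1)

/-- Here Y is the part of top weight of `serY`. In its cubic the term ζτ has too small a degree to
contribute, so a factor Y cancels and a quadratic remains. -/
lemma exists_alphaTop : ∃ Y : PowerSeries ℚ, PowerSeries.constantCoeff Y = 1 ∧
    Y * (Y - 1) = 2 * PowerSeries.X ∧ alphaTop = Y * (2 * Y - 1) := by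
  have hY := degLE_serY
  have hC1 : ∀ k, DegLE 2 0 k (1 : PowerSeries ℚ[X]) := fun k => by
    rw [← map_one PowerSeries.C]
    exact degLE_C (by simp)
  have ht1 : topSeries 2 0 (1 : PowerSeries ℚ[X]) = 1 := by
    rw [← map_one PowerSeries.C, topSeries_C]
    simp
  have h0 : PowerSeries.constantCoeff (topSeries 2 0 serY) = 1 := by
    rw [← PowerSeries.coeff_zero_eq_constantCoeff_apply, topSeries, PowerSeries.coeff_mk]
    simp [serY]
  refine ⟨topSeries 2 0 serY, h0, ?_, ?_⟩
  · have h1 : topSeries 2 (0 + 0 + 0) (serY * serY * (serY - 1)) =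
        topSeries 2 0 serY * topSeries 2 0 serY * (topSeries 2 0 serY - 1) := by
      rw [topSeries_mul (fun k => (hY k).mul (hY k)) (fun k => (hY k).sub (hC1 k)),
        topSeries_mul hY hY, topSeries_sub, ht1]
    have h2 : topSeries 2 0 (PowerSeries.X * (PowerSeries.C ((X + 2) * aPoly) * serY -
        PowerSeries.C (X : ℚ[X]))) = PowerSeries.X * (PowerSeries.C 2 * topSeries 2 0 serY) := by
      rw [topSeries_X_mul, topSeries_sub, topSeries_C,
        topSeries_mul (d := 2) (d' := 0) (fun k => degLE_C natDegree_X_add_two_mul_aPoly_le) hY,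
        topSeries_C, coeff_X_add_two_mul_aPoly]
      simp [coeff_X]
    have h3 := serY_spec
    rw [sq] at h3
    rw [h3, h2, show PowerSeries.C (2 : ℚ) = 2 from rfl] at h1
    apply mul_left_cancel₀ (a := topSeries 2 0 serY)
    · intro h
      simp [h] at h0
    · linear_combination -h1
  · have : topSeries 2 (0 + (1 + 0)) (serY * (PowerSeries.C aPoly * serY - PowerSeries.C (1 + X))) =
        topSeries 2 0 serY * (2 * topSeries 2 0 serY - 1) := by
      have hd : (1 + X : ℚ[X]).natDegree ≤ 1 := by compute_degree
      have hc : (1 + X : ℚ[X]).coeff 1 = 1 := by simp [coeff_one]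
      rw [topSeries_mul hY (fun k => ((degLE_C (d := 1) natDegree_aPoly.le).mul (hY k)).sub
        (degLE_C hd)), topSeries_sub,
        topSeries_mul (d := 1) (fun k => degLE_C natDegree_aPoly.le) hY,
        topSeries_C, topSeries_C, coeff_aPoly, hc,
        map_one]
      rfl
    exact this

end WeightedSeries

/-! ### Central binomial coefficients and a Hessenberg determinant. -/

section CentralBinomial

/-- The generating function of the central binomial coefficients at `-2x`. -/
noncomputable def centralSeries : PowerSeries ℚ :=
  PowerSeries.mk fun m => (-2) ^ m * (Nat.centralBinom m : ℚ)

/-- The recurrence for central binomial coefficients is the differential equation (1+8x)f' = -4f;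
hence f²(1+8x) has derivative zero and constant term 1. -/
lemma centralSeries_sq : centralSeries ^ 2 * (1 + 8 * PowerSeries.X) = 1 := by
  have h1 : (1 + 8 * PowerSeries.X) * PowerSeries.derivative ℚ centralSeries = -4 * centralSeries := by
    ext m
    have e8 : (8 : PowerSeries ℚ) = PowerSeries.C 8 := rfl
    have e4 : (-4 : PowerSeries ℚ) = PowerSeries.C (-4) := by simp [map_ofNat]
    rw [add_mul, one_mul, map_add, e8, mul_assoc, e4, PowerSeries.coeff_C_mul, PowerSeries.coeff_C_mul]
    rcases m with _ | m
    · simp [PowerSeries.coeff_derivative, centralSeries, Nat.centralBinom]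
      norm_num [Nat.choose]
    · have h2 : ((m + 1 + 1 : ℕ) : ℚ) * (m + 1 + 1).centralBinom =
          2 * (2 * (m + 1 : ℕ) + 1) * (m + 1).centralBinom := by
        exact_mod_cast Nat.succ_mul_centralBinom_succ (m + 1)
      rw [PowerSeries.coeff_succ_X_mul, PowerSeries.coeff_derivative, PowerSeries.coeff_derivative,
        centralSeries, PowerSeries.coeff_mk, PowerSeries.coeff_mk, pow_succ _ (m + 1)]
      push_cast at h2 ⊢
      linear_combination (-2 * (-2) ^ (m + 1)) * h2
  apply PowerSeries.derivative.ext
  · have e8 : PowerSeries.derivative ℚ (8 : PowerSeries ℚ) = 0 := by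
      rw [show (8 : PowerSeries ℚ) = PowerSeries.C 8 from rfl]
      exact PowerSeries.derivative_C
    have e1 : PowerSeries.derivative ℚ (1 + 8 * PowerSeries.X) = 8 := by
      rw [map_add, Derivation.leibniz, e8, PowerSeries.derivative_X, Derivation.map_one_eq_zero]
      simp
    rw [Derivation.leibniz, e1, Derivation.leibniz_pow, Derivation.map_one_eq_zero]
    simp only [smul_eq_mul, nsmul_eq_mul]
    push_cast
    linear_combination (2 * centralSeries) * h1
  · simp [centralSeries]

/-- The coefficients of the inverse of `alphaTop`. -/
noncomputable def recipTop : PowerSeries ℚ :=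
  PowerSeries.mk fun m => (-2) ^ m * (Nat.centralBinom (m + 1) : ℚ) / 2

lemma alphaTop_mul_recipTop : alphaTop * recipTop = 1 := by
  obtain ⟨Y, hY0, hY, hA⟩ := exists_alphaTop
  have h1 : 4 * (PowerSeries.X * recipTop) = 1 - centralSeries := by
    ext m
    rw [show (4 : PowerSeries ℚ) = PowerSeries.C 4 from rfl, PowerSeries.coeff_C_mul]
    rcases m with _ | m
    · simp [centralSeries]
    · rw [PowerSeries.coeff_succ_X_mul, map_sub, PowerSeries.coeff_one, if_neg (Nat.succ_ne_zero m),
        recipTop, centralSeries, PowerSeries.coeff_mk, PowerSeries.coeff_mk, pow_succ]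
      ring
  have h2 := centralSeries_sq
  have h3 : (2 * Y - 1) * centralSeries = 1 := by
    -- Y(Y-1) = 2x gives (2Y-1)² = 1+8x, so 2Y-1 and `centralSeries` are inverse up to sign; the
    -- constant terms decide the sign.
    have h4 : ((2 * Y - 1) * centralSeries - 1) * ((2 * Y - 1) * centralSeries + 1) = 0 := by
      linear_combination h2 + 4 * centralSeries ^ 2 * hY
    rcases mul_eq_zero.1 h4 with h5 | h5
    · exact sub_eq_zero.1 h5
    · have := congrArg PowerSeries.constantCoeff h5
      simp [hY0, centralSeries, map_ofNat] at this
  have h4 : (4 * PowerSeries.X : PowerSeries ℚ) ≠ 0 := by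
    refine mul_ne_zero ?_ PowerSeries.X_ne_zero
    rw [show (4 : PowerSeries ℚ) = PowerSeries.C 4 from rfl]
    simp
  apply mul_left_cancel₀ h4
  rw [hA]
  linear_combination (Y * (2 * Y - 1)) * h1 + 2 * hY - Y * h3

/-- The determinant of a Hessenberg Toeplitz matrix is a coefficient of the inverse series. -/
lemma det_hessenberg {R : Type*} [CommRing R] (g r : PowerSeries R) (hg : PowerSeries.constantCoeff g = 1)
    (h : g * r = 1) (n : ℕ) :
    (Matrix.of fun k j : Fin n => if (k : ℕ) ≤ j + 1 then PowerSeries.coeff (j + 1 - k) g else 0).det =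
      (-1) ^ n * PowerSeries.coeff n r := by
  set G : Matrix (Fin (n + 1)) (Fin (n + 1)) R :=
    Matrix.of fun i j => if (j : ℕ) ≤ i then PowerSeries.coeff (i - j) g else 0 with hG
  have hdet : G.det = 1 := by
    rw [Matrix.det_of_isLowerTriangular]
    · refine Finset.prod_eq_one fun i _ => ?_
      simp [hG, hg]
    · intro i j hij
      have : i < j := hij
      simp [hG, not_le.2 this]
  have hv : G.mulVec (fun j => PowerSeries.coeff j r) = Pi.single 0 1 := by
    funext i
    have h1 := congrArg (PowerSeries.coeff (i : ℕ)) h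
    rw [mul_comm, PowerSeries.coeff_mul, Finset.Nat.sum_antidiagonal_eq_sum_range_succ
      (fun a b => PowerSeries.coeff a r * PowerSeries.coeff b g), PowerSeries.coeff_one] at h1
    have h2 : (Pi.single 0 1 : Fin (n + 1) → R) i = if (i : ℕ) = 0 then 1 else 0 := by
      rw [Pi.single_apply]
      exact if_congr Fin.ext_iff rfl rfl
    rw [h2, ← h1, Matrix.mulVec, dotProduct]
    simp only [hG, Matrix.of_apply]
    rw [← Finset.sum_range (fun j => (if j ≤ i then PowerSeries.coeff (i - j) g else 0) *
      PowerSeries.coeff j r), ← Finset.sum_subset (Finset.range_subset_range.2 i.2)]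
    · refine Finset.sum_congr rfl fun j hj => ?_
      rw [if_pos (by simpa [Nat.lt_succ_iff] using hj), mul_comm]
    · intro j _ hj
      rw [if_neg (by simpa [Nat.lt_succ_iff] using hj), zero_mul]
  -- Cramer's rule for the unitriangular Toeplitz system: the last unknown is the minor without the
  -- first row and the last column, up to sign.
  have hr : PowerSeries.coeff n r = G.adjugate (Fin.last n) 0 := by
    have h1 : G.adjugate.mulVec (G.mulVec (fun j => PowerSeries.coeff j r)) =
        fun j : Fin (n + 1) => PowerSeries.coeff j r := by
      rw [Matrix.mulVec_mulVec, Matrix.adjugate_mul, hdet, one_smul, Matrix.one_mulVec]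
    rw [hv] at h1
    have := congrFun h1 (Fin.last n)
    rw [Matrix.mulVec_single_one] at this
    simpa using this.symm
  rw [hr, Matrix.adjugate_fin_succ_eq_det_submatrix, ← Matrix.det_transpose]
  simp only [Fin.val_zero, Fin.val_last, zero_add]
  rw [← mul_assoc, neg_one_pow_mul_self, one_mul]
  refine congrArg Matrix.det (Matrix.ext fun k j => ?_)
  simp only [hG, Matrix.transpose_apply, Matrix.submatrix_apply, Matrix.of_apply,
    Fin.succAbove_zero, Fin.succAbove_last, Fin.val_succ, Fin.val_castSucc]

lemma det_alphaTop (n : ℕ) :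
    (Matrix.of fun k j : Fin n => if (k : ℕ) + j ≤ n then
      PowerSeries.coeff (n - k - j) alphaTop else 0).det =
      (-1) ^ n.choose 2 * 2 ^ n * ((n + 1).centralBinom / 2) := by
  obtain ⟨Y, hY0, -, hA⟩ := exists_alphaTop
  have h0 : PowerSeries.constantCoeff alphaTop = 1 := by
    rw [hA]
    simp [hY0, map_ofNat]
    norm_num
  have h1 := det_hessenberg alphaTop recipTop h0 alphaTop_mul_recipTop n
  have h2 := det_rev (Matrix.of fun k j : Fin n => if (k : ℕ) + j ≤ n then
      PowerSeries.coeff (n - k - j) alphaTop else 0)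
  rw [show (Matrix.of fun i j => (Matrix.of fun k j : Fin n => if (k : ℕ) + j ≤ n then
      PowerSeries.coeff (n - k - j) alphaTop else 0) i (Fin.rev j)) = _ from ?_, h1] at h2
  · rw [recipTop, PowerSeries.coeff_mk, show (-2 : ℚ) = (-1) * 2 by norm_num, mul_pow] at h2
    have hn := neg_one_pow_mul_self (R := ℚ) n
    have hc := neg_one_pow_mul_self (R := ℚ) (n.choose 2)
    generalize ((-1) ^ n : ℚ) = s at *
    generalize ((-1) ^ n.choose 2 : ℚ) = t at *
    generalize Matrix.det (n := Fin n) (R := ℚ) _ = D at h2 ⊢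
    linear_combination (-t) * h2 - D * hc + t * 2 ^ n * ((n + 1).centralBinom / 2) * hn
  · ext k j
    simp only [Matrix.of_apply, Fin.val_rev]
    have hj := j.2
    by_cases hk : (k : ℕ) ≤ j + 1
    · rw [if_pos hk, if_pos (by omega)]
      congr 2
      omega
    · rw [if_neg hk, if_neg (by omega)]

end CentralBinomial

end SpecialPoly

namespace SpecialPoly

/-! ### Degree and leading coefficient. -/

section LeadingTerm

/-- The reduced matrix with rows and columns scaled so that the entries are polynomials. -/
noncomputable def weightMat (n : ℕ) : Matrix (Fin n) (Fin n) ℚ[X] :=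
  Matrix.of fun k j =>
    (if n ≤ k + j then aPoly ^ (3 * (n - k)) * (X + 2) ^ (3 * (n - j) - 2) * beta (k + j - n) else 0) -
    (if (k : ℕ) + j ≤ n then aPoly ^ (3 * (j : ℕ) + 1) * (X + 2) ^ (3 * (k : ℕ)) * alpha (n - k - j)
      else 0)

lemma map_det_weightMat {K : Type*} [Field K] (ev : ℚ[X] →+* K) (n : ℕ) (ha : ev aPoly ≠ 0)
    (hg : ev X + 2 ≠ 0) :
    ev (weightMat n).det = (ev aPoly ^ 3) ^ (n + 1).choose 2 * ((ev X + 2) ^ 3) ^ n.choose 2 *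
      (hMat ev n).det := by
  have hg' : ev (X + 2) = ev X + 2 := by simp [map_ofNat]
  have h1 : ev.mapMatrix (weightMat n) = Matrix.of fun k j : Fin n =>
      ((ev aPoly ^ 3) ^ (n + 1 - 1 - (k : ℕ)) * ((ev X + 2) ^ 3) ^ (k : ℕ)) * hMat ev n k j := by
    ext k j
    have hj := j.2
    simp only [RingHom.mapMatrix_apply, Matrix.map_apply, weightMat, hMat, Matrix.of_apply, map_sub,
      mul_sub, Nat.add_sub_cancel, ← pow_mul (ev aPoly) 3, ← pow_mul (ev X + 2) 3]
    congr 1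
    · split_ifs with h
      · simp only [map_mul, map_pow, hg']
        rw [← pow_mul_inv_sq_cube hg (r := 3 * (k : ℕ)) (s := 3 * (n - j) - 2) (m := k + j - n) (by omega)]
        ring
      · simp
    · split_ifs with h
      · simp only [map_mul, map_pow, hg']
        rw [← pow_mul_inv_cube ha (r := 3 * (n - k)) (s := 3 * (j : ℕ) + 1) (m := n - k - j) (by omega)]
        ring
      · simp
  rw [RingHom.map_det, h1, Matrix.det_mul_column, Finset.prod_mul_distrib, prod_pow_rev _ _ _ (by omega),
    prod_pow_val, choose_two_succ]
  congr 3
  simp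

/-- The α term has degree at most 2n+2+k+j. The β term, present only for k+j ≥ n, has degree at most
3n+1, which is strictly smaller; it does not affect the top coefficient. -/
lemma natDegree_coeff_weightMat (n : ℕ) (k j : Fin n) :
    (weightMat n k j).natDegree ≤ 2 * n + 2 + k + j ∧
      (weightMat n k j).coeff (2 * n + 2 + k + j) = 2 * 8 ^ (j : ℕ) * -(if (k : ℕ) + j ≤ n then
        PowerSeries.coeff (n - k - j) alphaTop else 0) := by
  have hk := k.2
  have hj := j.2
  have hg : (X + 2 : ℚ[X]).natDegree ≤ 1 := by compute_degree
  have hg1 : (X + 2 : ℚ[X]).coeff 1 = 1 := by simp [← C_ofNat]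
  have ha := natDegree_aPoly.le
  have hpa (e : ℕ) : (aPoly ^ e).natDegree ≤ e := by simpa using natDegree_pow_le_of_le e ha
  have hpg (e : ℕ) : ((X + 2 : ℚ[X]) ^ e).natDegree ≤ e := by simpa using natDegree_pow_le_of_le e hg
  have hca (e : ℕ) : (aPoly ^ e).coeff e = 2 ^ e := by
    simpa [coeff_aPoly] using coeff_pow_of_natDegree_le (m := e) ha
  have hcg (e : ℕ) : ((X + 2 : ℚ[X]) ^ e).coeff e = 1 := by
    simpa [hg1] using coeff_pow_of_natDegree_le (m := e) hg
  have h1 : (if n ≤ k + j then aPoly ^ (3 * (n - k)) * (X + 2) ^ (3 * (n - j) - 2) * beta (k + j - n)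
      else 0 : ℚ[X]).natDegree < 2 * n + 2 + k + j := by
    split_ifs with h
    · refine (natDegree_mul_le_of_le (natDegree_mul_le_of_le (hpa _) (hpg _))
        (natDegree_beta_le _)).trans_lt ?_
      omega
    · simp
  have h2 : (if (k : ℕ) + j ≤ n then aPoly ^ (3 * (j : ℕ) + 1) * (X + 2) ^ (3 * (k : ℕ)) *
      alpha (n - k - j) else 0 : ℚ[X]).natDegree ≤ 2 * n + 2 + k + j ∧
      (if (k : ℕ) + j ≤ n then aPoly ^ (3 * (j : ℕ) + 1) * (X + 2) ^ (3 * (k : ℕ)) *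
      alpha (n - k - j) else 0 : ℚ[X]).coeff (2 * n + 2 + k + j) = 2 * 8 ^ (j : ℕ) *
        (if (k : ℕ) + j ≤ n then PowerSeries.coeff (n - k - j) alphaTop else 0) := by
    split_ifs with h
    · have e1 : 2 * n + 2 + k + j = 3 * (j : ℕ) + 1 + 3 * (k : ℕ) + (2 * (n - k - j) + 1) := by omega
      rw [e1]
      refine ⟨natDegree_mul_le_of_le (natDegree_mul_le_of_le (hpa _) (hpg _)) (natDegree_alpha_le _), ?_⟩
      rw [coeff_mul_add_eq_of_natDegree_le (natDegree_mul_le_of_le (hpa _) (hpg _))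
        (natDegree_alpha_le _), coeff_mul_add_eq_of_natDegree_le (hpa _) (hpg _), hca, hcg, alphaTop,
        PowerSeries.coeff_mk, pow_succ, pow_mul, show (2 : ℚ) ^ 3 = 8 by norm_num]
      ring
    · simp
  constructor
  · exact (natDegree_sub_le_of_le h1.le h2.1).trans (max_self _).le
  · rw [weightMat, Matrix.of_apply, coeff_sub, coeff_eq_zero_of_natDegree_lt h1, h2.2]
    ring

lemma natDegree_det_weightMat (n : ℕ) : (weightMat n).det.natDegree = 3 * n ^ 2 + n ∧
    (weightMat n).det.leadingCoeff =
      (-1) ^ n * (-1) ^ n.choose 2 * 2 ^ (2 * n) * 8 ^ n.choose 2 * ((n + 1).centralBinom / 2) := by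
  have h1 := natDegree_det_coeff_det (weightMat n) (fun k => 2 * n + 2 + k) (fun j => j)
    fun k j => (natDegree_coeff_weightMat n k j).1
  have hs : ∑ i : Fin n, (2 * n + 2 + (i : ℕ)) + ∑ i : Fin n, (i : ℕ) = 3 * n ^ 2 + n := by
    have : ∑ i : Fin n, (i : ℕ) = n.choose 2 := by
      rw [← Finset.sum_range fun i => i, Finset.sum_range_id, Nat.choose_two_right]
    rw [Finset.sum_add_distrib, this]
    simp only [Finset.sum_const, Finset.card_univ, Fintype.card_fin, smul_eq_mul]
    nlinarith [sq_eq_choose n]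
  rw [hs] at h1
  have h2 : (weightMat n).det.coeff (3 * n ^ 2 + n) =
      (-1) ^ n * (-1) ^ n.choose 2 * 2 ^ (2 * n) * 8 ^ n.choose 2 * ((n + 1).centralBinom / 2) := by
    rw [h1.2]
    simp only [(natDegree_coeff_weightMat n _ _).2]
    have h3 := Matrix.det_mul_row (fun j : Fin n => (2 * 8 ^ (j : ℕ) : ℚ)) (-Matrix.of fun k j : Fin n =>
      if (k : ℕ) + j ≤ n then PowerSeries.coeff (n - k - j) alphaTop else 0)
    rw [Matrix.det_neg, det_alphaTop, Finset.prod_mul_distrib, prod_pow_val] at h3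
    refine h3.trans ?_
    simp only [Finset.prod_const, Finset.card_univ, Fintype.card_fin]
    rw [pow_mul']
    ring
  have h0 : (weightMat n).det.coeff (3 * n ^ 2 + n) ≠ 0 := by
    rw [h2]
    have : ((n + 1).centralBinom : ℚ) ≠ 0 := by exact_mod_cast (n + 1).centralBinom_ne_zero
    have h3 (m : ℕ) : (-1 : ℚ) ^ m ≠ 0 := by simp
    have h4 : (2 : ℚ) ^ (2 * n) ≠ 0 := by positivity
    have h5 : (8 : ℚ) ^ n.choose 2 ≠ 0 := by positivity
    exact mul_ne_zero (mul_ne_zero (mul_ne_zero (mul_ne_zero (h3 _) (h3 _)) h4) h5)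
      (div_ne_zero this two_ne_zero)
  have hd := natDegree_eq_of_le_of_coeff_ne_zero h1.1 h0
  exact ⟨hd, by rw [leadingCoeff, hd, h2]⟩

/-- An identity of nonzero polynomials in which all factors except p have known degree and leading
coefficient. Common powers are left in place, as they drop out when degrees are compared. -/
lemma weightMat_det_eq {n : ℕ} {p : ℚ[X]} (hp : ThreeColour.IsSpecialPolynomial n p) :
    C (2 ^ ThreeColour.delta (n - 1) * (-1) ^ (n + 1).choose 2) * (X * aPoly) ^ (n ^ 2 + n) *
        (X + 2) ^ n ^ 2 * (weightMat n).det =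
      C (2 ^ n ^ 2) * aPoly ^ (3 * (n + 1).choose 2 + ThreeColour.delta n) *
        (X + 2) ^ (3 * n.choose 2 + n + ThreeColour.delta (n - 1)) *
        (1 + X) ^ (n ^ 2 + n) * X ^ (n ^ 2 + n) * p := by
  rw [isSpecialPolynomial_iff] at hp
  have hinj : Function.Injective (algebraMap ℚ[X] (RatFunc ℚ)) :=
    FaithfulSMul.algebraMap_injective _ _
  have hg := ratFunc_X_add_two_ne_zero
  have he' := ratFunc_one_add_X_ne_zero
  have h0 : (RatFunc.X : RatFunc ℚ) ≠ 0 := RatFunc.X_ne_zero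
  rw [← RatFunc.algebraMap_X] at hg he' h0
  have h1 := det_hMat_eq_detHat (algebraMap ℚ[X] (RatFunc ℚ)) n h0 ratFunc_aPoly_ne_zero
    hg he' two_ne_zero
  have h2 := map_det_weightMat (algebraMap ℚ[X] (RatFunc ℚ)) n ratFunc_aPoly_ne_zero hg
  have h3 := congrArg (algebraMap ℚ[X] (RatFunc ℚ)) hp
  simp only [map_mul, map_pow, map_add, map_ofNat, map_detHat] at h3
  apply hinj
  simp only [map_mul, map_pow, map_add, map_one, map_ofNat, map_neg]
  rw [h2]
  simp only [pow_add _ (3 * _), pow_add _ (3 * _ + _), pow_mul]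
  rw [pow_add _ n] at h3
  generalize (hMat (algebraMap ℚ[X] (RatFunc ℚ)) n).det = D at *
  generalize detHat (algebraMap ℚ[X] (RatFunc ℚ) X) n = H at *
  generalize algebraMap ℚ[X] (RatFunc ℚ) X = x at *
  generalize algebraMap ℚ[X] (RatFunc ℚ) aPoly = a at *
  linear_combination (2 ^ ThreeColour.delta (n - 1) * (a ^ 3) ^ (n + 1).choose 2 *
    ((x + 2) ^ 3) ^ n.choose 2) * h1 + ((a ^ 3) ^ (n + 1).choose 2 *
    ((x + 2) ^ 3) ^ n.choose 2 * (1 + x) ^ (n ^ 2 + n)) * h3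

lemma delta_eq_add (n : ℕ) : ThreeColour.delta n = ThreeColour.delta (n - 1) + n / 2 := by
  induction n with
  | zero => rfl
  | succ n ih =>
    rw [delta_succ, Nat.add_sub_cancel]
    omega

lemma natDegree_leadingCoeff_of_isSpecialPolynomial {n : ℕ} {p : ℚ[X]}
    (hp : ThreeColour.IsSpecialPolynomial n p) : p.natDegree = n * (n + 1) / 2 ∧
      p.leadingCoeff = ((2 * n + 2).choose (n + 1) : ℚ) / 2 ^ ((n + 2) / 2) := by
  have h := weightMat_det_eq hp
  obtain ⟨hd, hl⟩ := natDegree_det_weightMat n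
  have hm0 : (weightMat n).det ≠ 0 := by
    rw [← leadingCoeff_ne_zero, hl]
    have : ((n + 1).centralBinom : ℚ) ≠ 0 := by exact_mod_cast (n + 1).centralBinom_ne_zero
    have h3 (m : ℕ) : (-1 : ℚ) ^ m ≠ 0 := by simp
    have h4 : (2 : ℚ) ^ (2 * n) ≠ 0 := by positivity
    have h5 : (8 : ℚ) ^ n.choose 2 ≠ 0 := by positivity
    exact mul_ne_zero (mul_ne_zero (mul_ne_zero (mul_ne_zero (h3 _) (h3 _)) h4) h5)
      (div_ne_zero this two_ne_zero)
  have hC1 : (C (2 ^ ThreeColour.delta (n - 1) * (-1) ^ (n + 1).choose 2) : ℚ[X]) ≠ 0 := by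
    rw [Ne, C_eq_zero]
    simp
  have hC2 : (C (2 ^ n ^ 2) : ℚ[X]) ≠ 0 := by
    rw [Ne, C_eq_zero]
    simp
  have hx : (X : ℚ[X]) ≠ 0 := X_ne_zero
  have ha := aPoly_ne_zero
  have hg := X_add_two_ne_zero
  have he := one_add_X_ne_zero
  have hp0 : p ≠ 0 := by
    rintro rfl
    rw [mul_zero] at h
    exact mul_ne_zero (mul_ne_zero (mul_ne_zero hC1 (pow_ne_zero _ (mul_ne_zero hx ha)))
      (pow_ne_zero _ hg)) hm0 h
  have dg : (X + 2 : ℚ[X]).natDegree = 1 := by compute_degree!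
  have de : (1 + X : ℚ[X]).natDegree = 1 := by compute_degree!
  have lg : (X + 2 : ℚ[X]).leadingCoeff = 1 := by
    rw [leadingCoeff, dg]
    simp [← C_ofNat]
  have le : (1 + X : ℚ[X]).leadingCoeff = 1 := by
    rw [leadingCoeff, de]
    simp [coeff_one]
  have la : aPoly.leadingCoeff = 2 := by rw [leadingCoeff, natDegree_aPoly, coeff_aPoly]
  have hdeg := congrArg natDegree h
  have hlc := congrArg leadingCoeff h
  have e1 := sq_eq_choose n
  have e2 := choose_two_succ n
  have e3 := delta_add_delta n
  constructor
  · have q1 := pow_ne_zero (n ^ 2 + n) (mul_ne_zero hx ha)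
    have q2 := pow_ne_zero (n ^ 2) hg
    have q3 := pow_ne_zero (3 * (n + 1).choose 2 + ThreeColour.delta n) ha
    have q4 := pow_ne_zero (3 * n.choose 2 + n + ThreeColour.delta (n - 1)) hg
    have q5 := pow_ne_zero (n ^ 2 + n) he
    have q6 := pow_ne_zero (n ^ 2 + n) hx
    have l1 := mul_ne_zero hC1 q1
    have r1 := mul_ne_zero hC2 q3
    have r2 := mul_ne_zero r1 q4
    have r3 := mul_ne_zero r2 q5
    rw [natDegree_mul (mul_ne_zero l1 q2) hm0, natDegree_mul l1 q2, natDegree_mul hC1 q1,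
      natDegree_mul (mul_ne_zero r3 q6) hp0, natDegree_mul r3 q6, natDegree_mul r2 q5,
      natDegree_mul r1 q4, natDegree_mul hC2 q3] at hdeg
    simp only [natDegree_pow, natDegree_mul hx ha, natDegree_C, natDegree_X, natDegree_aPoly, dg, de,
      hd] at hdeg
    have : n * (n + 1) = n ^ 2 + n := by ring
    rw [this]
    omega
  · simp only [leadingCoeff_mul, leadingCoeff_pow, leadingCoeff_C, leadingCoeff_X, lg, le, la, hl,
      one_pow, mul_one, one_mul] at hlc
    have e4 := delta_eq_add n
    have hcb : ((2 * n + 2).choose (n + 1) : ℚ) = (n + 1).centralBinom := by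
      rw [Nat.centralBinom_eq_two_mul_choose]
      rfl
    rw [hcb, show (n + 2) / 2 = n / 2 + 1 by omega, eq_div_iff (by positivity)]
    have hs := neg_one_pow_mul_self (R := ℚ) n
    have hs' := neg_one_pow_mul_self (R := ℚ) (n.choose 2)
    have g8 (k : ℕ) : (8 : ℚ) ^ k = (2 ^ k) ^ 3 := by rw [pow_right_comm]; norm_num
    have g3 (k : ℕ) : (2 : ℚ) ^ (3 * k) = (2 ^ k) ^ 3 := by rw [mul_comm, pow_mul]
    have g2 (k : ℕ) : (2 : ℚ) ^ (2 * k) = (2 ^ k) ^ 2 := by rw [mul_comm, pow_mul]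
    rw [e2, e4, pow_add (2 : ℚ) (3 * _), g3, pow_add (2 : ℚ) _ n, pow_add (2 : ℚ) _ (n / 2),
      pow_add (2 : ℚ) _ n, pow_add (-1 : ℚ), g8, g2] at hlc
    rw [pow_succ]
    have b1 : (2 : ℚ) ^ ThreeColour.delta (n - 1) ≠ 0 := by positivity
    have b2 : (2 : ℚ) ^ n ^ 2 ≠ 0 := by positivity
    have b3 : (2 : ℚ) ^ n ≠ 0 := by positivity
    have b4 : (2 : ℚ) ^ n.choose 2 ≠ 0 := by positivity
    generalize (2 : ℚ) ^ ThreeColour.delta (n - 1) = t1 at *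
    generalize (2 : ℚ) ^ n ^ 2 = t2 at *
    generalize (2 : ℚ) ^ n = t3 at *
    generalize (2 : ℚ) ^ n.choose 2 = t4 at *
    generalize (2 : ℚ) ^ (n / 2) = t5 at *
    generalize (-1 : ℚ) ^ n = s1 at *
    generalize (-1 : ℚ) ^ n.choose 2 = s2 at *
    generalize ((n + 1).centralBinom : ℚ) = B at *
    apply mul_left_cancel₀ (mul_ne_zero (mul_ne_zero (mul_ne_zero b1 b2) (pow_ne_zero 3 b3))
      (pow_ne_zero 3 b4))
    linear_combination (-2) * hlc + t1 * t2 * t3 ^ 3 * t4 ^ 3 * B * (s2 * s2 * hs + hs')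

end LeadingTerm

end SpecialPoly

theorem mainTheorem10 (n : ℕ) :
    (∃! p : ℚ[X], ThreeColour.IsSpecialPolynomial n p) ∧
    ∀ p : ℚ[X], ThreeColour.IsSpecialPolynomial n p →
      p.natDegree = n * (n + 1) / 2 ∧
      p.leadingCoeff = ((2 * n + 2).choose (n + 1) : ℚ) / 2 ^ ((n + 2) / 2) ∧
      p.eval (-1) = (if n % 4 = 1 then -1 else 1) * 2 ^ ThreeColour.delta (n + 1) ∧
      p.eval 1 = 2 ^ ThreeColour.delta (n + 1) * ThreeColour.A (n + 1) ∧
      p.eval (-2) =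
        (if Even n then ThreeColour.A (n + 1)
          else (-1) ^ ((n + 1) / 2) * ThreeColour.C (n + 1)) ∧
      p.eval (-1 / 2) =
        (if Even n then ThreeColour.C (n + 1) / 2 ^ ((n ^ 2 + 2 * n + 2) / 2)
          else (-1) ^ ((n + 1) / 2) * (ThreeColour.A (n + 1) / 2 ^ ((n + 1) ^ 2 / 2))) := by
  refine ⟨SpecialPoly.existsUnique_isSpecialPolynomial n, fun p hp => ?_⟩
  obtain ⟨hdeg, hlead⟩ := SpecialPoly.natDegree_leadingCoeff_of_isSpecialPolynomial hp
  exact ⟨hdeg, hlead, SpecialPoly.eval_neg_one_of_isSpecialPolynomial hp,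
    SpecialPoly.eval_one_of_isSpecialPolynomial hp, SpecialPoly.eval_neg_two_of_isSpecialPolynomial hp,
    SpecialPoly.eval_neg_half_of_isSpecialPolynomial hp⟩
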